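/- Let $n\ge 0$, let $F_n$ be the free group on $x_1,\dots,x_n$, and let $R_n$ be the wedge of $n$ circles, with the $i$-th circle representing $x_i$. A *graph* is a finite cell complex of dimension $\le 1$; it is a *core graph* if every vertex has valence $\ge 2$. A *marked metric graph* of rank $n$ is a triple $(\Gamma,f,\ell)$ consisting of a core graph $\Gamma$, a homotopy equivalence $f:R_n\to\Gamma$ and positive lengths $\ell(e)$ of the edges of $\Gamma$ with $\sum_e\ell(e)=1$; $\Gamma$ is regarded as a geodesic metric space in which the edge $e$ has length $\ell(e)$. For a loop $\alpha$ in $\Gamma$ let $\ell(\alpha)$ be the length of the immersed loop freely homotopic to $\alpha$, or $0$ if $\alpha$ is nullhomotopic. The triples $(\Gamma,f,\ell)$ and $(\Gamma',f',\ell')$ are equivalent if there is a homeomorphism $\phi:\Gamma\to\Gamma'$ such that $\phi f\simeq f'$ and $\ell(\alpha)=\ell'(\phi(\alpha))$ for all loops $\alpha$ in $\Gamma$. Outer space $\mathcal X_n$ is the set of equivalence classes; we write $\Gamma$ for the class of $(\Gamma,f,\ell)$. The group $\mathrm{Out}(F_n)=\mathrm{Aut}(F_n)/\mathrm{Inn}(F_n)$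 acts on $\mathcal X_n$ on the right by $[(\Gamma,f,\ell)]\cdot\Phi=[(\Gamma,f\Phi,\ell)]$, where $\Phi$ is viewed as a homotopy equivalence $R_n\to R_n$, defined up to homotopy. A *difference of markings* from $(\Gamma,f,\ell)$ to $(\Gamma',f',\ell')$ is a map $\phi:\Gamma\to\Gamma'$ with $\phi f\simeq f'$ that is linear on edges, i.e. restricted to each edge it is a local geodesic of constant speed (its slope on that edge; slope $0$, a constant map, is allowed). Let $\sigma(\phi)$ be its maximal slope, let $$\sigma(\Gamma,\Gamma')=\inf\{\sigma(\phi)\mid \phi:\Gamma\to\Gamma'\text{ is a difference of markings}\},$$ and let $d(\Gamma,\Gamma')=\log\sigma(\Gamma,\Gamma')$. **Proposition 2.4.** The number $d(\Gamma,\Gamma')$ depends only on the classes of $\Gamma$ and $\Gamma'$ in $\mathcal X_n$, and for all $\Gamma,\Gamma',\Gamma''\in\mathcal X_n$ and $\Phi\in\mathrm{Out}(F_n)$: 1. $d(\Gamma,\Gamma')\ge 0$, with equality only when $\Gamma=\Gamma'$; 2. $d(\Gamma,\Gamma'')\le d(\Gamma,\Gamma')+d(\Gamma',\Gamma'')$;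 3. $d(\Gamma\cdot\Phi,\Gamma'\cdot\Phi)=d(\Gamma,\Gamma')$, i.e. $\mathrm{Out}(F_n)$ acts on $\mathcal X_n$ by isometries. -/

import Mathlib

open scoped RightActions

noncomputable section

namespace OuterSpace

open scoped unitInterval

/-! ### Finite graphs as cell complexes -/

/-- A combinatorial description of a finite cell complex of dimension at most one: a finite set `V`
of `0`-cells, a finite set `E` of `1`-cells (each with a chosen orientation), and the attaching maps.
Loops and multiple edges are allowed. -/
structure FinGraph where
  V : Type
  E : Type
  [finiteV : Finite V]
  [fintypeE : Fintype E]
  src : E → V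
  tgt : E → V

attribute [instance] FinGraph.finiteV FinGraph.fintypeE

namespace FinGraph

variable (G : FinGraph)

/-- The disjoint union of one point for each vertex and one copy of `[0,1]` for each edge. -/
abbrev Cells : Type := (Σ _ : G.V, PUnit.{1}) ⊕ (Σ _ : G.E, I)

/-- The endpoints of each interval are glued to the endpoints of the edge. -/
inductive Glue : G.Cells → G.Cells → Prop
  | src (e : G.E) : Glue (Sum.inr ⟨e, 0⟩) (Sum.inl ⟨G.src e, PUnit.unit⟩)
  | tgt (e : G.E) : Glue (Sum.inr ⟨e, 1⟩) (Sum.inl ⟨G.tgt e, PUnit.unit⟩)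

/-- The geometric realization, with the quotient (that is, the CW) topology. -/
def Realization : Type := Quot G.Glue

instance : TopologicalSpace G.Realization := inferInstanceAs (TopologicalSpace (Quot G.Glue))

variable {G}

def vert (v : G.V) : G.Realization := Quot.mk _ (Sum.inl ⟨v, PUnit.unit⟩)

/-- The characteristic map of the closed edge `e`. -/
def edge (e : G.E) (t : I) : G.Realization := Quot.mk _ (Sum.inr ⟨e, t⟩)

lemma edge_zero (e : G.E) : edge e 0 = vert (G.src e) := Quot.sound (Glue.src e)

lemma edge_one (e : G.E) : edge e 1 = vert (G.tgt e) := Quot.sound (Glue.tgt e)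

lemma continuous_edge (e : G.E) : Continuous (edge e) := by
  unfold edge
  exact continuous_quot_mk.comp (continuous_inr.comp continuous_sigmaMk)

lemma realization_ind {p : G.Realization → Prop} (hv : ∀ v, p (vert v)) (he : ∀ e t, p (edge e t)) :
    ∀ x, p x := by
  rintro ⟨⟨v, ⟨⟩⟩ | ⟨e, t⟩⟩
  · exact hv v
  · exact he e t

/-- A map out of the realization is given by its values on the cells. -/
def lift {X : Type*} (fV : G.V → X) (fE : G.E → I → X) (h0 : ∀ e, fE e 0 = fV (G.src e))
    (h1 : ∀ e, fE e 1 = fV (G.tgt e)) : G.Realization → X :=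
  Quot.lift (Sum.elim (fun v => fV v.1) (fun e => fE e.1 e.2)) (by
    rintro _ _ (e | e)
    · exact h0 e
    · exact h1 e)

/-- A map out of `I × G.Realization` is continuous if it is so on the cells. -/
lemma continuous_prod {X : Type*} [TopologicalSpace X] {F : I × G.Realization → X}
    (hv : ∀ v, Continuous fun s => F (s, vert v))
    (he : ∀ e, Continuous fun st : I × I => F (st.1, edge e st.2)) : Continuous F := by
  have hq : Topology.IsQuotientMap (Quot.mk G.Glue) := isQuotientMap_quot_mk
  refine hq.continuous_lift_prod_right (g := F) ?_
  rw [← (Homeomorph.prodComm _ _).comp_continuous_iff',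
    ← (Homeomorph.sumProdDistrib).symm.comp_continuous_iff']
  refine continuous_sum_dom.2 ⟨?_, ?_⟩
  · rw [← (Homeomorph.sigmaProdDistrib).symm.comp_continuous_iff']
    refine continuous_sigma fun v => ?_
    exact (hv v).comp continuous_snd
  · rw [← (Homeomorph.sigmaProdDistrib).symm.comp_continuous_iff']
    refine continuous_sigma fun e => ?_
    exact (he e).comp continuous_swap

lemma continuous_of_cells {X : Type*} [TopologicalSpace X] {F : G.Realization → X}
    (he : ∀ e, Continuous fun t => F (edge e t)) : Continuous F := by
  have h : Continuous fun p : I × G.Realization => F p.2 :=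
    continuous_prod (F := fun p => F p.2) (fun v => continuous_const (y := F (vert v)))
      (fun e => (he e).comp continuous_snd)
  exact h.comp (Continuous.prodMk_right (0 : I))

variable (G)

/-- The number of edge ends at `v`; a loop counts twice. -/
def valence (v : G.V) : ℕ := Nat.card {e // G.src e = v} + Nat.card {e // G.tgt e = v}

/-- A core graph: all vertices have valence at least two. -/
def IsCore : Prop := ∀ v, 2 ≤ G.valence v

/-! ### The geodesic metric and linear maps -/

variable {G}

/-- `PathLength ℓ x y r`: there is a piecewise linear path of length `r` from `x` to `y`, a finite
concatenation of segments, each inside one closed edge. -/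
inductive PathLength (ℓ : G.E → ℝ) (x : G.Realization) : G.Realization → ℝ → Prop
  | refl : PathLength ℓ x x 0
  | step {r : ℝ} (e : G.E) (s t : I) : PathLength ℓ x (edge e s) r →
      PathLength ℓ x (edge e t) (r + ℓ e * |(s : ℝ) - t|)

/-- The path metric in which the edge `e` has length `ℓ e`. -/
def pathDist (ℓ : G.E → ℝ) (x y : G.Realization) : ℝ := sInf {r | PathLength ℓ x y r}

/-- `c` is a local geodesic of constant speed `s`: locally it multiplies distances by `s`.
For `s = 0` this says that `c` is locally constant, for `s > 0` it says that `c` is an immersed path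
(or loop) parametrized proportionally to arc length. -/
def IsLocalGeodesic {X : Type*} [PseudoMetricSpace X] (ℓ : G.E → ℝ) (c : X → G.Realization)
    (s : ℝ) : Prop :=
  ∀ x, ∃ U ∈ nhds x, ∀ a ∈ U, ∀ b ∈ U, pathDist ℓ (c a) (c b) = s * dist a b

/-- `ℓ(α)` for a loop `α`: the length of the immersed loop freely homotopic to `α`, or `0` if `α` is
freely homotopic to a constant loop. A loop parametrized by the circle of circumference `1` with
constant speed `L` has length `L`. -/
def loopLength (ℓ : G.E → ℝ) (α : C(UnitAddCircle, G.Realization)) : ℝ :=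
  sInf {L | ∃ β : C(UnitAddCircle, G.Realization), α.Homotopic β ∧ IsLocalGeodesic ℓ β L}

/-- `φ` is linear with slope `s` on the edge `e`: the edge `e` has length `ℓ e`, so in terms of its
parametrization by `[0,1]` its image has speed `s * ℓ e`. -/
def HasSlope {G' : FinGraph} (ℓ : G.E → ℝ) (ℓ' : G'.E → ℝ) (φ : C(G.Realization, G'.Realization))
    (e : G.E) (s : ℝ) : Prop :=
  IsLocalGeodesic ℓ' (fun t : I => φ (edge e t)) (s * ℓ e)

/-- The maximal slope `σ(φ)` of a map that is linear on edges. -/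
def maxSlope {G' : FinGraph} (ℓ : G.E → ℝ) (ℓ' : G'.E → ℝ)
    (φ : C(G.Realization, G'.Realization)) : ℝ :=
  sSup {s | ∃ e, HasSlope ℓ ℓ' φ e s}

end FinGraph

open FinGraph

/-! ### The rose and the action of automorphisms on it -/

/-- One vertex and `n` loops. -/
def roseGraph (n : ℕ) : FinGraph where
  V := Unit
  E := Fin n
  src _ := ()
  tgt _ := ()

/-- The rose `R_n`, the wedge of `n` circles. -/
abbrev Rose (n : ℕ) : Type := (roseGraph n).Realization

namespace Rose

variable {n : ℕ}

/-- The vertex of the rose. -/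
def base : Rose n := vert (G := roseGraph n) ()

/-- The `i`-th petal as a loop at the vertex. -/
def petal (i : Fin n) : Path (base : Rose n) base where
  toFun := edge (G := roseGraph n) i
  continuous_toFun := continuous_edge (G := roseGraph n) i
  source' := edge_zero (G := roseGraph n) i
  target' := edge_one (G := roseGraph n) i

/-- The edge loop that spells a word in the generators and their inverses. -/
def wordPath : List (Fin n × Bool) → Path (base : Rose n) base
  | [] => Path.refl _
  | (i, true) :: w => (petal i).trans (wordPath w)
  | (i, false) :: w => (petal i).symm.trans (wordPath w)

/-- The map from the rose that sends the `i`-th petal along the loop `q i`. -/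
def mapOfLoops {X : Type*} [TopologicalSpace X] {x : X} (q : Fin n → Path x x) : C(Rose n, X) where
  toFun := lift (G := roseGraph n) (fun _ => x) (fun i t => q i t) (fun i => (q i).source)
    (fun i => (q i).target)
  continuous_toFun := continuous_of_cells (G := roseGraph n) fun i => (q i).continuous

/-- The self-map of the rose determined by an automorphism `φ` of the free group: it sends the
`i`-th petal along the edge loop that spells the reduced word `φ(x_i)`. -/
def autMap (φ : MulAut (FreeGroup (Fin n))) : C(Rose n, Rose n) :=
  mapOfLoops fun i => wordPath (φ (FreeGroup.of i)).toWord

lemma hom_ext {X : Type*} [TopologicalSpace X] {f g : C(Rose n, X)} (hb : f base = g base)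
    (h : ∀ i t, f (petal i t) = g (petal i t)) : f = g :=
  ContinuousMap.ext (realization_ind (G := roseGraph n) (fun _ => hb) h)

/-- A homotopy between maps from the rose is given by a compatible family of homotopies on the
petals. -/
lemma homotopic_of_family {X : Type*} [TopologicalSpace X] {f g : C(Rose n, X)} (c : I → X)
    (hc : Continuous c) (Q : Fin n → I × I → X) (hQ : ∀ i, Continuous (Q i))
    (h0 : ∀ i s, Q i (s, 0) = c s) (h1 : ∀ i s, Q i (s, 1) = c s)
    (hf : f base = c 0) (hf' : ∀ i t, f (petal i t) = Q i (0, t))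
    (hg : g base = c 1) (hg' : ∀ i t, g (petal i t) = Q i (1, t)) : f.Homotopic g := by
  let F : I × Rose n → X := fun p =>
    lift (G := roseGraph n) (fun _ => c p.1) (fun i t => Q i (p.1, t)) (fun i => h0 i p.1)
      (fun i => h1 i p.1) p.2
  have hF : Continuous F :=
    continuous_prod (G := roseGraph n) (fun _ => hc) (fun i => hQ i)
  refine ⟨⟨⟨F, hF⟩, ?_, ?_⟩⟩
  · exact realization_ind (G := roseGraph n) (fun _ => hf.symm) (fun i t => (hf' i t).symm)
  · exact realization_ind (G := roseGraph n) (fun _ => hg.symm) (fun i t => (hg' i t).symm)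

lemma mapOfLoops_homotopic {X : Type*} [TopologicalSpace X] {x : X} {q q' : Fin n → Path x x}
    (h : ∀ i, (q i).Homotopic (q' i)) : (mapOfLoops q).Homotopic (mapOfLoops q') := by
  let H := fun i => (h i).some
  refine homotopic_of_family (fun _ => x) continuous_const (fun i p => H i p)
    (fun i => (H i).continuous) (fun i s => (H i).source s) (fun i s => (H i).target s)
    rfl (fun i t => ?_) rfl (fun i t => ?_)
  · exact ((H i).apply_zero t).symm
  · exact ((H i).apply_one t).symm

lemma mapOfLoops_conj {X : Type*} [TopologicalSpace X] {x y : X} (γ : Path x y)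
    (q : Fin n → Path y y) :
    (mapOfLoops fun i => (γ.trans (q i)).trans γ.symm).Homotopic (mapOfLoops q) := by
  let P : ∀ s : I, Path (γ s) y := fun s => (γ.subpath s 1).cast rfl γ.target.symm
  have hP : Continuous fun p : I × I => P p.1 p.2 :=
    γ.subpath_continuous_family.comp (by fun_prop : Continuous fun p : I × I => (p.1, (1 : I), p.2))
  have hP0 : ∀ t, P 0 t = γ t := fun t => by simp [P, Path.subpath]
  have hP1 : ∀ t, P 1 t = y := fun t => by simp [P, Path.subpath]
  have key : (mapOfLoops fun i => (γ.trans (q i)).trans γ.symm).Homotopic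
      (mapOfLoops fun i => ((Path.refl y).trans (q i)).trans (Path.refl y).symm) := by
    refine homotopic_of_family γ γ.continuous
      (fun i p => (((P p.1).trans (q i)).trans (P p.1).symm) p.2) (fun i => ?_)
      (fun i s => by simp) (fun i s => by simp) γ.source.symm (fun i t => ?_) γ.target.symm
      (fun i t => ?_)
    · refine Path.trans_continuous_family (fun s => (P s).trans (q i)) ?_ (fun s => (P s).symm) ?_
      · exact Path.trans_continuous_family P hP (fun _ => q i) ((q i).continuous.comp continuous_snd)
      · exact Path.symm_continuous_family P hP
    · change ((γ.trans (q i)).trans γ.symm) t = _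
      simp only [Path.trans_apply, Path.symm_apply, Function.comp_apply, hP0]
    · change (((Path.refl y).trans (q i)).trans (Path.refl y).symm) t = _
      simp only [Path.trans_apply, Path.symm_apply, Function.comp_apply, hP1, Path.refl_apply]
  refine key.trans (mapOfLoops_homotopic fun i => ?_)
  rw [Path.refl_symm]
  exact ⟨(Path.Homotopy.transRefl _).trans (Path.Homotopy.reflTrans _)⟩

/-- The identification of the free group with the fundamental group of the rose. In Mathlib the
product in the fundamental group is the concatenation in reversed order. -/
def toPi : FreeGroup (Fin n) →* (FundamentalGroup (Rose n) base)ᵐᵒᵖ :=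
  FreeGroup.lift fun i => MulOpposite.op (FundamentalGroup.fromPath (.mk (petal i)))

lemma toPi_mk (w : List (Fin n × Bool)) :
    toPi (FreeGroup.mk w) = MulOpposite.op (FundamentalGroup.fromPath (.mk (wordPath w))) := by
  induction w with
  | nil => exact map_one toPi
  | cons a w ih =>
    obtain ⟨i, b⟩ := a
    have h : FreeGroup.mk ((i, b) :: w) = FreeGroup.mk [(i, b)] * FreeGroup.mk w := by
      rw [FreeGroup.mul_mk]; rfl
    rw [h, map_mul, ih]
    cases b
    · have h2 : FreeGroup.mk [(i, false)] = (FreeGroup.of i)⁻¹ := rfl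
      rw [h2, map_inv, toPi, FreeGroup.lift_apply_of]
      rfl
    · have h2 : FreeGroup.mk [(i, true)] = FreeGroup.of i := rfl
      rw [h2, toPi, FreeGroup.lift_apply_of]
      rfl

lemma toPi_eq (g : FreeGroup (Fin n)) :
    toPi g = MulOpposite.op (FundamentalGroup.fromPath (.mk (wordPath g.toWord))) := by
  conv_lhs => rw [← FreeGroup.mk_toWord (x := g)]
  exact toPi_mk _

lemma homotopic_of_toPi {p q : Path (base : Rose n) base}
    (h : MulOpposite.op (FundamentalGroup.fromPath (.mk p)) =
      MulOpposite.op (FundamentalGroup.fromPath (.mk q))) : p.Homotopic q :=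
  Path.Homotopic.Quotient.exact (MulOpposite.op_injective h)

lemma autMap_petal (φ : MulAut (FreeGroup (Fin n))) (i : Fin n) :
    (petal i).map (autMap φ).continuous = wordPath (φ (FreeGroup.of i)).toWord := rfl

lemma autMap_wordPath (φ : MulAut (FreeGroup (Fin n))) (g : FreeGroup (Fin n)) :
    ((wordPath g.toWord).map (autMap φ).continuous : Path (base : Rose n) base).Homotopic
      (wordPath (φ g).toWord) := by
  let m : FundamentalGroup (Rose n) base →* FundamentalGroup (Rose n) base :=
    FundamentalGroup.map (autMap φ) base
  have h : (MonoidHom.op m).comp toPi = toPi.comp φ.toMonoidHom := by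
    ext i
    simp only [MonoidHom.comp_apply]
    rw [toPi, FreeGroup.lift_apply_of, ← toPi]
    exact (toPi_eq (φ (FreeGroup.of i))).symm
  have h' := DFunLike.congr_fun h g
  simp only [MonoidHom.comp_apply] at h'
  rw [toPi_eq] at h'
  exact homotopic_of_toPi (h'.trans (toPi_eq (φ g)))

lemma autMap_mul (φ ψ : MulAut (FreeGroup (Fin n))) :
    (autMap (φ * ψ)).Homotopic ((autMap φ).comp (autMap ψ)) := by
  have h : (autMap φ).comp (autMap ψ) = mapOfLoops (fun i =>
      ((wordPath (ψ (FreeGroup.of i)).toWord).map (autMap φ).continuous :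
        Path (base : Rose n) base)) := hom_ext rfl fun _ _ => rfl
  rw [h]
  exact mapOfLoops_homotopic fun i => (autMap_wordPath φ (ψ (FreeGroup.of i))).symm

lemma mapOfLoops_petal : mapOfLoops (petal (n := n)) = ContinuousMap.id _ :=
  hom_ext rfl fun _ _ => rfl

lemma autMap_conj (g : FreeGroup (Fin n)) :
    (autMap (MulAut.conj g)).Homotopic (ContinuousMap.id _) := by
  rw [← mapOfLoops_petal]
  refine (mapOfLoops_homotopic fun i => ?_).trans (mapOfLoops_conj (wordPath g.toWord) petal)
  apply homotopic_of_toPi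
  rw [← toPi_eq, MulAut.conj_apply, map_mul, map_mul, map_inv, toPi_eq g, toPi,
    FreeGroup.lift_apply_of]
  rfl

lemma autMap_one : (autMap (1 : MulAut (FreeGroup (Fin n)))).Homotopic (ContinuousMap.id _) := by
  rw [← map_one MulAut.conj]
  exact autMap_conj 1

/-- An automorphism of the free group induces a homotopy equivalence of the rose. -/
def autEquiv (φ : MulAut (FreeGroup (Fin n))) : ContinuousMap.HomotopyEquiv (Rose n) (Rose n) where
  toFun := autMap φ
  invFun := autMap φ⁻¹
  left_inv := by
    have h := autMap_mul φ⁻¹ φ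
    rw [inv_mul_cancel] at h
    exact h.symm.trans autMap_one
  right_inv := by
    have h := autMap_mul φ φ⁻¹
    rw [mul_inv_cancel] at h
    exact h.symm.trans autMap_one

end Rose

instance innNormal (n : ℕ) : (MulAut.conj (G := FreeGroup (Fin n))).range.Normal where
  conj_mem := by
    rintro _ ⟨g, rfl⟩ φ
    exact ⟨φ g, by ext x; simp [MulAut.conj_apply]⟩

/-- `Out(F_n)`: automorphisms of the free group of rank `n` modulo inner automorphisms. -/
abbrev OutF (n : ℕ) : Type :=
  MulAut (FreeGroup (Fin n)) ⧸ (MulAut.conj (G := FreeGroup (Fin n))).range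

/-! ### Outer space -/

/-- A marked metric core graph `(Γ, f, ℓ)` of rank `n` with total length `1`. -/
structure MarkedGraph (n : ℕ) where
  graph : FinGraph
  isCore : graph.IsCore
  marking : C(Rose n, graph.Realization)
  isMarking : ∃ h : ContinuousMap.HomotopyEquiv (Rose n) graph.Realization, h.toFun = marking
  length : graph.E → ℝ
  length_pos : ∀ e, 0 < length e
  length_sum : ∑ e, length e = 1

variable {n : ℕ}

namespace MarkedGraph

/-- The underlying space of the graph. -/
abbrev Space (Γ : MarkedGraph n) : Type := Γ.graph.Realization

/-- Two marked metric graphs are equivalent if there is a homeomorphism that is compatible with the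
markings up to homotopy and preserves the lengths of all loops. -/
def Equivalent (Γ Γ' : MarkedGraph n) : Prop :=
  ∃ φ : Γ.Space ≃ₜ Γ'.Space,
    ((φ : C(Γ.Space, Γ'.Space)).comp Γ.marking).Homotopic Γ'.marking ∧
    ∀ α : C(UnitAddCircle, Γ.Space),
      loopLength Γ.length α = loopLength Γ'.length ((φ : C(Γ.Space, Γ'.Space)).comp α)

instance setoid (n : ℕ) : Setoid (MarkedGraph n) where
  r := Equivalent
  iseqv := by
    refine ⟨fun Γ => ⟨Homeomorph.refl _, ContinuousMap.Homotopic.refl _, fun α => rfl⟩, ?_, ?_⟩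
    · rintro Γ Γ' ⟨φ, hφ, hl⟩
      refine ⟨φ.symm, ?_, fun α => ?_⟩
      · have h := ((ContinuousMap.Homotopic.refl (φ.symm : C(Γ'.Space, Γ.Space))).comp hφ).symm
        have e : (φ.symm : C(Γ'.Space, Γ.Space)).comp
            ((φ : C(Γ.Space, Γ'.Space)).comp Γ.marking) = Γ.marking := by
          ext x; simp
        rwa [e] at h
      · rw [hl]
        congr 1
        ext x; simp
    · rintro Γ Γ' Γ'' ⟨φ, hφ, hl⟩ ⟨ψ, hψ, hl'⟩
      refine ⟨φ.trans ψ, ?_, fun α => ?_⟩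
      · exact ((ContinuousMap.Homotopic.refl (ψ : C(Γ'.Space, Γ''.Space))).comp hφ).trans hψ
      · rw [hl, hl']; rfl

/-- A difference of markings: a map that is compatible with the markings up to homotopy and linear on
edges. -/
def IsDifferenceOfMarkings (Γ Γ' : MarkedGraph n) (φ : C(Γ.Space, Γ'.Space)) : Prop :=
  (φ.comp Γ.marking).Homotopic Γ'.marking ∧ ∀ e, ∃ s, HasSlope Γ.length Γ'.length φ e s

/-- `σ(Γ, Γ')`: the infimum of the maximal slopes of all differences of markings. -/
def stretch (Γ Γ' : MarkedGraph n) : ℝ :=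
  sInf {r | ∃ φ, IsDifferenceOfMarkings Γ Γ' φ ∧ r = maxSlope Γ.length Γ'.length φ}

/-- `(Γ, f, ℓ)Φ = (Γ, fΦ, ℓ)`, for an automorphism `Φ` viewed as a homotopy equivalence of the
rose. -/
def act (Γ : MarkedGraph n) (φ : MulAut (FreeGroup (Fin n))) : MarkedGraph n where
  graph := Γ.graph
  isCore := Γ.isCore
  marking := Γ.marking.comp (Rose.autMap φ)
  isMarking := by
    obtain ⟨h, hh⟩ := Γ.isMarking
    exact ⟨(Rose.autEquiv φ).trans h, by rw [← hh]; rfl⟩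
  length := Γ.length
  length_pos := Γ.length_pos
  length_sum := Γ.length_sum

lemma act_equiv_of_homotopic (Γ Γ' : MarkedGraph n) (φ φ' : MulAut (FreeGroup (Fin n)))
    (h : Γ ≈ Γ') (hφ : (Rose.autMap φ).Homotopic (Rose.autMap φ')) : Γ.act φ ≈ Γ'.act φ' := by
  obtain ⟨ψ, hψ, hl⟩ := h
  exact ⟨ψ, hψ.comp hφ, hl⟩

end MarkedGraph

/-- Culler-Vogtmann's Outer space `X_n`. -/
def Outer (n : ℕ) : Type 1 := Quotient (MarkedGraph.setoid n)

/-- The class of a marked metric graph. -/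
def MarkedGraph.toOuter (Γ : MarkedGraph n) : Outer n := Quotient.mk _ Γ

namespace Outer

/-- The right action of `Out(F_n)` on Outer space. -/
def act (x : Outer n) (Φ : OutF n) : Outer n :=
  Quotient.liftOn₂' x Φ (fun Γ φ => (Γ.act φ).toOuter) (by
    intro Γ φ Γ' φ' h hφ
    refine Quotient.sound (MarkedGraph.act_equiv_of_homotopic Γ Γ' φ φ' h ?_)
    obtain ⟨g, hg⟩ := QuotientGroup.leftRel_apply.1 hφ
    have e : φ' = φ * MulAut.conj g := by rw [hg]; simp
    rw [e]
    exact ((Rose.autMap_mul φ (MulAut.conj g)).trans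
      ((ContinuousMap.Homotopic.refl _).comp (Rose.autMap_conj g))).symm)

instance : MulAction (OutF n)ᵐᵒᵖ (Outer n) where
  smul Φ x := x.act Φ.unop
  one_smul x := by
    induction x using Quotient.inductionOn with
    | h Γ =>
      refine Quotient.sound ⟨Homeomorph.refl _, ?_, fun α => rfl⟩
      exact (ContinuousMap.Homotopic.refl Γ.marking).comp Rose.autMap_one
  mul_smul Φ Ψ x := by
    obtain ⟨Φ⟩ := Φ
    obtain ⟨Ψ⟩ := Ψ
    induction x using Quotient.inductionOn with
    | h Γ =>
      induction Φ using QuotientGroup.induction_on with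
      | H φ =>
        induction Ψ using QuotientGroup.induction_on with
        | H ψ =>
          refine Quotient.sound ⟨Homeomorph.refl _, ?_, fun α => rfl⟩
          exact (ContinuousMap.Homotopic.refl Γ.marking).comp (Rose.autMap_mul ψ φ)

/-- `σ(x, y)` for points of Outer space: the infimum of the maximal slopes of all differences of
markings between representatives of `x` and `y`. -/
def stretch (x y : Outer n) : ℝ :=
  sInf {r | ∃ Γ Γ' : MarkedGraph n, Γ.toOuter = x ∧ Γ'.toOuter = y ∧
    ∃ φ, MarkedGraph.IsDifferenceOfMarkings Γ Γ' φ ∧ r = maxSlope Γ.length Γ'.length φ}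

/-- The (nonsymmetric) Lipschitz metric `d = log σ`. -/
def d (x y : Outer n) : ℝ := Real.log (stretch x y)

end Outer

end OuterSpace

end

open scoped RightActions

noncomputable section

namespace OuterSpace

open scoped unitInterval

open FinGraph

variable {n : ℕ}

/-! ### The path metric -/

namespace FinGraph

variable {G : FinGraph} {ℓ : G.E → ℝ}

/-! Everything is reduced to Lipschitz constants for the path metrics. Nearby maps into a finite
graph are homotopic (`exists_homotopic_of_close`), so an Arzelà–Ascoli argument gives a map of least
Lipschitz constant among the maps compatible with the markings (`exists_optimal`). Tightening the
image of every edge with fixed endpoints (`exists_tight`) makes this map linear on edges without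
raising the constant. Hence the stretch factor is the least Lipschitz constant of a compatible map,
and it is attained (`stretch_spec`). The triangle inequality follows by composing maps. Invariance
under `OutF` holds because changing both markings by the same automorphism keeps compatible maps
compatible.

For nonnegativity, every point of a core graph lies on an immersed loop, and a loop homotopic to an
immersed loop covers it. So compatible maps are surjective, and a surjection between spaces of total
length one has Lipschitz constant at least one (`Compatible.one_le`). If the constant is one, no
length is lost: images of sets that meet in measure zero meet in measure zero. Suppose two points
had the same image. A tight path between them would have an image that lifts to a closed path in the
universal cover, a tree; at the point of the lift farthest from its start the path must fold back
over itself, which loses length. So the map is injective, then isometric, and the two marked graphs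
are equivalent.

Independence of representatives needs the converse, that equivalent graphs have stretch factor one,
although an equivalence is only a homeomorphism preserving loop lengths. An optimal map can be
chosen such that each maximally stretched edge continues into another one without folding: otherwise
pushing the image of a vertex reduces the number of such edges (`IsLinear.exists_push`). Following
these edges gives a closed loop whose length is multiplied by exactly the stretch factor
(`Equivalent.exists_nonexpanding`). Since the equivalence preserves the length of that loop, the
factor is one.

The universal cover is built by hand from reduced edge paths with a fractional last letter. The four
point condition is all that is used of its tree structure. -/

lemma PathLength.nonneg (hℓ : ∀ e, 0 < ℓ e) {x y : G.Realization} {r : ℝ}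
    (h : PathLength ℓ x y r) : 0 ≤ r := by
  induction h with
  | refl => exact le_rfl
  | step e s t _ ih => have := (hℓ e).le; positivity

lemma PathLength.append {x y z : G.Realization} {r r' : ℝ} (h : PathLength ℓ x y r)
    (h' : PathLength ℓ y z r') : PathLength ℓ x z (r + r') := by
  induction h' with
  | refl => simpa using h
  | step e s t _ ih => rw [← add_assoc]; exact ih.step e s t

lemma PathLength.single (e : G.E) (s t : I) :
    PathLength ℓ (edge e s) (edge e t) (ℓ e * |(s : ℝ) - t|) := by
  simpa using (PathLength.refl (ℓ := ℓ) (x := edge e s)).step e s t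

lemma PathLength.symm {x y : G.Realization} {r : ℝ} (h : PathLength ℓ x y r) :
    PathLength ℓ y x r := by
  induction h with
  | refl => exact .refl
  | step e s t _ ih =>
    rw [add_comm]
    refine PathLength.append ?_ ih
    rw [abs_sub_comm]
    exact .single e t s

/-- Test functions that are 1-Lipschitz along every edge are the source of lower bounds for the path
metric. -/
lemma PathLength.abs_sub_le {x y : G.Realization} {r : ℝ} {F : G.Realization → ℝ}
    (hF : ∀ e s t, |F (edge e s) - F (edge e t)| ≤ ℓ e * |(s : ℝ) - t|)
    (h : PathLength ℓ x y r) : |F x - F y| ≤ r := by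
  induction h with
  | refl => simp
  | step e s t _ ih => exact (_root_.abs_sub_le _ _ _).trans (add_le_add ih (hF e s t))

/-- Reachability does not change along a closed edge, so its indicator is continuous on the CW
complex, hence constant by connectedness. -/
lemma exists_pathLength [PreconnectedSpace G.Realization] (x y : G.Realization) :
    ∃ r, PathLength ℓ x y r := by
  classical
  let f : G.Realization → Bool := fun y => decide (∃ r, PathLength ℓ x y r)
  have hf : Continuous f := by
    refine continuous_of_cells fun e => ?_
    refine continuous_const.congr (f := fun _ => f (edge e 0)) fun t => ?_
    have : (∃ r, PathLength ℓ x (edge e 0) r) ↔ ∃ r, PathLength ℓ x (edge e t) r :=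
      ⟨fun ⟨r, h⟩ => ⟨_, h.step e 0 t⟩, fun ⟨r, h⟩ => ⟨_, h.step e t 0⟩⟩
    simp only [f, this]
  have h : f y = f x := PreconnectedSpace.constant inferInstance hf
  have hx : f x = true := by simpa [f] using ⟨0, PathLength.refl⟩
  simpa [f] using h.trans hx

lemma compactSpace_realization (G : FinGraph) : CompactSpace G.Realization := by
  have : CompactSpace (Σ _ : G.V, PUnit.{1}) := inferInstance
  have : CompactSpace (Σ _ : G.E, I) := inferInstance
  exact inferInstanceAs (CompactSpace (Quot G.Glue))

instance : CompactSpace G.Realization := compactSpace_realization G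

lemma exists_edge_length_lower_bound (hℓ : ∀ e, 0 < ℓ e) : ∃ m > 0, ∀ e, m ≤ ℓ e := by
  cases isEmpty_or_nonempty G.E
  · exact ⟨1, one_pos, fun e => isEmptyElim e⟩
  · obtain ⟨e, he⟩ := Finite.exists_min ℓ
    exact ⟨ℓ e, hℓ e, he⟩

section Dist

variable [PreconnectedSpace G.Realization]

lemma pathDist_le (hℓ : ∀ e, 0 < ℓ e) {x y : G.Realization} {r : ℝ} (h : PathLength ℓ x y r) :
    pathDist ℓ x y ≤ r :=
  csInf_le ⟨0, fun _ h => h.nonneg hℓ⟩ h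

lemma exists_pathLength_lt {x y : G.Realization} {r : ℝ} (h : pathDist ℓ x y < r) :
    ∃ r' < r, PathLength ℓ x y r' := by
  obtain ⟨r', h', hr⟩ := exists_lt_of_csInf_lt (exists_pathLength x y) h
  exact ⟨r', hr, h'⟩

lemma pathDist_nonneg (hℓ : ∀ e, 0 < ℓ e) (x y : G.Realization) : 0 ≤ pathDist ℓ x y :=
  Real.sInf_nonneg fun _ h => h.nonneg hℓ

lemma abs_sub_le_pathDist {F : G.Realization → ℝ}
    (hF : ∀ e s t, |F (edge e s) - F (edge e t)| ≤ ℓ e * |(s : ℝ) - t|) (x y : G.Realization) :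
    |F x - F y| ≤ pathDist ℓ x y :=
  le_csInf (exists_pathLength x y) fun _ h => h.abs_sub_le hF

lemma pathDist_self (hℓ : ∀ e, 0 < ℓ e) (x : G.Realization) : pathDist ℓ x x = 0 :=
  le_antisymm (pathDist_le hℓ .refl) (pathDist_nonneg hℓ _ _)

lemma pathDist_comm (x y : G.Realization) : pathDist ℓ x y = pathDist ℓ y x := by
  unfold pathDist
  congr 1
  ext r
  exact ⟨fun h => h.symm, fun h => h.symm⟩

lemma pathDist_triangle (hℓ : ∀ e, 0 < ℓ e) (x y z : G.Realization) :
    pathDist ℓ x z ≤ pathDist ℓ x y + pathDist ℓ y z := by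
  refine le_of_forall_pos_le_add fun ε hε => ?_
  obtain ⟨r, hr, h⟩ := exists_pathLength_lt (lt_add_of_pos_right (pathDist ℓ x y) (half_pos hε))
  obtain ⟨r', hr', h'⟩ :=
    exists_pathLength_lt (lt_add_of_pos_right (pathDist ℓ y z) (half_pos hε))
  have := pathDist_le hℓ (h.append h')
  linarith

end Dist

/-- A tent function supported in the interior of one edge. -/
def tent (ℓ : G.E → ℝ) (e : G.E) (c δ : ℝ) (h0 : δ ≤ c) (h1 : c + δ ≤ 1) : G.Realization → ℝ :=
  open Classical in
  lift (fun _ => 0) (fun e' t => if e' = e then ℓ e * max 0 (δ - |(t : ℝ) - c|) else 0)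
    (fun e' => by
      split_ifs
      · rw [max_eq_left]
        · simp
        · have := neg_le_abs ((0 : ℝ) - c)
          simp at this ⊢; linarith
      · rfl)
    (fun e' => by
      split_ifs
      · rw [max_eq_left]
        · simp
        · have := le_abs_self ((1 : ℝ) - c)
          simp at this ⊢; linarith
      · rfl)

lemma tent_edge (e : G.E) (c δ : ℝ) (h0 : δ ≤ c) (h1 : c + δ ≤ 1) (t : I) :
    tent ℓ e c δ h0 h1 (edge e t) = ℓ e * max 0 (δ - |(t : ℝ) - c|) := by
  classical
  change (if e = e then _ else _) = _
  simp

lemma tent_edge_of_ne {e e' : G.E} (h : e' ≠ e) (c δ : ℝ) (h0 : δ ≤ c) (h1 : c + δ ≤ 1) (t : I) :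
    tent ℓ e c δ h0 h1 (edge e' t) = 0 := by
  classical
  change (if e' = e then _ else _) = _
  simp [h]

lemma tent_vert (e : G.E) (v : G.V) (c δ : ℝ) (h0 : δ ≤ c) (h1 : c + δ ≤ 1) :
    tent ℓ e c δ h0 h1 (vert v) = 0 := rfl

lemma tent_lipschitz (hℓ : ∀ e, 0 < ℓ e) (e : G.E) (c δ : ℝ) (h0 : δ ≤ c) (h1 : c + δ ≤ 1) (e' : G.E) (s t : I) :
    |tent ℓ e c δ h0 h1 (edge e' s) - tent ℓ e c δ h0 h1 (edge e' t)| ≤ ℓ e' * |(s : ℝ) - t| := by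
  by_cases h : e' = e
  · subst h
    rw [tent_edge, tent_edge, ← mul_sub, abs_mul, abs_of_pos (hℓ e')]
    refine mul_le_mul_of_nonneg_left ?_ (hℓ e').le
    refine (abs_max_sub_max_le_max _ _ _ _).trans ?_
    simp only [sub_self, abs_zero, sub_sub_sub_cancel_left]
    refine max_le (abs_nonneg _) ((abs_abs_sub_abs_le_abs_sub _ _).trans ?_)
    rw [abs_sub_comm (s : ℝ)]
    simp
  · rw [tent_edge_of_ne h, tent_edge_of_ne h]
    have := (hℓ e').le
    simp only [sub_self, abs_zero]
    positivity

/-- A function that detects one vertex. -/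
def hat (m : ℝ) (v : G.V) : G.Realization → ℝ :=
  open Classical in
  lift (fun w => if w = v then m else 0)
    (fun e t => (1 - t) * (if G.src e = v then m else 0) + t * (if G.tgt e = v then m else 0))
    (fun e => by simp) (fun e => by simp)

lemma hat_vert_self (m : ℝ) (v : G.V) : hat m v (vert v) = m := by
  classical
  change (if v = v then _ else _) = _
  simp

lemma hat_vert_of_ne (m : ℝ) {v w : G.V} (h : w ≠ v) : hat m v (vert w) = 0 := by
  classical
  change (if w = v then _ else _) = _
  simp [h]

/-- With a height at most every edge length, linear interpolation between the values at the ends is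
1-Lipschitz on each edge. -/
lemma hat_lipschitz {m : ℝ} (hm0 : 0 ≤ m) (hm : ∀ e, m ≤ ℓ e) (v : G.V) (e : G.E) (s t : I) :
    |hat m v (edge e s) - hat m v (edge e t)| ≤ ℓ e * |(s : ℝ) - t| := by
  classical
  change |((1 - (s : ℝ)) * (if G.src e = v then m else 0) + s * (if G.tgt e = v then m else 0)) -
    ((1 - (t : ℝ)) * (if G.src e = v then m else 0) + t * (if G.tgt e = v then m else 0))| ≤ _
  have h : ∀ a b : ℝ, ((1 - (s : ℝ)) * a + s * b) - ((1 - (t : ℝ)) * a + t * b) =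
      (b - a) * (s - t) := fun a b => by ring
  rw [h, abs_mul]
  refine mul_le_mul_of_nonneg_right (le_trans ?_ (hm e)) (abs_nonneg _)
  split_ifs <;> simp [abs_of_nonneg, hm0]

section Dist

variable [PreconnectedSpace G.Realization]

/-- Points in the interior of an edge are at positive distance from all other points. -/
lemma eq_of_pathDist_edge_eq_zero (hℓ : ∀ e, 0 < ℓ e) {e : G.E} {t : I} (h0 : 0 < t) (h1 : t < 1) {y : G.Realization}
    (h : pathDist ℓ (edge e t) y = 0) : edge e t = y := by
  have key : ∀ δ (h0' : δ ≤ (t : ℝ)) (h1' : (t : ℝ) + δ ≤ 1), 0 ≤ δ →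
      tent ℓ e t δ h0' h1' y = ℓ e * δ := by
    intro δ h0' h1' hδ
    have := abs_sub_le_pathDist (tent_lipschitz hℓ e t δ h0' h1') (edge e t) y
    rw [h, tent_edge] at this
    have := sub_eq_zero.1 (abs_nonpos_iff.1 this)
    rw [← this]
    simp [hδ]
  have h0r : (0 : ℝ) < t := h0
  have h1r : (t : ℝ) < 1 := h1
  -- The widest tent centred at `t` that vanishes at both ends of the edge. It takes its maximum
  -- only at the point itself, so the value at `y` identifies `y`.
  set δ := min (t : ℝ) (1 - t) with hδ
  have hδ0 : 0 < δ := lt_min h0r (by linarith)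
  have k := key δ (min_le_left _ _) (by linarith [min_le_right (t : ℝ) (1 - t)]) hδ0.le
  revert k
  clear key h
  induction y using realization_ind with | hv v => ?_ | he e' s => ?_
  · rw [tent_vert]
    intro k
    exact absurd k.symm (mul_pos (hℓ e) hδ0).ne'
  · intro k
    by_cases he : e' = e
    · subst he
      rw [tent_edge] at k
      have k' := mul_left_cancel₀ (hℓ e').ne' k
      have hs : (s : ℝ) = t := by
        have h3 := abs_nonneg ((s : ℝ) - t)
        have h4 : |(s : ℝ) - t| = 0 := by
          rcases max_choice 0 (δ - |(s : ℝ) - t|) with h | h <;> rw [h] at k' <;> linarith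
        linarith [abs_eq_zero.1 h4]
      rw [Subtype.ext hs]
    · rw [tent_edge_of_ne he] at k
      exact absurd k.symm (mul_pos (hℓ e) hδ0).ne'

lemma cell_cases (x : G.Realization) :
    (∃ v, x = vert v) ∨ ∃ e, ∃ t : I, 0 < t ∧ t < 1 ∧ x = edge e t := by
  induction x using realization_ind with | hv v => exact .inl ⟨v, rfl⟩ | he e t => ?_
  rcases eq_or_lt_of_le (show 0 ≤ t from t.2.1) with h | h
  · exact .inl ⟨G.src e, by rw [← h, edge_zero]⟩
  rcases eq_or_lt_of_le (show t ≤ 1 from t.2.2) with h' | h'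
  · exact .inl ⟨G.tgt e, by rw [h', edge_one]⟩
  exact .inr ⟨e, t, h, h', rfl⟩

lemma eq_of_pathDist_eq_zero (hℓ : ∀ e, 0 < ℓ e) {x y : G.Realization} (h : pathDist ℓ x y = 0) : x = y := by
  rcases cell_cases x with ⟨v, rfl⟩ | ⟨e, t, h0, h1, rfl⟩
  · rcases cell_cases y with ⟨w, rfl⟩ | ⟨e, t, h0, h1, rfl⟩
    · by_contra hne
      obtain ⟨m, hm0, hm⟩ := exists_edge_length_lower_bound hℓ
      have := abs_sub_le_pathDist (hat_lipschitz hm0.le hm v) (vert v) (vert w)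
      rw [h, hat_vert_self, hat_vert_of_ne m (fun h' => hne (by rw [h']))] at this
      rw [sub_zero] at this
      linarith [le_abs_self m]
    · rw [pathDist_comm] at h
      exact (eq_of_pathDist_edge_eq_zero hℓ h0 h1 h).symm
  · exact eq_of_pathDist_edge_eq_zero hℓ h0 h1 h

/-- The path metric, before the topology is adjusted. -/
@[reducible]
def metricAux (hℓ : ∀ e, 0 < ℓ e) : MetricSpace G.Realization where
  dist := pathDist ℓ
  dist_self := pathDist_self hℓ
  dist_comm := pathDist_comm
  dist_triangle := pathDist_triangle hℓ
  eq_of_dist_eq_zero := eq_of_pathDist_eq_zero hℓ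

lemma pathDist_edge_le (hℓ : ∀ e, 0 < ℓ e) (e : G.E) (s t : I) :
    pathDist ℓ (edge e s) (edge e t) ≤ ℓ e * |(s : ℝ) - t| :=
  pathDist_le hℓ (.single e s t)

/-- The identity from the CW topology to the metric topology is continuous because the edges are
Lipschitz. It goes from a compact space to a Hausdorff space, so it is closed. -/
lemma topology_eq (hℓ : ∀ e, 0 < ℓ e) : (inferInstance : TopologicalSpace G.Realization) =
    (metricAux hℓ).toUniformSpace.toTopologicalSpace := by
  let M := metricAux hℓ
  have hc : @Continuous _ _ _ M.toUniformSpace.toTopologicalSpace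
      (id : G.Realization → G.Realization) := by
    let := M.toUniformSpace.toTopologicalSpace
    refine @continuous_of_cells G G.Realization M.toUniformSpace.toTopologicalSpace id fun e => ?_
    let := M
    refine (LipschitzWith.of_dist_le_mul (K := ⟨ℓ e, (hℓ e).le⟩) fun s t => ?_).continuous
    exact pathDist_edge_le hℓ e s t
  have hT2 : @T2Space G.Realization M.toUniformSpace.toTopologicalSpace := by
    let := M
    infer_instance
  refine le_antisymm (continuous_id_iff_le.1 hc) ?_
  have hh := @Continuous.isClosedMap G.Realization G.Realization _
    M.toUniformSpace.toTopologicalSpace _ hT2 id hc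
  intro s hs
  have h2 := hh _ (@IsOpen.isClosed_compl _ _ s hs)
  rw [Set.image_id] at h2
  exact (@isClosed_compl_iff _ M.toUniformSpace.toTopologicalSpace s).1 h2

/-- The metric space structure given by the path metric. -/
@[reducible]
def metric (hℓ : ∀ e, 0 < ℓ e) : MetricSpace G.Realization := (metricAux hℓ).replaceTopology (topology_eq hℓ)

end Dist

end FinGraph

/-! ### Lipschitz maps and curves -/

/-- `f` is Lipschitz with the real constant `K`. -/
def LipBound {X Y : Type*} [PseudoMetricSpace X] [PseudoMetricSpace Y] (K : ℝ) (f : X → Y) : Prop :=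
  ∀ x y, dist (f x) (f y) ≤ K * dist x y

namespace LipBound

variable {X Y Z : Type*} [PseudoMetricSpace X] [PseudoMetricSpace Y] [PseudoMetricSpace Z]

lemma lipschitzWith {K : ℝ} {f : X → Y} (h : LipBound K f) : LipschitzWith K.toNNReal f :=
  LipschitzWith.of_dist_le_mul fun x y =>
    (h x y).trans (mul_le_mul_of_nonneg_right (Real.le_coe_toNNReal K) dist_nonneg)

lemma continuous {K : ℝ} {f : X → Y} (h : LipBound K f) : Continuous f := h.lipschitzWith.continuous

lemma mono {K K' : ℝ} {f : X → Y} (h : LipBound K f) (hK : K ≤ K') : LipBound K' f :=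
  fun x y => (h x y).trans (mul_le_mul_of_nonneg_right hK dist_nonneg)

lemma comp {K K' : ℝ} {g : Y → Z} {f : X → Y} (hg : LipBound K g) (hf : LipBound K' f)
    (hK : 0 ≤ K) : LipBound (K * K') (g ∘ f) := fun x y => by
  refine (hg _ _).trans ?_
  rw [mul_assoc]
  exact mul_le_mul_of_nonneg_left (hf x y) hK

lemma of_le {K : ℝ} {f : ℝ → Y} (h : ∀ x y, x ≤ y → dist (f x) (f y) ≤ K * (y - x)) :
    LipBound K f := fun x y => by
  rcases le_total x y with hxy | hxy
  · rw [Real.dist_eq, abs_sub_comm, abs_of_nonneg (sub_nonneg.2 hxy)]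
    exact h x y hxy
  · rw [dist_comm, Real.dist_eq, abs_of_nonneg (sub_nonneg.2 hxy)]
    exact h y x hxy

lemma glue {K : ℝ} {f g : ℝ → Y} (hf : LipBound K f) (hg : LipBound K g) {u : ℝ} (h : f u = g u) :
    LipBound K (fun t => if t ≤ u then f t else g t) := by
  refine of_le fun x y hxy => ?_
  have e : ∀ x y : ℝ, x ≤ y → dist x y = y - x := fun x y h => by
    rw [Real.dist_eq, abs_sub_comm, abs_of_nonneg (sub_nonneg.2 h)]
  by_cases hx : x ≤ u
  · by_cases hy : y ≤ u
    · simp only [hx, hy, if_true]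
      exact (hf x y).trans_eq (by rw [e _ _ hxy])
    · simp only [hx, hy, if_true, if_false]
      have h1 := hf x u
      have h2 := hg u y
      rw [e _ _ hx] at h1
      rw [e _ _ (not_le.1 hy).le] at h2
      have := dist_triangle (f x) (f u) (g y)
      rw [h] at this h1
      linarith
  · have hy : ¬ y ≤ u := fun hy => hx (hxy.trans hy)
    simp only [hx, hy, if_false]
    exact (hg x y).trans_eq (by rw [e _ _ hxy])

lemma const (K : ℝ) (hK : 0 ≤ K) (y : Y) : LipBound K (fun _ : X => y) := fun a b => by
  rw [dist_self]; positivity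

end LipBound

lemma dist_projIcc_le (x y : ℝ) :
    dist (Set.projIcc (0 : ℝ) 1 zero_le_one x) (Set.projIcc (0 : ℝ) 1 zero_le_one y) ≤ dist x y := by
  have := (LipschitzWith.projIcc (zero_le_one (α := ℝ))).dist_le_mul x y
  simpa using this

/-- A function on an interval that is locally Lipschitz to the right is Lipschitz. -/
lemma dist_le_of_locally {Y : Type*} [PseudoMetricSpace Y] {f : ℝ → Y} {a b s : ℝ} (hab : a ≤ b)
    (hc : ContinuousOn f (Set.Icc a b))
    (h : ∀ t ∈ Set.Ico a b, ∃ ε > 0, ∀ u ∈ Set.Icc a b, t < u → u < t + ε →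
      dist (f t) (f u) ≤ s * (u - t)) : dist (f a) (f b) ≤ s * (b - a) := by
  -- Continuous induction: the set of times up to which the estimate from `a` holds is closed and
  -- can be extended to the right.
  let S : Set ℝ := {t | dist (f a) (f t) ≤ s * (t - a)}
  have hS : IsClosed (S ∩ Set.Icc a b) := by
    have : ContinuousOn (fun t => dist (f a) (f t) - s * (t - a)) (Set.Icc a b) :=
      (by fun_prop)
    have := this.preimage_isClosed_of_isClosed isClosed_Icc (isClosed_Iic (a := (0 : ℝ)))
    convert this using 1
    ext t
    simp [S, and_comm]
  refine hS.Icc_subset_of_forall_exists_gt (a := a) (by simp [S]) (fun t ht y hy => ?_)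
    ⟨hab, le_rfl⟩
  obtain ⟨hts, htab⟩ := ht
  obtain ⟨ε, hε, H⟩ := h t htab
  obtain ⟨u, hu1, hu2⟩ := exists_between (lt_min (lt_min hy htab.2) (lt_add_of_pos_right t hε))
  refine ⟨u, ?_, hu1, (hu2.trans_le ((min_le_left _ _).trans (min_le_left _ _))).le⟩
  have hub := hu2.trans_le ((min_le_left _ _).trans (min_le_right _ _))
  have h1 := H u ⟨htab.1.trans hu1.le, hub.le⟩ hu1 (hu2.trans_le (min_le_right _ _))
  have h2 := dist_triangle (f a) (f t) (f u)
  simp only [S, Set.mem_ofPred_eq] at hts ⊢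
  linarith

instance rose_pathConnected (n : ℕ) : PathConnectedSpace (Rose n) := by
  have h : ∀ x : Rose n, Joined Rose.base x := by
    intro x
    induction x using realization_ind with
    | hv v => exact Joined.refl _
    | he i t =>
      exact ⟨((Rose.petal i).subpath 0 t).cast (Rose.petal i).source.symm rfl⟩
  exact ⟨⟨Rose.base⟩, fun x y => (h x).symm.trans (h y)⟩

namespace MarkedGraph

variable (Γ : MarkedGraph n)

/-- The homotopy from the round trip through the rose to the identity joins each point to the image
of the path connected rose. -/
instance pathConnected : PathConnectedSpace Γ.graph.Realization := by
  obtain ⟨h, -⟩ := Γ.isMarking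
  have hj : ∀ x, Joined (h.toFun (h.invFun x)) x := fun x =>
    ⟨(h.right_inv.some.evalAt x)⟩
  refine ⟨⟨h.toFun Rose.base⟩, fun x y => ?_⟩
  have : Joined (h.toFun (h.invFun x)) (h.toFun (h.invFun y)) :=
    ⟨(PathConnectedSpace.somePath (h.invFun x) (h.invFun y)).map h.toFun.continuous⟩
  exact (hj x).symm.trans (this.trans (hj y))

instance : MetricSpace Γ.graph.Realization := metric Γ.length_pos

lemma nonempty_edges : Nonempty Γ.graph.E := by
  by_contra h
  rw [not_nonempty_iff] at h
  have := Γ.length_sum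
  simp at this

lemma exists_length_lower_bound : ∃ m > 0, ∀ e, m ≤ Γ.length e :=
  exists_edge_length_lower_bound Γ.length_pos

variable {Γ}

lemma abs_sub_le_dist {F : Γ.graph.Realization → ℝ}
    (hF : ∀ e s t, |F (edge e s) - F (edge e t)| ≤ Γ.length e * |(s : ℝ) - t|)
    (x y : Γ.graph.Realization) : |F x - F y| ≤ dist x y :=
  abs_sub_le_pathDist hF x y

lemma lipBound_edge (e : Γ.graph.E) : LipBound (Γ.length e) (fun t : I => edge e t) := fun s t =>
  pathDist_edge_le Γ.length_pos e s t

/-- A map that is Lipschitz on edges is Lipschitz. -/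
lemma lipBound_of_edges {Y : Type*} [PseudoMetricSpace Y] {φ : Γ.graph.Realization → Y} {K : ℝ}
    (hK : 0 ≤ K) (h : ∀ e, LipBound (K * Γ.length e) (fun t : I => φ (edge e t))) :
    LipBound K φ := fun x y => by
  have key : ∀ r, PathLength Γ.length x y r → dist (φ x) (φ y) ≤ K * r := by
    intro r hr
    induction hr with
    | refl => simp
    | step e s t _ ih =>
      have h1 := h e s t
      simp only [Subtype.dist_eq, Real.dist_eq] at h1
      have h2 := dist_triangle (φ x) (φ (edge e s)) (φ (edge e t))
      nlinarith
  refine le_of_forall_pos_le_add fun ε hε => ?_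
  -- The slack is divided by `K + 1` because `K` may be zero.
  obtain ⟨r, hr, hr'⟩ := exists_pathLength_lt (ℓ := Γ.length)
    (lt_add_of_pos_right (pathDist Γ.length x y) (show 0 < ε / (K + 1) by positivity))
  refine (key r hr').trans ?_
  have : K * (ε / (K + 1)) ≤ ε := by
    rw [mul_div_assoc', div_le_iff₀ (by positivity)]; nlinarith
  have h3 : K * r ≤ K * (dist x y + ε / (K + 1)) := mul_le_mul_of_nonneg_left hr.le hK
  linarith

/-- Segments are appended one at a time, with the sign `κ` recording the direction along the edge.
Clamping the parameter by `projIcc` makes each segment a 1-Lipschitz curve on the whole line, so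
pieces can be glued. -/
lemma exists_curve_of_pathLength {x y : Γ.graph.Realization} {r : ℝ}
    (h : PathLength Γ.length x y r) :
    ∃ ρ : ℝ → Γ.graph.Realization, LipBound 1 ρ ∧ ρ 0 = x ∧ ρ r = y := by
  induction h with
  | refl => exact ⟨fun _ => x, LipBound.const 1 zero_le_one x, rfl, rfl⟩
  | @step r e s t h ih =>
    obtain ⟨ρ, hρ, h0, hr⟩ := ih
    have hl := Γ.length_pos e
    obtain ⟨κ, hκ, hκt⟩ : ∃ κ : ℝ, |κ| = 1 ∧ κ * |(s : ℝ) - t| = t - s := by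
      rcases le_total (s : ℝ) t with hst | hst
      · exact ⟨1, by simp, by rw [abs_sub_comm, abs_of_nonneg (sub_nonneg.2 hst)]; ring⟩
      · exact ⟨-1, by simp, by rw [abs_of_nonneg (sub_nonneg.2 hst)]; ring⟩
    let g : ℝ → Γ.graph.Realization := fun u =>
      edge e (Set.projIcc 0 1 zero_le_one (s + κ * (u - r) / Γ.length e))
    have hg : LipBound 1 g := fun a b => by
      refine (lipBound_edge e _ _).trans ?_
      refine (mul_le_mul_of_nonneg_left (dist_projIcc_le _ _) hl.le).trans ?_
      rw [Real.dist_eq, Real.dist_eq, one_mul]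
      have : (s + κ * (a - r) / Γ.length e) - (s + κ * (b - r) / Γ.length e) =
        κ * (a - b) / Γ.length e := by ring
      rw [this, abs_div, abs_mul, hκ, abs_of_pos hl, one_mul, mul_div_cancel₀ _ hl.ne']
    have hgr : g r = edge e s := by simp [g]
    refine ⟨_, hρ.glue hg (hr.trans hgr.symm), ?_, ?_⟩
    · simp only [h.nonneg Γ.length_pos, if_true, h0]
    · have hgt : g (r + Γ.length e * |(s : ℝ) - t|) = edge e t := by
        have : (s : ℝ) + κ * (r + Γ.length e * |(s : ℝ) - t| - r) / Γ.length e = t := by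
          have : κ * (r + Γ.length e * |(s : ℝ) - t| - r) = (t - s) * Γ.length e := by
            rw [← hκt]; ring
          rw [this, mul_div_cancel_right₀ _ hl.ne']; ring
        simp only [g, this]
        rw [Set.projIcc_val]
      split_ifs with hle
      · have h0 : Γ.length e * |(s : ℝ) - t| = 0 := by
          have := mul_nonneg hl.le (abs_nonneg ((s : ℝ) - t)); linarith
        rw [h0, add_zero] at hgt ⊢
        rw [hr, ← hgr, hgt]
      · exact hgt

lemma exists_curve {x y : Γ.graph.Realization} {r : ℝ} (h : dist x y < r) :
    ∃ r' < r, 0 ≤ r' ∧ ∃ ρ : ℝ → Γ.graph.Realization, LipBound 1 ρ ∧ ρ 0 = x ∧ ρ r' = y := by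
  obtain ⟨r', hr, hp⟩ := exists_pathLength_lt (ℓ := Γ.length) (x := x) (y := y) h
  exact ⟨r', hr, hp.nonneg Γ.length_pos, exists_curve_of_pathLength hp⟩

end MarkedGraph

/-! ### Nearby maps into a graph are homotopic -/

/-- If two paths are opposite sides of a square, they differ by the other two sides. -/
lemma homotopic_of_square {X : Type*} [TopologicalSpace X] (F : C(I × I, X)) {x y x' y' : X}
    (γ : Path x y) (δ : Path x' y') (τ : Path x x') (τ' : Path y y')
    (hγ : ∀ t, F (0, t) = γ t) (hδ : ∀ t, F (1, t) = δ t) (hτ : ∀ s, F (s, 0) = τ s)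
    (hτ' : ∀ s, F (s, 1) = τ' s) : γ.Homotopic (τ.trans (δ.trans τ'.symm)) := by
  have hI : ContractibleSpace I := (convex_Icc (0 : ℝ) 1).contractibleSpace ⟨0, by simp⟩
  let a : Path ((0, 0) : I × I) (0, 1) := ⟨⟨fun t => (0, t), by fun_prop⟩, rfl, rfl⟩
  let b : Path ((0, 0) : I × I) (1, 0) := ⟨⟨fun t => (t, 0), by fun_prop⟩, rfl, rfl⟩
  let c : Path ((1, 0) : I × I) (1, 1) := ⟨⟨fun t => (1, t), by fun_prop⟩, rfl, rfl⟩
  let d : Path ((0, 1) : I × I) (1, 1) := ⟨⟨fun t => (t, 1), by fun_prop⟩, rfl, rfl⟩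
  have hp : Path.Homotopic a (b.trans (c.trans d.symm)) := by
    have : SimplyConnectedSpace (I × I) := by infer_instance
    exact SimplyConnectedSpace.paths_homotopic _ _
  have h := hp.map F
  have e0 : F (0, 0) = x := by rw [hγ, γ.source]
  have e1 : F (0, 1) = y := by rw [hγ, γ.target]
  have e2 : F (1, 0) = x' := by rw [hδ, δ.source]
  have e3 : F (1, 1) = y' := by rw [hδ, δ.target]
  subst e0 e1 e2 e3
  have ha : a.map F.continuous = γ := by ext t; exact hγ t
  have hb : b.map F.continuous = τ := by ext t; exact hτ t
  have hc : c.map F.continuous = δ := by ext t; exact hδ t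
  have hd : d.map F.continuous = τ' := by ext t; exact hτ' t
  have := Path.map_trans b (c.trans d.symm) F.continuous
  rw [this, Path.map_trans c d.symm F.continuous, ← Path.map_symm, ha, hb, hc, hd] at h
  exact h

/-- A function is continuous on the image of a compact space if its pullback is continuous. -/
lemma continuousOn_range_of_comp {C Z W : Type*} [TopologicalSpace C] [CompactSpace C]
    [TopologicalSpace Z] [T2Space Z] [TopologicalSpace W] {q : C → Z} (hq : Continuous q)
    {F : Z → W} (hF : Continuous (F ∘ q)) : ContinuousOn F (Set.range q) := by
  rw [continuousOn_iff_isClosed]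
  intro t ht
  refine ⟨q '' ((F ∘ q) ⁻¹' t), ((ht.preimage hF).isCompact.image hq).isClosed, ?_⟩
  ext z
  constructor
  · rintro ⟨h1, ⟨c, rfl⟩⟩
    exact ⟨⟨c, h1, rfl⟩, ⟨c, rfl⟩⟩
  · rintro ⟨⟨c, h1, rfl⟩, h2⟩
    exact ⟨h1, h2⟩

namespace FinGraph

variable {G : FinGraph}

/-- The gluing relation is never analysed: a tent function with its peak at the given interior point
separates it from all other points. -/
lemma edge_injective_of_interior {e e' : G.E} {s s' : I} (h0 : 0 < s) (h1 : s < 1)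
    (h : edge e s = edge e' s') : e = e' ∧ s = s' := by
  have h0r : (0 : ℝ) < s := h0
  have h1r : (s : ℝ) < 1 := h1
  have hδ0 : 0 < min (s : ℝ) (1 - s) := lt_min h0r (by linarith)
  have k := congrArg (tent (fun _ : G.E => (1 : ℝ)) e s (min (s : ℝ) (1 - s)) (min_le_left _ _)
    (by linarith [min_le_right (s : ℝ) (1 - s)])) h
  by_cases he : e' = e
  · subst he
    refine ⟨rfl, ?_⟩
    rw [tent_edge, tent_edge] at k
    simp only [sub_self, abs_zero, sub_zero, one_mul, max_eq_right hδ0.le] at k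
    have hs : (s : ℝ) = s' := by
      have h4 : |(s' : ℝ) - s| = 0 := by
        have h3 := abs_nonneg ((s' : ℝ) - s)
        rcases max_choice 0 (min (s : ℝ) (1 - s) - |(s' : ℝ) - s|) with h | h <;>
          rw [h] at k <;> linarith
      linarith [abs_eq_zero.1 h4]
    exact Subtype.ext hs
  · rw [tent_edge, tent_edge_of_ne he] at k
    simp only [sub_self, abs_zero, sub_zero, one_mul, max_eq_right hδ0.le] at k
    exact absurd k hδ0.ne'

lemma edge_ne_vert {e : G.E} {s : I} (h0 : 0 < s) (h1 : s < 1) (v : G.V) : edge e s ≠ vert v := by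
  intro h
  have h0r : (0 : ℝ) < s := h0
  have h1r : (s : ℝ) < 1 := h1
  have hδ0 : 0 < min (s : ℝ) (1 - s) := lt_min h0r (by linarith)
  have k := congrArg (tent (fun _ : G.E => (1 : ℝ)) e s (min (s : ℝ) (1 - s)) (min_le_left _ _)
    (by linarith [min_le_right (s : ℝ) (1 - s)])) h
  rw [tent_edge, tent_vert] at k
  simp only [sub_self, abs_zero, sub_zero, one_mul, max_eq_right hδ0.le] at k
  exact absurd k hδ0.ne'

/-- The self-map of the unit interval that collapses the first and the last third. -/
def thirds (t : I) : I := Set.projIcc 0 1 zero_le_one (3 * (t : ℝ) - 1)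

lemma continuous_thirds : Continuous thirds :=
  continuous_projIcc.comp (by fun_prop)

lemma thirds_of_le {t : I} (h : (t : ℝ) ≤ 1 / 3) : thirds t = 0 :=
  Set.projIcc_of_le_left _ (by linarith)

lemma thirds_of_ge {t : I} (h : 2 / 3 ≤ (t : ℝ)) : thirds t = 1 :=
  Set.projIcc_of_right_le _ (by linarith)

lemma thirds_pos {t : I} (h : 1 / 3 < (t : ℝ)) : 0 < thirds t := by
  refine lt_of_le_of_ne (thirds t).2.1 fun h' => ?_
  have := congrArg Subtype.val h'
  simp only [thirds, Set.coe_projIcc, Set.Icc.coe_zero] at this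
  rcases max_choice 0 (min 1 (3 * (t : ℝ) - 1)) with h1 | h1
  · have := le_max_right 0 (min 1 (3 * (t : ℝ) - 1))
    rw [h1] at this
    rcases min_choice 1 (3 * (t : ℝ) - 1) with h2 | h2 <;> rw [h2] at this <;> linarith
  · rw [h1] at this
    rcases min_choice 1 (3 * (t : ℝ) - 1) with h2 | h2 <;> rw [h2] at this <;> linarith

lemma thirds_lt_one {t : I} (h : (t : ℝ) < 2 / 3) : thirds t < 1 := by
  rw [← Subtype.coe_lt_coe]
  simp only [thirds, Set.coe_projIcc, Set.Icc.coe_one]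
  exact max_lt one_pos ((min_le_right _ _).trans_lt (by linarith))

/-- The deformation that collapses the star of radius `1/3` around each vertex. -/
def collapseHomotopy (p : I × G.Realization) : G.Realization :=
  lift vert (fun e t => edge e (Set.Icc.convexComb t (thirds t) p.1))
    (fun e => by rw [thirds_of_le (by simp)]; simp [edge_zero])
    (fun e => by rw [thirds_of_ge (by norm_num)]; simp [edge_one]) p.2

lemma collapseHomotopy_edge (s t : I) (e : G.E) :
    collapseHomotopy (s, edge e t) = edge e (Set.Icc.convexComb t (thirds t) s) := rfl

lemma continuous_collapseHomotopy : Continuous (collapseHomotopy (G := G)) := by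
  refine continuous_prod (fun v => continuous_const) fun e => ?_
  refine (continuous_edge e).comp (Set.Icc.continuous_convexComb_prod.comp (f := fun p : I × I =>
    (p.2, thirds p.2, p.1)) ?_)
  have := continuous_thirds
  fun_prop

lemma collapseHomotopy_zero (x : G.Realization) : collapseHomotopy (0, x) = x := by
  induction x using realization_ind with
  | hv v => rfl
  | he e t => rw [collapseHomotopy_edge]; simp

/-- The end of the deformation `collapseHomotopy`. -/
def collapse : C(G.Realization, G.Realization) :=
  ⟨fun x => collapseHomotopy (1, x), continuous_collapseHomotopy.comp (by fun_prop)⟩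

lemma collapse_edge (e : G.E) (t : I) : collapse (edge e t) = edge e (thirds t) := by
  change collapseHomotopy (1, edge e t) = _
  rw [collapseHomotopy_edge]
  simp

lemma collapse_vert (v : G.V) : collapse (vert v : G.Realization) = vert v := rfl

lemma homotopic_collapse : (ContinuousMap.id G.Realization).Homotopic collapse :=
  ⟨⟨⟨collapseHomotopy, continuous_collapseHomotopy⟩, collapseHomotopy_zero, fun _ => rfl⟩⟩

/-- Pairs of points which lie close together on one edge. -/
def edgePairs (e : G.E) : Set (G.Realization × G.Realization) :=
  {p | ∃ s t : I, |(s : ℝ) - t| ≤ 1 / 4 ∧ p.1 = edge e s ∧ p.2 = edge e t}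

/-- Pairs of points in the star of a vertex. -/
def starPairs (v : G.V) : Set (G.Realization × G.Realization) :=
  {p | collapse p.1 = vert v ∧ collapse p.2 = vert v}

open Classical in
/-- The segment from `collapse x` to `collapse y`, if these points lie on one edge. -/
def segment (z : (G.Realization × G.Realization) × I) : G.Realization :=
  if h : ∃ (e : G.E) (s t : I), |(s : ℝ) - t| ≤ 1 / 4 ∧ z.1.1 = edge e s ∧ z.1.2 = edge e t then
    edge h.choose (Set.Icc.convexComb (thirds h.choose_spec.choose)
      (thirds h.choose_spec.choose_spec.choose) z.2)
  else collapse z.1.1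

lemma convexComb_self {a b : ℝ} (x : Set.Icc a b) (s : I) : Set.Icc.convexComb x x s = x := by
  ext
  change (1 - (s : ℝ)) * x + s * x = x
  ring

/-- This makes `segment` independent of the chosen edge and parameters. An interior point determines
its edge and parameter. The other point could then be ambiguous only between the two ends of a loop,
and the bound `1 / 4` excludes one of them. If both points are ends of the edge, the bound forces
equal parameters and the segment is constant. -/
lemma segment_edge_aux {e e' : G.E} {s t s' t' : I} (hst : |(s : ℝ) - t| ≤ 1 / 4)
    (hst' : |(s' : ℝ) - t'| ≤ 1 / 4) (h : edge e s = edge e' s') (h' : edge e t = edge e' t')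
    (r : I) : edge e (Set.Icc.convexComb (thirds s) (thirds t) r) =
      edge e' (Set.Icc.convexComb (thirds s') (thirds t') r) := by
  have bd : ∀ s : I, ¬ (0 < s ∧ s < 1) → (s : ℝ) = 0 ∨ (s : ℝ) = 1 := by
    intro s hs
    by_contra hc
    push Not at hc
    exact hs ⟨lt_of_le_of_ne s.2.1 (fun h => hc.1 (congrArg Subtype.val h).symm),
      lt_of_le_of_ne s.2.2 (fun h => hc.2 (congrArg Subtype.val h))⟩
  rw [abs_le] at hst hst'
  by_cases hs : 0 < s ∧ s < 1
  · obtain ⟨rfl, rfl⟩ := edge_injective_of_interior hs.1 hs.2 h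
    by_cases ht : 0 < t ∧ t < 1
    · obtain ⟨-, rfl⟩ := edge_injective_of_interior ht.1 ht.2 h'
      rfl
    · by_cases ht' : 0 < t' ∧ t' < 1
      · obtain ⟨-, rfl⟩ := edge_injective_of_interior ht'.1 ht'.2 h'.symm
        rfl
      · have : (t : ℝ) = t' := by
          rcases bd t ht with h1 | h1 <;> rcases bd t' ht' with h2 | h2 <;> rw [h1, h2] <;>
            rw [h1] at hst <;> rw [h2] at hst' <;> exfalso <;> linarith
        rw [Subtype.ext this]
  · by_cases ht : 0 < t ∧ t < 1
    · obtain ⟨rfl, rfl⟩ := edge_injective_of_interior ht.1 ht.2 h'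
      by_cases hs' : 0 < s' ∧ s' < 1
      · obtain ⟨-, rfl⟩ := edge_injective_of_interior hs'.1 hs'.2 h.symm
        rfl
      · have : (s : ℝ) = s' := by
          rcases bd s hs with h1 | h1 <;> rcases bd s' hs' with h2 | h2 <;> rw [h1, h2] <;>
            rw [h1] at hst <;> rw [h2] at hst' <;> exfalso <;> linarith
        rw [Subtype.ext this]
    · have hs' : ¬ (0 < s' ∧ s' < 1) := fun hs' => by
        obtain ⟨-, rfl⟩ := edge_injective_of_interior hs'.1 hs'.2 h.symm
        exact hs hs'
      have ht' : ¬ (0 < t' ∧ t' < 1) := fun ht' => by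
        obtain ⟨-, rfl⟩ := edge_injective_of_interior ht'.1 ht'.2 h'.symm
        exact ht ht'
      have e1 : s = t := by
        refine Subtype.ext ?_
        rcases bd s hs with h1 | h1 <;> rcases bd t ht with h2 | h2 <;> rw [h1, h2] <;>
          rw [h1, h2] at hst <;> exfalso <;> linarith
      have e2 : s' = t' := by
        refine Subtype.ext ?_
        rcases bd s' hs' with h1 | h1 <;> rcases bd t' ht' with h2 | h2 <;> rw [h1, h2] <;>
          rw [h1, h2] at hst' <;> exfalso <;> linarith
      subst e1 e2
      rw [convexComb_self, convexComb_self, ← collapse_edge, ← collapse_edge, h]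

lemma segment_edge (e : G.E) {s t : I} (hst : |(s : ℝ) - t| ≤ 1 / 4) (r : I) :
    segment ((edge e s, edge e t), r) =
      edge e (Set.Icc.convexComb (thirds s) (thirds t) r) := by
  have h : ∃ (e' : G.E) (s' t' : I), |(s' : ℝ) - t'| ≤ 1 / 4 ∧ edge e s = edge e' s' ∧
      edge e t = edge e' t' := ⟨e, s, t, hst, rfl, rfl⟩
  rw [segment, dif_pos h]
  obtain ⟨h1, h2, h3⟩ := h.choose_spec.choose_spec.choose_spec
  exact (segment_edge_aux hst h1 h2 h3 r).symm

lemma edge_eq_vert_iff {e : G.E} {t : I} {v : G.V} (h : edge e t = vert v) : t = 0 ∨ t = 1 := by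
  by_contra hc
  push Not at hc
  exact edge_ne_vert (lt_of_le_of_ne t.2.1 hc.1.symm) (lt_of_le_of_ne t.2.2 hc.2) v h

/-- If the two points are also close on one edge, they lie in its same outer third, since the outer
thirds are `1 / 3 > 1 / 4` apart. So this case is consistent with the segment along the edge. -/
lemma segment_star {v : G.V} {x y : G.Realization} (hx : collapse x = vert v)
    (hy : collapse y = vert v) (r : I) : segment ((x, y), r) = vert v := by
  by_cases h : ∃ (e : G.E) (s t : I), |(s : ℝ) - t| ≤ 1 / 4 ∧ x = edge e s ∧ y = edge e t
  · obtain ⟨e, s, t, hst, rfl, rfl⟩ := h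
    rw [segment_edge e hst]
    rw [collapse_edge] at hx hy
    have key : ∀ s : I, thirds s = 0 ∨ thirds s = 1 → (s : ℝ) ≤ 1 / 3 ∨ 2 / 3 ≤ (s : ℝ) := by
      intro s hs
      by_contra hc
      push Not at hc
      rcases hs with hs | hs
      · exact (thirds_pos hc.1).ne' hs
      · exact (thirds_lt_one hc.2).ne hs
    rw [abs_le] at hst
    have : thirds s = thirds t := by
      rcases key s (edge_eq_vert_iff hx) with h1 | h1 <;>
        rcases key t (edge_eq_vert_iff hy) with h2 | h2
      · rw [thirds_of_le h1, thirds_of_le h2]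
      · exfalso; linarith
      · exfalso; linarith
      · rw [thirds_of_ge h1, thirds_of_ge h2]
    rw [this, convexComb_self, hy]
  · rw [segment, dif_neg h]
    exact hx

/-- Pairs of points whose images under `collapse` lie on one edge. -/
def nearPairs (G : FinGraph) : Set (G.Realization × G.Realization) :=
  (⋃ e : G.E, edgePairs e) ∪ ⋃ v : G.V, starPairs v

lemma segment_zero {x y : G.Realization} (h : (x, y) ∈ nearPairs G) :
    segment ((x, y), 0) = collapse x := by
  rcases h with h | h
  · obtain ⟨e, s, t, hst, h1, h2⟩ := Set.mem_iUnion.1 h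
    obtain rfl : x = _ := h1
    obtain rfl : y = _ := h2
    rw [segment_edge e hst, collapse_edge]
    simp
  · obtain ⟨v, h1, h2⟩ := Set.mem_iUnion.1 h
    rw [segment_star h1 h2]
    exact h1.symm

lemma segment_one {x y : G.Realization} (h : (x, y) ∈ nearPairs G) :
    segment ((x, y), 1) = collapse y := by
  rcases h with h | h
  · obtain ⟨e, s, t, hst, h1, h2⟩ := Set.mem_iUnion.1 h
    obtain rfl : x = _ := h1
    obtain rfl : y = _ := h2
    rw [segment_edge e hst, collapse_edge]
    simp
  · obtain ⟨v, h1, h2⟩ := Set.mem_iUnion.1 h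
    rw [segment_star h1 h2]
    exact h2.symm

lemma segment_self (x : G.Realization) (r : I) : segment ((x, x), r) = collapse x := by
  induction x using realization_ind with
  | hv v => exact segment_star (collapse_vert v) (collapse_vert v) r
  | he e t => rw [segment_edge e (by simp), convexComb_self, collapse_edge]

/-- The near pairs form a finite union of closed pieces. On a star the segment is constant. On an
edge piece, continuity is checked after pulling back to a compact parameter space. -/
lemma continuousOn_segment [T2Space G.Realization] :
    ContinuousOn segment (nearPairs G ×ˢ (Set.univ : Set I)) := by
  have hE : ∀ e : G.E, ContinuousOn segment (edgePairs e ×ˢ (Set.univ : Set I)) ∧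
      IsClosed (edgePairs e) := by
    intro e
    let C : Set (I × I) := {p | |(p.1 : ℝ) - p.2| ≤ 1 / 4}
    have hC : IsClosed C := isClosed_le (by fun_prop) continuous_const
    have : CompactSpace C := isCompact_iff_compactSpace.1 hC.isCompact
    let q : C × I → (G.Realization × G.Realization) × I := fun z =>
      ((edge e z.1.1.1, edge e z.1.1.2), z.2)
    have hce := continuous_edge e
    have hq : Continuous q := by fun_prop
    have hr : Set.range q = edgePairs e ×ˢ (Set.univ : Set I) := by
      ext ⟨⟨x, y⟩, r⟩
      constructor
      · rintro ⟨⟨⟨⟨s, t⟩, hst⟩, r⟩, h⟩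
        obtain ⟨h1, rfl⟩ := Prod.ext_iff.1 h
        obtain ⟨h1, h2⟩ := Prod.ext_iff.1 h1
        exact ⟨⟨s, t, hst, h1.symm, h2.symm⟩, trivial⟩
      · rintro ⟨⟨s, t, hst, h1, h2⟩, -⟩
        exact ⟨(⟨(s, t), hst⟩, r), Prod.ext (Prod.ext h1.symm h2.symm) rfl⟩
    constructor
    · rw [← hr]
      refine continuousOn_range_of_comp hq ?_
      have : segment ∘ q = fun z => edge e (Set.Icc.convexComb (thirds z.1.1.1)
          (thirds z.1.1.2) z.2) := by
        ext z
        exact segment_edge e z.1.2 z.2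
      rw [this]
      refine hce.comp (Set.Icc.continuous_convexComb_prod.comp (f := fun z : C × I =>
        (thirds z.1.1.1, thirds z.1.1.2, z.2)) ?_)
      have := continuous_thirds
      fun_prop
    · let q' : C → G.Realization × G.Realization := fun z => (edge e z.1.1, edge e z.1.2)
      have hq' : Continuous q' := by fun_prop
      have : edgePairs e = Set.range q' := by
        ext ⟨x, y⟩
        constructor
        · rintro ⟨s, t, hst, h1, h2⟩
          exact ⟨⟨(s, t), hst⟩, Prod.ext h1.symm h2.symm⟩
        · rintro ⟨⟨⟨s, t⟩, hst⟩, h⟩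
          obtain ⟨h1, h2⟩ := Prod.ext_iff.1 h
          exact ⟨s, t, hst, h1.symm, h2.symm⟩
      rw [this]
      exact (isCompact_range hq').isClosed
  have hV : ∀ v : G.V, ContinuousOn segment (starPairs v ×ˢ (Set.univ : Set I)) ∧
      IsClosed (starPairs v) := by
    intro v
    constructor
    · refine (continuousOn_const (c := (vert v : G.Realization))).congr ?_
      rintro ⟨⟨x, y⟩, r⟩ ⟨⟨h1, h2⟩, -⟩
      exact segment_star h1 h2 r
    · have hc := (collapse (G := G)).continuous
      exact (isClosed_eq (by fun_prop) continuous_const).inter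
        (isClosed_eq (by fun_prop) continuous_const)
  have h1 : ContinuousOn segment (⋃ e : G.E, edgePairs e ×ˢ (Set.univ : Set I)) :=
    (locallyFinite_of_finite _).continuousOn_iUnion
      (fun e => (hE e).2.prod isClosed_univ) fun e => (hE e).1
  have h2 : ContinuousOn segment (⋃ v : G.V, starPairs v ×ˢ (Set.univ : Set I)) :=
    (locallyFinite_of_finite _).continuousOn_iUnion
      (fun e => (hV e).2.prod isClosed_univ) fun e => (hV e).1
  have := h1.union_of_isClosed h2
    (isClosed_iUnion_of_finite fun e => (hE e).2.prod isClosed_univ)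
    (isClosed_iUnion_of_finite fun e => (hV e).2.prod isClosed_univ)
  rwa [← Set.iUnion_prod_const, ← Set.iUnion_prod_const, ← Set.union_prod] at this

/-- A function that is positive on the open star of radius `1/3` around a vertex. -/
def starFun (v : G.V) : G.Realization → ℝ :=
  open Classical in
  lift (fun w => if w = v then 1 / 3 else 0)
    (fun e t => max (if G.src e = v then 1 / 3 - (t : ℝ) else 0)
      (max 0 (if G.tgt e = v then (t : ℝ) - 2 / 3 else 0)))
    (fun e => by split_ifs <;> norm_num) (fun e => by split_ifs <;> norm_num)

lemma continuous_starFun (v : G.V) : Continuous (starFun v) := by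
  classical
  refine continuous_of_cells fun e => ?_
  change Continuous fun t : I => max (if G.src e = v then 1 / 3 - (t : ℝ) else 0)
      (max 0 (if G.tgt e = v then (t : ℝ) - 2 / 3 else 0))
  split_ifs <;> fun_prop

lemma collapse_of_starFun_pos {v : G.V} {x : G.Realization} (h : 0 < starFun v x) :
    collapse x = vert v := by
  classical
  induction x using realization_ind with
  | hv w =>
    change 0 < (if w = v then (1 : ℝ) / 3 else 0) at h
    split_ifs at h with hw
    · rw [hw]; rfl
    · exact absurd h (lt_irrefl _)
  | he e t =>
    change 0 < max (if G.src e = v then 1 / 3 - (t : ℝ) else 0)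
      (max 0 (if G.tgt e = v then (t : ℝ) - 2 / 3 else 0)) at h
    rw [collapse_edge]
    rcases lt_max_iff.1 h with h | h
    · split_ifs at h with hv
      · rw [thirds_of_le (by linarith), edge_zero, hv]
      · exact absurd h (lt_irrefl _)
    · rcases lt_max_iff.1 h with h | h
      · exact absurd h (lt_irrefl _)
      · split_ifs at h with hv
        · rw [thirds_of_ge (by linarith), edge_one, hv]
        · exact absurd h (lt_irrefl _)

lemma continuous_tent (ℓ : G.E → ℝ) (e : G.E) (c δ : ℝ) (h0 : δ ≤ c) (h1 : c + δ ≤ 1) :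
    Continuous (tent ℓ e c δ h0 h1) := by
  refine continuous_of_cells fun e' => ?_
  by_cases h : e' = e
  · subst h
    simp only [tent_edge]
    fun_prop
  · simp only [tent_edge_of_ne h]
    fun_prop

end FinGraph

namespace MarkedGraph

variable (Γ : MarkedGraph n)

/-- Points of a marked graph that are close to each other can be joined by a segment after
collapsing stars. -/
lemma exists_nearPairs : ∃ r > 0, ∀ x y : Γ.graph.Realization, dist x y < r →
    (x, y) ∈ nearPairs Γ.graph := by
  -- The open cover consists of the stars of radius `1 / 3` and of windows of radius `1 / 8` inside
  -- edges. Points of the same window have parameters within `1 / 4`, so a Lebesgue number of this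
  -- cover is the required `r`.
  let c : Γ.graph.V ⊕ (Γ.graph.E × {c : ℝ // 1 / 8 ≤ c ∧ c + 1 / 8 ≤ 1}) →
      Set Γ.graph.Realization := Sum.elim (fun v => {x | 0 < starFun v x})
        fun p => {x | 0 < tent (fun _ => 1) p.1 p.2.1 (1 / 8) p.2.2.1 p.2.2.2 x}
  have hopen : ∀ i, IsOpen (c i) := by
    rintro (v | ⟨e, a, ha⟩)
    · exact isOpen_lt continuous_const (continuous_starFun v)
    · exact isOpen_lt continuous_const (continuous_tent _ _ _ _ _ _)
  have hcover : Set.univ ⊆ ⋃ i, c i := by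
    classical
    intro x _
    rw [Set.mem_iUnion]
    induction x using realization_ind with
    | hv v =>
      refine ⟨.inl v, ?_⟩
      change 0 < (if v = v then (1 : ℝ) / 3 else 0)
      norm_num
    | he e t =>
      by_cases h1 : (t : ℝ) < 1 / 3
      · refine ⟨.inl (Γ.graph.src e), ?_⟩
        change 0 < max (if Γ.graph.src e = Γ.graph.src e then 1 / 3 - (t : ℝ) else 0)
            (max 0 (if Γ.graph.tgt e = Γ.graph.src e then (t : ℝ) - 2 / 3 else 0))
        refine lt_max_of_lt_left ?_
        rw [if_pos rfl]; linarith
      · by_cases h2 : 2 / 3 < (t : ℝ)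
        · refine ⟨.inl (Γ.graph.tgt e), ?_⟩
          change 0 < max (if Γ.graph.src e = Γ.graph.tgt e then 1 / 3 - (t : ℝ) else 0)
            (max 0 (if Γ.graph.tgt e = Γ.graph.tgt e then (t : ℝ) - 2 / 3 else 0))
          refine lt_max_of_lt_right (lt_max_of_lt_right ?_)
          rw [if_pos rfl]; linarith
        · refine ⟨.inr (e, ⟨t, by linarith, by linarith⟩), ?_⟩
          change 0 < tent _ _ _ _ _ _ _
          rw [tent_edge]
          simp
  obtain ⟨r, hr, h⟩ := lebesgue_number_lemma_of_metric (isCompact_univ (X := Γ.graph.Realization))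
    hopen hcover
  refine ⟨r, hr, fun x y hxy => ?_⟩
  obtain ⟨i, hi⟩ := h x trivial
  have hx := hi (Metric.mem_ball_self hr)
  have hy := hi (Metric.mem_ball'.2 hxy)
  rcases i with v | ⟨e, a, ha⟩
  · exact .inr (Set.mem_iUnion.2 ⟨v, collapse_of_starFun_pos hx, collapse_of_starFun_pos hy⟩)
  · refine .inl (Set.mem_iUnion.2 ⟨e, ?_⟩)
    have key : ∀ z : Γ.graph.Realization, 0 < tent (fun _ => 1) e a (1 / 8) ha.1 ha.2 z →
        ∃ t : I, |(t : ℝ) - a| < 1 / 8 ∧ z = edge e t := by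
      intro z hz
      induction z using realization_ind with
      | hv w => rw [tent_vert] at hz; exact absurd hz (lt_irrefl _)
      | he e' t =>
        by_cases he : e' = e
        · subst he
          rw [tent_edge, one_mul] at hz
          refine ⟨t, ?_, rfl⟩
          rcases lt_max_iff.1 hz with h | h
          · exact absurd h (lt_irrefl _)
          · linarith
        · rw [tent_edge_of_ne he] at hz; exact absurd hz (lt_irrefl _)
    obtain ⟨s, hs, rfl⟩ := key x hx
    obtain ⟨t, ht, rfl⟩ := key y hy
    refine ⟨s, t, ?_, rfl, rfl⟩
    rw [abs_lt] at hs ht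
    rw [abs_le]
    constructor <;> linarith [hs.1, hs.2, ht.1, ht.2]

/-- Maps into a marked graph that are uniformly close are homotopic. -/
lemma exists_homotopic_of_close : ∃ r > 0,
    (∀ (X : Type) [TopologicalSpace X] (f g : C(X, Γ.graph.Realization)),
      (∀ x, dist (f x) (g x) < r) → f.Homotopic g) ∧
    ∀ (x y : Γ.graph.Realization) (γ δ : Path x y), (∀ t, dist (γ t) (δ t) < r) →
      γ.Homotopic δ := by
  obtain ⟨r, hr, h⟩ := Γ.exists_nearPairs
  have hseg : ∀ (X : Type) [TopologicalSpace X] (f g : C(X, Γ.graph.Realization)),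
      (∀ x, dist (f x) (g x) < r) → Continuous fun p : I × X => segment ((f p.2, g p.2), p.1) := by
    intro X _ f g hfg
    refine continuousOn_segment.comp_continuous (by fun_prop) fun p => ?_
    exact ⟨h _ _ (hfg p.2), trivial⟩
  refine ⟨r, hr, fun X _ f g hfg => ?_, fun x y γ δ hγ => ?_⟩
  · have h1 : (collapse.comp f).Homotopic (collapse.comp g) :=
      ⟨⟨⟨fun p : I × X => segment ((f p.2, g p.2), p.1), hseg X f g hfg⟩,
        fun x => segment_zero (h _ _ (hfg x)), fun x => segment_one (h _ _ (hfg x))⟩⟩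
    have h2 : f.Homotopic (collapse.comp f) :=
      homotopic_collapse.comp (ContinuousMap.Homotopic.refl f)
    have h3 : g.Homotopic (collapse.comp g) :=
      homotopic_collapse.comp (ContinuousMap.Homotopic.refl g)
    exact h2.trans (h1.trans h3.symm)
  -- Collapsing moves endpoints, so a path is compared with its collapse along the tracks of both
  -- ends. These tracks are the same for `γ` and `δ`.
  · let τ : ∀ z : Γ.graph.Realization, Path z (collapse z) := fun z =>
      ⟨⟨fun s => collapseHomotopy (s, z), continuous_collapseHomotopy.comp (by fun_prop)⟩,
        collapseHomotopy_zero z, rfl⟩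
    have key : ∀ γ : Path x y, γ.Homotopic ((τ x).trans
        ((γ.map collapse.continuous).trans (τ y).symm)) := by
      intro γ
      refine homotopic_of_square ⟨fun p : I × I => collapseHomotopy (p.1, γ p.2),
        continuous_collapseHomotopy.comp (by fun_prop)⟩ _ _ _ _
        (fun t => collapseHomotopy_zero _) (fun t => rfl) (fun s => ?_) (fun s => ?_)
      · simp only [ContinuousMap.coe_mk, γ.source]; rfl
      · simp only [ContinuousMap.coe_mk, γ.target]; rfl
    have h1 : (γ.map collapse.continuous).Homotopic (δ.map collapse.continuous) := by
      refine ⟨⟨⟨⟨fun p : I × I => segment ((γ p.2, δ p.2), p.1),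
        hseg I γ.toContinuousMap δ.toContinuousMap hγ⟩, fun t => segment_zero (h _ _ (hγ t)),
        fun t => segment_one (h _ _ (hγ t))⟩, ?_⟩⟩
      rintro s t (rfl | rfl)
      · simp [segment_self]
      · simp [segment_self]
    exact (key γ).trans (((Path.Homotopic.refl _).hcomp
      (h1.hcomp (Path.Homotopic.refl _))).trans (key δ).symm)

end MarkedGraph

/-! ### Tight paths and optimal maps -/

open Filter Topology in
/-- Compactness of sets of Lipschitz maps. -/
lemma LipBound.exists_limit {X Y : Type*} [PseudoMetricSpace X] [CompactSpace X] [MetricSpace Y]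
    [CompactSpace Y] {K : ℕ → ℝ} {K₀ : ℝ} (hK : Tendsto K atTop (𝓝 K₀)) (f : ℕ → X → Y)
    (hf : ∀ i, LipBound (K i) (f i)) :
    ∃ g : X → Y, LipBound K₀ g ∧ ∀ ε > 0, ∃ i, ∀ x, dist (f i x) (g x) < ε := by
  -- A nonprincipal ultrafilter provides pointwise limits at all points at once, in place of a
  -- diagonal subsequence.
  let U : Ultrafilter ℕ := hyperfilter ℕ
  have hU : (U : Filter ℕ) ≤ atTop := by
    rw [← Nat.cofinite_eq_atTop]; exact hyperfilter_le_cofinite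
  have hlim : ∀ x, ∃ y, Tendsto (fun i => f i x) U (𝓝 y) := by
    intro x
    obtain ⟨y, -, hy⟩ := (isCompact_univ (X := Y)).ultrafilter_le_nhds (U.map fun i => f i x)
      (by simp)
    exact ⟨y, hy⟩
  choose g hg using hlim
  have hKU := hK.mono_left hU
  refine ⟨g, fun x y => ?_, fun ε hε => ?_⟩
  · exact le_of_tendsto_of_tendsto ((hg x).dist (hg y)) (hKU.mul_const _)
      (Eventually.of_forall fun i => hf i x y)
  -- A positive Lipschitz bound valid for both the limit and a late map. It turns closeness on a
  -- finite net into uniform closeness.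
  · set B := max (K₀ + 1) 1 with hB
    have hB0 : 0 < B := lt_max_of_lt_right one_pos
    obtain ⟨t, -, ht, hcov⟩ := (isCompact_univ (X := X)).finite_cover_balls
      (show 0 < ε / (3 * B) by positivity)
    have h1 : ∀ᶠ i in (U : Filter ℕ), ∀ x ∈ t, dist (f i x) (g x) < ε / 3 := by
      rw [eventually_all_finite ht]
      intro x _
      exact (tendsto_iff_dist_tendsto_zero.1 (hg x)).eventually (gt_mem_nhds (by positivity))
    have h2 : ∀ᶠ i in (U : Filter ℕ), K i < K₀ + 1 := hKU.eventually (gt_mem_nhds (by linarith))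
    obtain ⟨i, hi1, hi2⟩ := (h1.and h2).exists
    have hgL : LipBound B g := by
      refine LipBound.mono (K := K₀) (fun x y => ?_) ((by linarith : K₀ ≤ K₀ + 1).trans
        (le_max_left _ _))
      exact le_of_tendsto_of_tendsto ((hg x).dist (hg y)) (hKU.mul_const _)
        (Eventually.of_forall fun i => hf i x y)
    have hfL : LipBound B (f i) := (hf i).mono (hi2.le.trans (le_max_left _ _))
    refine ⟨i, fun x => ?_⟩
    obtain ⟨y, hy, hxy⟩ := Set.mem_iUnion₂.1 (hcov (Set.mem_univ x))
    rw [Metric.mem_ball] at hxy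
    have e1 := hfL x y
    have e2 := hgL y x
    rw [dist_comm y x] at e2
    have e3 := hi1 y hy
    have e4 : B * dist x y < ε / 3 := by
      have := mul_lt_mul_of_pos_left hxy hB0
      have e5 : B * (ε / (3 * B)) = ε / 3 := by field_simp
      linarith
    have := dist_triangle4 (f i x) (f i y) (g y) (g x)
    linarith

lemma LipBound.nonneg_of_path {Y : Type*} [PseudoMetricSpace Y] {K : ℝ} {f : I → Y}
    (h : LipBound K f) : 0 ≤ K := by
  have := h 0 1
  have h1 : dist (0 : I) 1 = 1 := by simp [Subtype.dist_eq]
  rw [h1, mul_one] at this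
  exact dist_nonneg.trans this

namespace MarkedGraph

variable {Γ : MarkedGraph n}

/-- Every path is uniformly close to a Lipschitz path with the same endpoints. -/
lemma exists_lipBound_close {x y : Γ.graph.Realization} (γ : Path x y) {ε : ℝ} (hε : 0 < ε) :
    ∃ (K : ℝ) (δ : Path x y), LipBound K δ ∧ ∀ t, dist (γ t) (δ t) < ε := by
  obtain ⟨η, hη, hu⟩ := Metric.uniformContinuous_iff.1
    (CompactSpace.uniformContinuous_of_continuous γ.continuous) (ε / 3) (by positivity)
  obtain ⟨N, hN⟩ := exists_nat_one_div_lt hη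
  set M : ℝ := (N : ℝ) + 1 with hM
  have hM0 : 0 < M := by positivity
  let c : ℝ → Γ.graph.Realization := fun t => γ (Set.projIcc 0 1 zero_le_one t)
  have hc : ∀ s t : ℝ, |s - t| ≤ 1 / M → dist (c s) (c t) < ε / 3 := fun s t hst =>
    hu ((dist_projIcc_le s t).trans_lt (by rw [Real.dist_eq]; exact hst.trans_lt hN))
  have key : ∀ k : ℕ, ∃ (K : ℝ) (ρ : ℝ → Γ.graph.Realization), LipBound K ρ ∧ ρ 0 = x ∧
      ρ (k / M) = c (k / M) ∧ ∀ t, 0 ≤ t → t ≤ k / M → dist (c t) (ρ t) < ε := by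
    intro k
    induction k with
    | zero =>
      have h0 : c 0 = x := by simp [c]
      refine ⟨0, fun _ => x, LipBound.const 0 le_rfl x, rfl, by simp [h0], fun t h1 h2 => ?_⟩
      have : t = 0 := le_antisymm (by simpa using h2) h1
      rw [this, h0, dist_self]
      exact hε
    | succ k ih =>
      obtain ⟨K, ρ, hρ, h0, hk, hcl⟩ := ih
      have hstep : |(k : ℝ) / M - ((k + 1 : ℕ) : ℝ) / M| ≤ 1 / M := by
        rw [← sub_div]
        push_cast
        rw [abs_div, abs_of_pos hM0]
        simp
      obtain ⟨r, hr, hr0, κ, hκ, hκ0, hκr⟩ := exists_curve (hc _ _ hstep)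
      -- The connecting curve of length `r < ε / 3` is run through in the time `1 / M` of one
      -- subdivision interval.
      let g : ℝ → Γ.graph.Realization := fun t => κ ((t - k / M) * (M * r))
      have hg : LipBound (M * r) g := fun s t => by
        refine (hκ _ _).trans ?_
        rw [one_mul, Real.dist_eq, Real.dist_eq]
        have : (s - k / M) * (M * r) - (t - k / M) * (M * r) = (M * r) * (s - t) := by ring
        rw [this, abs_mul, abs_of_nonneg (by positivity)]
      have hgk : g (k / M) = c (k / M) := by simp [g, hκ0]
      have hgk1 : g ((k + 1 : ℕ) / M) = c ((k + 1 : ℕ) / M) := by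
        have : (((k + 1 : ℕ) : ℝ) / M - k / M) * (M * r) = r := by
          push_cast
          field_simp
          ring
        simp only [g, this, hκr]
      refine ⟨_, _, (hρ.mono (le_max_left K (M * r))).glue (hg.mono (le_max_right K (M * r)))
        (hk.trans hgk.symm), ?_, ?_, fun t ht0 ht => ?_⟩
      · have : (0 : ℝ) ≤ k / M := by positivity
        simp only [this, if_true, h0]
      · have : ¬ ((k + 1 : ℕ) : ℝ) / M ≤ k / M := by
          rw [not_le]
          gcongr
          simp
        simp only [this, if_false, hgk1]
      · split_ifs with h
        · exact hcl t ht0 h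
        · rw [not_le] at h
          have e1 : dist (c t) (c (k / M)) < ε / 3 := by
            refine hc _ _ ?_
            rw [abs_of_nonneg (by linarith)]
            push_cast at ht
            rw [add_div] at ht
            linarith
          have e2 : dist (c (k / M)) (g t) < ε / 3 := by
            rw [← hgk]
            refine (hg _ _).trans_lt ?_
            rw [Real.dist_eq, abs_sub_comm, abs_of_nonneg (by linarith)]
            push_cast at ht
            rw [add_div] at ht
            have : M * r * (t - k / M) ≤ M * r * (1 / M) := by gcongr; linarith
            have e : M * r * (1 / M) = r := by field_simp
            linarith
          linarith [dist_triangle (c t) (c (k / M)) (g t)]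
  obtain ⟨K, ρ, hρ, h0, h1, hcl⟩ := key (N + 1)
  have e1 : ((N + 1 : ℕ) : ℝ) / M = 1 := by push_cast; exact div_self hM0.ne'
  rw [e1] at h1 hcl
  have hy : c 1 = y := by simp [c]
  refine ⟨K, ⟨⟨fun t => ρ t, hρ.continuous.comp continuous_subtype_val⟩, by simp [h0],
    by simp [h1, hy]⟩, fun s t => hρ s t, fun t => ?_⟩
  have := hcl t t.2.1 t.2.2
  simpa [c] using this

/-- A path of least Lipschitz constant among the paths close to it is a local geodesic. -/
lemma dist_eq_of_minimal {x y : Γ.graph.Realization} {c : Path x y} {K r : ℝ} (hr : 0 < r)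
    (hc : LipBound K c) (hmin : ∀ K' (δ : Path x y), LipBound K' δ →
      (∀ t, dist (c t) (δ t) < r) → K ≤ K') :
    ∃ η > 0, ∀ a b : I, a ≤ b → (b : ℝ) - a < η → dist (c a) (c b) = K * (b - a) := by
  rcases hc.nonneg_of_path.eq_or_lt with h0 | hK
  · refine ⟨1, one_pos, fun a b _ _ => le_antisymm ?_ ?_⟩
    · have := hc a b
      rw [← h0, zero_mul] at this ⊢
      exact this
    · rw [← h0, zero_mul]; exact dist_nonneg
  -- A shortcut between `a` and `b` will move the path by at most `3 * K * (b - a)`, including the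
  -- change of parametrization, and this is less than `3 * r / 4`.
  refine ⟨r / (4 * K), by positivity, fun a b hab hη => ?_⟩
  have habr : (a : ℝ) ≤ b := hab
  have hle : dist (c a) (c b) ≤ K * (b - a) := by
    have := hc a b
    rwa [Subtype.dist_eq, Real.dist_eq, abs_sub_comm, abs_of_nonneg (sub_nonneg.2 habr)] at this
  refine hle.eq_of_not_lt fun hlt => ?_
  obtain ⟨l, hl, hl0, ρ, hρ, hρ0, hρl⟩ := exists_curve hlt
  let cc : ℝ → Γ.graph.Realization := fun u => c (Set.projIcc 0 1 zero_le_one (u / K))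
  have hcc : LipBound 1 cc := fun u v => by
    refine (hc _ _).trans ?_
    have := dist_projIcc_le (u / K) (v / K)
    rw [Real.dist_eq, ← sub_div, abs_div, abs_of_pos hK] at this
    rw [one_mul, Real.dist_eq]
    calc _ ≤ K * (|u - v| / K) := mul_le_mul_of_nonneg_left this hK.le
      _ = _ := by field_simp
  have hccK : ∀ t : I, cc (K * t) = c t := fun t => by
    simp only [cc, mul_div_cancel_left₀ _ hK.ne', Set.projIcc_val]
  let a' : ℝ := K * a
  let b' : ℝ := K * b
  -- The path reparametrized to unit speed, with the part from `a'` to `b'` replaced by the shorter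
  -- curve `ρ` of length `l` and the rest shifted. Its total duration is `Λ` below, which is less
  -- than `K`; rescaled to the unit interval it contradicts minimality.
  let e : ℝ → Γ.graph.Realization := fun u =>
    if u ≤ a' then cc u else if u ≤ a' + l then ρ (u - a') else cc (u - (a' + l) + b')
  have ha0 : 0 ≤ a' := mul_nonneg hK.le a.2.1
  have hb1 : b' ≤ K := by
    have := mul_le_mul_of_nonneg_left b.2.2 hK.le
    simpa [b'] using this
  have hab' : K * (b - a) = b' - a' := by simp only [a', b']; ring
  have g1 : LipBound 1 fun u => ρ (u - a') := fun u v => by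
    have := hρ (u - a') (v - a')
    simpa using this
  have g2 : LipBound 1 fun u => cc (u - (a' + l) + b') := fun u v => by
    have := hcc (u - (a' + l) + b') (v - (a' + l) + b')
    simpa using this
  have h1 : ρ (a' + l - a') = cc (a' + l - (a' + l) + b') := by
    rw [add_sub_cancel_left, hρl, sub_self, zero_add, hccK]
  have g3 := LipBound.glue g1 g2 (u := a' + l) h1
  have he : LipBound 1 e := by
    refine LipBound.glue hcc g3 (u := a') ?_
    simp only [le_add_iff_nonneg_right, hl0, if_true, sub_self, hρ0]
    exact hccK a
  have heR : ∀ u, a' + l ≤ u → e u = cc (u - (a' + l) + b') := by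
    intro u hu
    simp only [e]
    split_ifs with h2 h3
    · have hl' : l = 0 := by linarith
      have hu' : u = a' := by linarith
      rw [hu', hl', add_zero, sub_self, zero_add, hccK, hccK, ← hρl, hl', hρ0]
    · have hu' : u = a' + l := by linarith
      rw [hu', h1]
    · rfl
  let Λ : ℝ := K - (b' - a') + l
  have hΛ0 : 0 ≤ Λ := by simp only [Λ]; linarith
  have hΛK : Λ < K := by simp only [Λ]; linarith
  have hclose : ∀ u, dist (e u) (cc u) ≤ 2 * (b' - a') := by
    intro u
    have hba : 0 ≤ b' - a' := by rw [← hab']; exact mul_nonneg hK.le (sub_nonneg.2 habr)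
    simp only [e]
    split_ifs with h2 h3
    · rw [dist_self]; positivity
    · rw [not_le] at h2
      have d1 := hρ (u - a') 0
      have d2 := hcc a' u
      rw [hρ0, one_mul, Real.dist_eq, sub_zero, abs_of_nonneg (by linarith)] at d1
      rw [hccK a, one_mul, Real.dist_eq, abs_sub_comm, abs_of_nonneg (by linarith)] at d2
      linarith [dist_triangle (ρ (u - a')) (c a) (cc u)]
    · have d2 := hcc (u - (a' + l) + b') u
      rw [one_mul, Real.dist_eq] at d2
      have : u - (a' + l) + b' - u = b' - a' - l := by ring
      rw [this, abs_of_nonneg (by linarith)] at d2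
      linarith
  refine absurd (hmin Λ ⟨⟨fun t => e (Λ * t), he.continuous.comp (by fun_prop)⟩, ?_, ?_⟩ ?_ ?_)
    (not_le.2 hΛK)
  · simp only [Set.Icc.coe_zero, mul_zero]
    simp only [e, ha0, if_true]
    simp [cc]
  · simp only [Set.Icc.coe_one, mul_one]
    rw [heR Λ (by simp only [Λ]; linarith)]
    have : Λ - (a' + l) + b' = K * ((1 : I) : ℝ) := by
      simp only [Λ, Set.Icc.coe_one]; ring
    rw [this, hccK, c.target]
  · intro s t
    have := he (Λ * s) (Λ * t)
    rw [one_mul, Real.dist_eq, ← mul_sub, abs_mul, abs_of_nonneg hΛ0] at this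
    exact this
  · intro t
    change dist (c t) (e (Λ * t)) < r
    have d1 := hclose (Λ * t)
    have d2 := hcc (Λ * t) (K * t)
    rw [one_mul, Real.dist_eq, ← sub_mul, abs_mul, abs_of_nonneg t.2.1, hccK,
      abs_sub_comm, abs_of_pos (by linarith)] at d2
    have d3 : (K - Λ) * (t : ℝ) ≤ b' - a' := by
      have : (K - Λ) * (t : ℝ) ≤ (K - Λ) * 1 :=
        mul_le_mul_of_nonneg_left t.2.2 (by linarith)
      simp only [Λ] at this ⊢
      linarith
    have d4 : K * (b - a) < r / 4 := by
      have := mul_lt_mul_of_pos_left hη hK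
      have e5 : K * (r / (4 * K)) = r / 4 := by field_simp
      linarith
    rw [dist_comm] 
    linarith [dist_triangle (e (Λ * t)) (cc (Λ * t)) (c t)]

/-- Every path is homotopic to a shortest path, which is a local geodesic of constant speed. -/
theorem exists_tight {x y : Γ.graph.Realization} (γ : Path x y) :
    ∃ (δ : Path x y) (s : ℝ), δ.Homotopic γ ∧ LipBound s δ ∧
      IsLocalGeodesic Γ.length (δ : I → Γ.graph.Realization) s ∧
      ∀ (K : ℝ) (δ' : Path x y), δ'.Homotopic γ → LipBound K δ' → s ≤ K := by
  obtain ⟨r, hr, -, hcl⟩ := Γ.exists_homotopic_of_close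
  let A : Set ℝ := {K | ∃ δ : Path x y, δ.Homotopic γ ∧ LipBound K δ}
  have hbdd : BddBelow A := ⟨0, fun K ⟨δ, _, h⟩ => h.nonneg_of_path⟩
  have hne : A.Nonempty := by
    obtain ⟨K, δ, hδ, h⟩ := exists_lipBound_close γ hr
    exact ⟨K, δ, (hcl _ _ _ _ h).symm, hδ⟩
  obtain ⟨K, -, hKt, hKA⟩ := exists_seq_tendsto_sInf hne hbdd
  choose δ hδγ hδK using hKA
  obtain ⟨g, hg, hgc⟩ := LipBound.exists_limit hKt (fun i => ⇑(δ i)) hδK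
  have hgx : g 0 = x := by
    refine (eq_of_forall_dist_le fun ε hε => ?_).symm
    obtain ⟨i, hi⟩ := hgc ε hε
    have := hi 0
    rw [(δ i).source] at this
    exact this.le
  have hgy : g 1 = y := by
    refine (eq_of_forall_dist_le fun ε hε => ?_).symm
    obtain ⟨i, hi⟩ := hgc ε hε
    have := hi 1
    rw [(δ i).target] at this
    exact this.le
  let p : Path x y := ⟨⟨g, hg.continuous⟩, hgx, hgy⟩
  have hp : p.Homotopic γ := by
    obtain ⟨i, hi⟩ := hgc r hr
    exact (hcl _ _ _ _ (fun t => hi t)).symm.trans (hδγ i)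
  have hmin : ∀ (K : ℝ) (δ' : Path x y), δ'.Homotopic γ → LipBound K δ' → sInf A ≤ K :=
    fun K δ' h h' => csInf_le hbdd ⟨δ', h, h'⟩
  -- Nearby paths with the same endpoints are homotopic, so minimality in the homotopy class gives
  -- minimality among nearby paths.
  obtain ⟨η, hη, hgeo⟩ := dist_eq_of_minimal (c := p) hr hg fun K' δ' h1 h2 =>
    hmin K' δ' ((hcl _ _ _ _ h2).symm.trans hp) h1
  refine ⟨p, sInf A, hp, hg, fun t => ?_, hmin⟩
  refine ⟨Metric.ball t (η / 2), Metric.ball_mem_nhds _ (by positivity), fun a ha b hb => ?_⟩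
  have hd : dist a b < η := by
    rw [Metric.mem_ball] at ha hb
    linarith [dist_triangle_right a b t]
  change dist (p a) (p b) = _
  rw [Subtype.dist_eq, Real.dist_eq] at hd ⊢
  rcases le_total a b with hab | hab
  · have : (a : ℝ) ≤ b := hab
    rw [abs_sub_comm, abs_of_nonneg (by linarith)] at hd ⊢
    exact hgeo a b hab hd
  · have : (b : ℝ) ≤ a := hab
    rw [abs_of_nonneg (by linarith)] at hd ⊢
    rw [dist_comm]
    exact hgeo b a hab hd

end MarkedGraph

/-! ### Maps out of a graph prescribed by paths along its edges -/

namespace FinGraph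

variable {G : FinGraph} {X : Type*} [TopologicalSpace X]

/-- The map given by paths along the edges. -/
def mapOfPaths (fV : G.V → X) (P : ∀ e, Path (fV (G.src e)) (fV (G.tgt e))) :
    C(G.Realization, X) where
  toFun := lift fV (fun e t => P e t) (fun e => (P e).source) (fun e => (P e).target)
  continuous_toFun := continuous_of_cells fun e => (P e).continuous

lemma mapOfPaths_edge (fV : G.V → X) (P : ∀ e, Path (fV (G.src e)) (fV (G.tgt e))) (e : G.E)
    (t : I) : mapOfPaths fV P (edge e t) = P e t := rfl

lemma mapOfPaths_vert (fV : G.V → X) (P : ∀ e, Path (fV (G.src e)) (fV (G.tgt e))) (v : G.V) :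
    mapOfPaths fV P (vert v) = fV v := rfl

/-- The restriction of a map to an edge. -/
def edgePath (φ : C(G.Realization, X)) (e : G.E) : Path (φ (vert (G.src e))) (φ (vert (G.tgt e))) :=
  ⟨⟨fun t => φ (edge e t), φ.continuous.comp (continuous_edge e)⟩, by simp [edge_zero],
    by simp [edge_one]⟩

lemma mapOfPaths_homotopic {fV : G.V → X} {P Q : ∀ e, Path (fV (G.src e)) (fV (G.tgt e))}
    (h : ∀ e, (P e).Homotopic (Q e)) : (mapOfPaths fV P).Homotopic (mapOfPaths fV Q) := by
  let H := fun e => (h e).some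
  let F : I × G.Realization → X := fun p =>
    lift fV (fun e t => H e (p.1, t)) (fun e => (H e).source p.1) (fun e => (H e).target p.1) p.2
  have hF : Continuous F := continuous_prod (fun v => continuous_const) fun e => (H e).continuous
  refine ⟨⟨⟨F, hF⟩, fun x => ?_, fun x => ?_⟩⟩
  · induction x using realization_ind with
    | hv v => rfl
    | he e t => exact (H e).apply_zero t
  · induction x using realization_ind with
    | hv v => rfl
    | he e t => exact (H e).apply_one t

lemma mapOfPaths_edgePath (φ : C(G.Realization, X)) :
    mapOfPaths (fun v => φ (vert v)) (edgePath φ) = φ := by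
  ext x
  induction x using realization_ind with
  | hv v => rfl
  | he e t => rfl

end FinGraph

namespace MarkedGraph

variable {Γ Γ' : MarkedGraph n}

/-- A map can be replaced by a homotopic one that is linear on edges and not longer on any edge. -/
lemma exists_linear (φ : C(Γ.graph.Realization, Γ'.graph.Realization)) (K : Γ.graph.E → ℝ)
    (hK : ∀ e, LipBound (K e) (edgePath φ e)) :
    ∃ ψ : C(Γ.graph.Realization, Γ'.graph.Realization), ψ.Homotopic φ ∧ ∀ e, ∃ s,
      s * Γ.length e ≤ K e ∧ HasSlope Γ.length Γ'.length ψ e s ∧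
      LipBound (s * Γ.length e) (edgePath ψ e) := by
  -- Tightening fixes the endpoints of each edge path, so the homotopies on the edges fit together
  -- and the images of vertices do not move.
  choose δ s h1 h2 h3 h4 using fun e => exists_tight (edgePath φ e)
  refine ⟨mapOfPaths (fun v => φ (vert v)) δ, ?_, fun e => ⟨s e / Γ.length e, ?_, ?_, ?_⟩⟩
  · have := mapOfPaths_homotopic (fV := fun v => φ (vert v)) h1
    rwa [mapOfPaths_edgePath] at this
  · rw [div_mul_cancel₀ _ (Γ.length_pos e).ne']
    exact h4 e _ _ (Path.Homotopic.refl _) (hK e)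
  · unfold HasSlope
    rw [div_mul_cancel₀ _ (Γ.length_pos e).ne']
    exact h3 e
  · rw [div_mul_cancel₀ _ (Γ.length_pos e).ne']
    exact h2 e

variable (Γ Γ') in
/-- The homotopy class of maps that are compatible with the markings. -/
def Compatible (φ : C(Γ.graph.Realization, Γ'.graph.Realization)) : Prop :=
  (φ.comp Γ.marking).Homotopic Γ'.marking

lemma Compatible.homotopic {φ ψ : C(Γ.graph.Realization, Γ'.graph.Realization)}
    (h : Compatible Γ Γ' φ) (hψ : ψ.Homotopic φ) : Compatible Γ Γ' ψ :=
  (hψ.comp (ContinuousMap.Homotopic.refl _)).trans h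

lemma Compatible.comp {Γ'' : MarkedGraph n} {φ : C(Γ.graph.Realization, Γ'.graph.Realization)}
    {ψ : C(Γ'.graph.Realization, Γ''.graph.Realization)} (hψ : Compatible Γ' Γ'' ψ)
    (hφ : Compatible Γ Γ' φ) : Compatible Γ Γ'' (ψ.comp φ) :=
  ((ContinuousMap.Homotopic.refl ψ).comp hφ).trans hψ

/-- Precomposition with a homotopy inverse of the marking cancels it. Compatible maps thus form a
single homotopy class. -/
lemma Compatible.homotopic_of {φ ψ : C(Γ.graph.Realization, Γ'.graph.Realization)}
    (hφ : Compatible Γ Γ' φ) (hψ : Compatible Γ Γ' ψ) : φ.Homotopic ψ := by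
  obtain ⟨h, hh⟩ := Γ.isMarking
  have e : ∀ φ : C(Γ.graph.Realization, Γ'.graph.Realization),
      ((φ.comp Γ.marking).comp h.invFun).Homotopic φ := fun φ => by
    rw [ContinuousMap.comp_assoc, ← hh]
    exact (ContinuousMap.Homotopic.refl φ).comp h.right_inv
  exact (e φ).symm.trans (((hφ.trans hψ.symm).comp (ContinuousMap.Homotopic.refl _)).trans (e ψ))

variable (Γ Γ') in
lemma exists_compatible : ∃ φ, Compatible Γ Γ' φ := by
  obtain ⟨h, hh⟩ := Γ.isMarking
  refine ⟨Γ'.marking.comp h.invFun, ?_⟩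
  unfold Compatible
  rw [ContinuousMap.comp_assoc, ← hh]
  exact (ContinuousMap.Homotopic.refl Γ'.marking).comp h.left_inv

/-- Images of vertices are kept and each edge path is replaced by a nearby Lipschitz path.
Finiteness of the graph gives one constant for all edges. -/
lemma exists_lipBound_homotopic (φ : C(Γ.graph.Realization, Γ'.graph.Realization)) :
    ∃ (K : ℝ) (ψ : C(Γ.graph.Realization, Γ'.graph.Realization)), LipBound K ψ ∧
      ψ.Homotopic φ := by
  obtain ⟨r, hr, hcl, -⟩ := Γ'.exists_homotopic_of_close
  choose K δ h1 h2 using fun e => exists_lipBound_close (edgePath φ e) hr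
  obtain ⟨m, hm, hml⟩ := Γ.exists_length_lower_bound
  obtain ⟨B, hB⟩ := (Set.finite_range K).bddAbove
  have hB' : ∀ e, K e ≤ (max B 0 / m) * Γ.length e := fun e => by
    have h3 : K e ≤ max B 0 := (hB ⟨e, rfl⟩).trans (le_max_left _ _)
    have h4 : max B 0 / m * m ≤ max B 0 / m * Γ.length e :=
      mul_le_mul_of_nonneg_left (hml e) (by positivity)
    rw [div_mul_cancel₀ _ hm.ne'] at h4
    linarith
  refine ⟨max B 0 / m, mapOfPaths (fun v => φ (vert v)) δ,
    lipBound_of_edges (by positivity) fun e => (h1 e).mono (hB' e), ?_⟩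
  refine (hcl _ _ _ fun x => ?_)
  induction x using realization_ind with
  | hv v => rw [mapOfPaths_vert, dist_self]; exact hr
  | he e t => rw [mapOfPaths_edge, dist_comm]; exact h2 e t

lemma lipBound_nonneg [Nonempty Γ.graph.E] {Y : Type*} [PseudoMetricSpace Y] {K : ℝ}
    {φ : Γ.graph.Realization → Y} (h : LipBound K φ) : 0 ≤ K := by
  obtain ⟨e⟩ := ‹Nonempty Γ.graph.E›
  by_contra hK
  rw [not_le] at hK
  have h1 : (edge e 0 : Γ.graph.Realization) ≠ edge e ⟨1 / 2, by norm_num, by norm_num⟩ := by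
    rw [edge_zero]
    exact (edge_ne_vert (by rw [← Subtype.coe_lt_coe]; norm_num)
      (by rw [← Subtype.coe_lt_coe]; norm_num) _).symm
  have h2 := h (edge e 0) (edge e ⟨1 / 2, by norm_num, by norm_num⟩)
  have h3 := mul_neg_of_neg_of_pos hK (dist_pos.2 h1)
  linarith [dist_nonneg (x := φ (edge e 0)) (y := φ (edge e ⟨1 / 2, by norm_num, by norm_num⟩))]

variable (Γ Γ') in
/-- There is a compatible map of least Lipschitz constant. -/
theorem exists_optimal : ∃ (K : ℝ) (φ : C(Γ.graph.Realization, Γ'.graph.Realization)),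
    Compatible Γ Γ' φ ∧ LipBound K φ ∧ 0 ≤ K ∧ ∀ K' φ', Compatible Γ Γ' φ' →
      LipBound K' φ' → K ≤ K' := by
  have := Γ.nonempty_edges
  obtain ⟨r, hr, hcl, -⟩ := Γ'.exists_homotopic_of_close
  -- A uniform limit of maps whose constants tend to the infimum is again compatible, because it is
  -- close to one of them.
  let A : Set ℝ := {K | ∃ φ, Compatible Γ Γ' φ ∧ LipBound K φ}
  have hbdd : BddBelow A := ⟨0, fun K ⟨δ, _, h⟩ => lipBound_nonneg h⟩
  have hne : A.Nonempty := by
    obtain ⟨φ, hφ⟩ := exists_compatible Γ Γ'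
    obtain ⟨K, ψ, h1, h2⟩ := exists_lipBound_homotopic φ
    exact ⟨K, ψ, hφ.homotopic h2, h1⟩
  obtain ⟨K, -, hKt, hKA⟩ := exists_seq_tendsto_sInf hne hbdd
  choose φ hφ hφK using hKA
  obtain ⟨g, hg, hgc⟩ := LipBound.exists_limit hKt (fun i => ⇑(φ i)) hφK
  obtain ⟨i, hi⟩ := hgc r hr
  refine ⟨sInf A, ⟨g, hg.continuous⟩, (hφ i).homotopic ?_, hg, lipBound_nonneg hg,
    fun K' φ' h1 h2 => csInf_le hbdd ⟨φ', h1, h2⟩⟩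
  exact (hcl _ (φ i) ⟨g, hg.continuous⟩ hi).symm

end MarkedGraph

/-! ### Trees of reduced fractional words -/

/-- Words whose last letter may be fractional. -/
inductive FracWord (D : Type) : Type
  | nil : FracWord D
  | part (a : D) (s : Set.Ioo (0 : ℝ) 1) : FracWord D
  | cons (a : D) (x : FracWord D) : FracWord D

namespace FracWord

variable {D : Type} (w : D → ℝ)

/-- The weighted length of a word. -/
def len : FracWord D → ℝ
  | nil => 0
  | part a s => w a * s
  | cons a x => w a + len x

open Classical in
/-- The weighted length of the longest common initial segment. -/
def prod : FracWord D → FracWord D → ℝ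
  | nil, _ => 0
  | part _ _, nil => 0
  | part a s, part b t => if a = b then w a * min (s : ℝ) t else 0
  | part a s, cons b _ => if a = b then w a * s else 0
  | cons _ _, nil => 0
  | cons a _, part b t => if a = b then w a * t else 0
  | cons a x, cons b y => if a = b then w a + prod x y else 0

variable {w}

lemma len_nonneg (hw : ∀ a, 0 < w a) (x : FracWord D) : 0 ≤ len w x := by
  induction x with
  | nil => exact le_rfl
  | part a s => exact mul_nonneg (hw a).le s.2.1.le
  | cons a x ih => exact add_nonneg (hw a).le ih

lemma prod_comm (x y : FracWord D) : prod w x y = prod w y x := by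
  induction x generalizing y with
  | nil => cases y <;> rfl
  | part a s =>
    cases y with
    | nil => rfl
    | part b t =>
      by_cases h : a = b
      · subst h; simp [prod, min_comm]
      · simp [prod, h, Ne.symm h]
    | cons b y =>
      by_cases h : a = b
      · subst h; simp [prod]
      · simp [prod, h, Ne.symm h]
  | cons a x ih =>
    cases y with
    | nil => rfl
    | part b t =>
      by_cases h : a = b
      · subst h; simp [prod]
      · simp [prod, h, Ne.symm h]
    | cons b y =>
      by_cases h : a = b
      · subst h; simp [prod, ih y]
      · simp [prod, h, Ne.symm h]

lemma prod_self (x : FracWord D) : prod w x x = len w x := by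
  induction x with
  | nil => rfl
  | part a s => simp [prod, len]
  | cons a x ih => simp [prod, len, ih]

lemma prod_nonneg (hw : ∀ a, 0 < w a) (x y : FracWord D) : 0 ≤ prod w x y := by
  induction x generalizing y with
  | nil => cases y <;> exact le_rfl
  | part a s =>
    have h0 := s.2.1.le
    have h1 := (hw a).le
    cases y with
    | nil => exact le_rfl
    | part b t => have := t.2.1.le; simp only [prod]; split_ifs <;> positivity
    | cons b y => simp only [prod]; split_ifs <;> positivity
  | cons a x ih =>
    have h1 := (hw a).le
    cases y with
    | nil => exact le_rfl
    | part b t => have := t.2.1.le; simp only [prod]; split_ifs <;> positivity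
    | cons b y => have := ih y; simp only [prod]; split_ifs <;> positivity

lemma prod_le_left (hw : ∀ a, 0 < w a) (x y : FracWord D) : prod w x y ≤ len w x := by
  induction x generalizing y with
  | nil => cases y <;> exact le_rfl
  | part a s =>
    have h0 := s.2.1.le
    have h1 := (hw a).le
    cases y with
    | nil => exact len_nonneg hw _
    | part b t =>
      simp only [prod, len]
      split_ifs
      · exact mul_le_mul_of_nonneg_left (min_le_left _ _) h1
      · positivity
    | cons b y => simp only [prod, len]; split_ifs <;> [exact le_rfl; positivity]
  | cons a x ih =>
    have h1 := (hw a).le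
    have h2 := len_nonneg hw x
    cases y with
    | nil => exact len_nonneg hw _
    | part b t =>
      have := mul_le_mul_of_nonneg_left t.2.2.le h1
      simp only [prod, len]; split_ifs <;> linarith
    | cons b y => have := ih y; simp only [prod, len]; split_ifs <;> linarith

lemma prod_le_right (hw : ∀ a, 0 < w a) (x y : FracWord D) : prod w x y ≤ len w y :=
  prod_comm (w := w) y x ▸ prod_le_left hw y x

/-- Two words that share initial segments with a third share the shorter of the two with each other.
This ultrametric inequality is the whole tree property. -/
lemma min_prod_le (hw : ∀ a, 0 < w a) (x y z : FracWord D) :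
    min (prod w x y) (prod w y z) ≤ prod w x z := by
  have hz : ∀ a b c : ℝ, a ≤ 0 → 0 ≤ c → min a b ≤ c := fun a b c h1 h2 =>
    (min_le_left _ _).trans (h1.trans h2)
  have hz' : ∀ a b c : ℝ, b ≤ 0 → 0 ≤ c → min a b ≤ c := fun a b c h1 h2 =>
    (min_le_right _ _).trans (h1.trans h2)
  induction x generalizing y z with
  | nil => exact hz _ _ _ (by cases y <;> exact le_rfl) (prod_nonneg hw _ _)
  | part a s =>
    have ha := (hw a).le
    cases y with
    | nil => exact hz _ _ _ le_rfl (prod_nonneg hw _ _)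
    | part b t =>
      cases z with
      | nil => exact hz' _ _ _ le_rfl (prod_nonneg hw _ _)
      | part c u =>
        by_cases hab : a = b
        · by_cases hbc : b = c
          · subst hab hbc
            simp only [prod, if_true]
            rw [← mul_min_of_nonneg _ _ ha]
            refine mul_le_mul_of_nonneg_left (le_min ?_ ?_) ha
            · exact (min_le_left _ _).trans (min_le_left _ _)
            · exact (min_le_right _ _).trans (min_le_right _ _)
          · exact hz' _ _ _ (by simp [prod, hbc]) (prod_nonneg hw _ _)
        · exact hz _ _ _ (by simp [prod, hab]) (prod_nonneg hw _ _)
      | cons c z =>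
        by_cases hab : a = b
        · by_cases hbc : b = c
          · subst hab hbc
            simp only [prod, if_true]
            exact (min_le_left _ _).trans (mul_le_mul_of_nonneg_left (min_le_left _ _) ha)
          · exact hz' _ _ _ (by simp [prod, hbc]) (prod_nonneg hw _ _)
        · exact hz _ _ _ (by simp [prod, hab]) (prod_nonneg hw _ _)
    | cons b y =>
      cases z with
      | nil => exact hz' _ _ _ le_rfl (prod_nonneg hw _ _)
      | part c u =>
        by_cases hab : a = b
        · by_cases hbc : b = c
          · subst hab hbc
            simp only [prod, if_true]
            rw [← mul_min_of_nonneg _ _ ha]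
          · exact hz' _ _ _ (by simp [prod, hbc]) (prod_nonneg hw _ _)
        · exact hz _ _ _ (by simp [prod, hab]) (prod_nonneg hw _ _)
      | cons c z =>
        by_cases hab : a = b
        · by_cases hbc : b = c
          · subst hab hbc
            simp only [prod, if_true]
            exact min_le_left _ _
          · exact hz' _ _ _ (by simp [prod, hbc]) (prod_nonneg hw _ _)
        · exact hz _ _ _ (by simp [prod, hab]) (prod_nonneg hw _ _)
  | cons a x ih =>
    have ha := (hw a).le
    cases y with
    | nil => exact hz _ _ _ le_rfl (prod_nonneg hw _ _)
    | part b t =>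
      cases z with
      | nil => exact hz' _ _ _ le_rfl (prod_nonneg hw _ _)
      | part c u =>
        by_cases hab : a = b
        · by_cases hbc : b = c
          · subst hab hbc
            simp only [prod, if_true]
            exact (min_le_right _ _).trans (mul_le_mul_of_nonneg_left (min_le_right _ _) ha)
          · exact hz' _ _ _ (by simp [prod, hbc]) (prod_nonneg hw _ _)
        · exact hz _ _ _ (by simp [prod, hab]) (prod_nonneg hw _ _)
      | cons c z =>
        by_cases hab : a = b
        · by_cases hbc : b = c
          · subst hab hbc
            have h1 := mul_le_mul_of_nonneg_left t.2.2.le ha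
            have h2 := prod_nonneg hw x z
            simp only [prod, if_true]
            exact (min_le_left _ _).trans (by linarith)
          · exact hz' _ _ _ (by simp [prod, hbc]) (prod_nonneg hw _ _)
        · exact hz _ _ _ (by simp [prod, hab]) (prod_nonneg hw _ _)
    | cons b y =>
      cases z with
      | nil => exact hz' _ _ _ le_rfl (prod_nonneg hw _ _)
      | part c u =>
        by_cases hab : a = b
        · by_cases hbc : b = c
          · subst hab hbc
            simp only [prod, if_true]
            exact min_le_right _ _
          · exact hz' _ _ _ (by simp [prod, hbc]) (prod_nonneg hw _ _)
        · exact hz _ _ _ (by simp [prod, hab]) (prod_nonneg hw _ _)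
      | cons c z =>
        by_cases hab : a = b
        · by_cases hbc : b = c
          · subst hab hbc
            simp only [prod, if_true]
            rw [min_add_add_left]
            exact add_le_add_right (ih y z) _
          · exact hz' _ _ _ (by simp [prod, hbc]) (prod_nonneg hw _ _)
        · exact hz _ _ _ (by simp [prod, hab]) (prod_nonneg hw _ _)

variable (w) in
/-- The length of the path in the tree between two words. -/
def treeDist (x y : FracWord D) : ℝ := len w x + len w y - 2 * prod w x y

lemma treeDist_nil (x : FracWord D) : treeDist w nil x = len w x := by
  cases x <;> simp [treeDist, len, prod]

lemma treeDist_comm (x y : FracWord D) : treeDist w x y = treeDist w y x := by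
  unfold treeDist
  rw [prod_comm]; ring

lemma treeDist_self (x : FracWord D) : treeDist w x x = 0 := by
  unfold treeDist
  rw [prod_self]; ring

lemma treeDist_triangle (hw : ∀ a, 0 < w a) (x y z : FracWord D) :
    treeDist w x z ≤ treeDist w x y + treeDist w y z := by
  unfold treeDist
  have h1 := min_prod_le hw x y z
  have h2 := prod_le_right hw x y
  have h3 := prod_le_left hw y z
  rcases min_choice (prod w x y) (prod w y z) with h | h <;> rw [h] at h1 <;> linarith

lemma treeDist_cons_cons (a : D) (x y : FracWord D) :
    treeDist w (cons a x) (cons a y) = treeDist w x y := by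
  simp [treeDist, len, prod]; ring

lemma treeDist_cons_of_ne {a b : D} (h : a ≠ b) (x y : FracWord D) :
    treeDist w (cons a x) (cons b y) = w a + len w x + (w b + len w y) := by
  simp [treeDist, len, prod, h]

lemma treeDist_part_part (a : D) (s t : Set.Ioo (0 : ℝ) 1) :
    treeDist w (part a s) (part a t) = w a * |(s : ℝ) - t| := by
  simp only [treeDist, len, prod, if_true]
  rcases le_total (s : ℝ) t with h | h
  · rw [min_eq_left h, abs_sub_comm, abs_of_nonneg (sub_nonneg.2 h)]; ring
  · rw [min_eq_right h, abs_of_nonneg (sub_nonneg.2 h)]; ring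

lemma treeDist_part_part_of_ne {a b : D} (h : a ≠ b) (s t : Set.Ioo (0 : ℝ) 1) :
    treeDist w (part a s) (part b t) = w a * s + w b * t := by
  simp [treeDist, len, prod, h]

lemma treeDist_part_cons (a : D) (s : Set.Ioo (0 : ℝ) 1) (y : FracWord D) :
    treeDist w (part a s) (cons a y) = w a * (1 - s) + len w y := by
  simp [treeDist, len, prod]; ring

lemma treeDist_part_cons_of_ne {a b : D} (h : a ≠ b) (s : Set.Ioo (0 : ℝ) 1) (y : FracWord D) :
    treeDist w (part a s) (cons b y) = w a * s + (w b + len w y) := by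
  simp [treeDist, len, prod, h]

/-- Fractions lie in the open interval, so a point of the tree is given by only one word: vanishing
and full fractional letters are not available as alternatives to `nil` and `cons`. -/
lemma eq_of_treeDist_eq_zero (hw : ∀ a, 0 < w a) {x y : FracWord D} (h : treeDist w x y = 0) :
    x = y := by
  induction x generalizing y with
  | nil =>
    rw [treeDist_nil] at h
    cases y with
    | nil => rfl
    | part b t => exact absurd h (mul_pos (hw b) t.2.1).ne'
    | cons b y => exact absurd h (add_pos_of_pos_of_nonneg (hw b) (len_nonneg hw y)).ne'
  | part a s =>
    have hs := mul_pos (hw a) s.2.1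
    cases y with
    | nil =>
      rw [treeDist_comm, treeDist_nil] at h
      exact absurd h hs.ne'
    | part b t =>
      have ht := mul_pos (hw b) t.2.1
      by_cases hab : a = b
      · subst hab
        rw [treeDist_part_part] at h
        have := (mul_eq_zero.1 h).resolve_left (hw a).ne'
        rw [Subtype.ext (sub_eq_zero.1 (abs_eq_zero.1 this))]
      · rw [treeDist_part_part_of_ne hab] at h
        linarith
    | cons b y =>
      have hb := add_pos_of_pos_of_nonneg (hw b) (len_nonneg hw y)
      by_cases hab : a = b
      · subst hab
        rw [treeDist_part_cons] at h
        have := mul_pos (hw a) (sub_pos.2 s.2.2)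
        linarith [len_nonneg hw y]
      · rw [treeDist_part_cons_of_ne hab] at h
        linarith
  | cons a x ih =>
    have ha := add_pos_of_pos_of_nonneg (hw a) (len_nonneg hw x)
    cases y with
    | nil =>
      rw [treeDist_comm, treeDist_nil] at h
      exact absurd h ha.ne'
    | part b t =>
      have ht := mul_pos (hw b) t.2.1
      rw [treeDist_comm] at h
      by_cases hab : b = a
      · subst hab
        rw [treeDist_part_cons] at h
        have := mul_pos (hw b) (sub_pos.2 t.2.2)
        linarith [len_nonneg hw x]
      · rw [treeDist_part_cons_of_ne hab] at h
        linarith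
    | cons b y =>
      by_cases hab : a = b
      · subst hab
        rw [treeDist_cons_cons] at h
        rw [ih h]
      · rw [treeDist_cons_of_ne hab] at h
        linarith [hw b, len_nonneg hw y]

end FracWord

/-- The four point condition that characterizes subsets of trees. -/
def FourPoint (T : Type*) [PseudoMetricSpace T] : Prop :=
  ∀ x y z w : T, dist x y + dist z w ≤ max (dist x z + dist y w) (dist x w + dist y z)

namespace FracWord

variable {D : Type} {w : D → ℝ}

/-- Lengths cancel, and the claim becomes a lower bound for `prod x y + prod z u`. Each of these two
products is bounded below by the ultrametric inequality through both points of the other pair; the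
four inequalities suffice. -/
lemma treeDist_fourPoint (hw : ∀ a, 0 < w a) (x y z u : FracWord D) :
    treeDist w x y + treeDist w z u ≤
      max (treeDist w x z + treeDist w y u) (treeDist w x u + treeDist w y z) := by
  have a1 := min_prod_le hw x z y
  have a2 := min_prod_le hw x u y
  have b1 := min_prod_le hw z x u
  have b2 := min_prod_le hw z y u
  rw [prod_comm z y] at a1 b2
  rw [prod_comm u y] at a2
  rw [prod_comm z x] at b1
  unfold treeDist
  rw [le_max_iff]
  by_contra hc
  push Not at hc
  obtain ⟨h1, h2⟩ := hc
  rcases min_le_iff.1 a1 with a1 | a1 <;> rcases min_le_iff.1 a2 with a2 | a2 <;>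
    rcases min_le_iff.1 b1 with b1 | b1 <;> rcases min_le_iff.1 b2 with b2 | b2 <;> linarith

end FracWord

/-! ### Directed edges and the universal cover of a marked graph -/

namespace FinGraph

variable {G : FinGraph}

variable (G) in
/-- Edges with a direction. -/
abbrev Dir : Type := G.E × Bool

/-- The initial vertex. -/
def org (a : G.Dir) : G.V := if a.2 then G.src a.1 else G.tgt a.1

/-- The reversed edge. -/
def bar (a : G.Dir) : G.Dir := (a.1, !a.2)

/-- The terminal vertex. -/
def ter (a : G.Dir) : G.V := org (bar a)

/-- The parameter on the underlying edge. -/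
def par (a : G.Dir) (t : I) : I := if a.2 then t else unitInterval.symm t

/-- The characteristic map of a directed edge. -/
def dedge (a : G.Dir) (t : I) : G.Realization := edge a.1 (par a t)

@[simp] lemma bar_bar (a : G.Dir) : bar (bar a) = a := by simp [bar]

lemma bar_ne (a : G.Dir) : bar a ≠ a := fun h => by simpa [bar] using congrArg Prod.snd h

@[simp] lemma bar_fst (a : G.Dir) : (bar a).1 = a.1 := rfl

lemma eq_or_eq_bar {a b : G.Dir} (h : a.1 = b.1) : a = b ∨ a = bar b := by
  obtain ⟨e, i⟩ := a
  obtain ⟨e', j⟩ := b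
  obtain rfl : e = e' := h
  cases i <;> cases j <;> simp [bar]

@[simp] lemma par_par (a : G.Dir) (t : I) : par a (par a t) = t := by
  unfold par; split_ifs <;> simp

lemma par_injective (a : G.Dir) : Function.Injective (par a) :=
  (show Function.Involutive (par a) from par_par a).injective

lemma abs_par_sub (a : G.Dir) (s t : I) : |(par a s : ℝ) - par a t| = |(s : ℝ) - t| := by
  unfold par; split_ifs
  · rfl
  · rw [unitInterval.coe_symm_eq, unitInterval.coe_symm_eq, ← abs_neg]
    congr 1; ring

lemma par_bar (a : G.Dir) (t : I) : par (bar a) t = unitInterval.symm (par a t) := by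
  obtain ⟨e, i⟩ := a
  cases i <;> simp [par, bar]

lemma par_interior {a : G.Dir} {t : I} (h0 : 0 < t) (h1 : t < 1) : 0 < par a t ∧ par a t < 1 := by
  unfold par; split_ifs
  · exact ⟨h0, h1⟩
  · have h0' : (0 : ℝ) < t := h0
    have h1' : (t : ℝ) < 1 := h1
    constructor <;> rw [← Subtype.coe_lt_coe, unitInterval.coe_symm_eq]
    · exact sub_pos.2 h1'
    · exact sub_lt_self _ h0'

lemma dedge_bar (a : G.Dir) (t : I) : dedge (bar a) t = dedge a (unitInterval.symm t) := by
  obtain ⟨e, i⟩ := a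
  cases i <;> simp [dedge, par, bar]

lemma dedge_zero (a : G.Dir) : dedge a 0 = vert (org a) := by
  obtain ⟨e, i⟩ := a
  cases i <;> simp [dedge, par, org, edge_zero, edge_one]

lemma dedge_one (a : G.Dir) : dedge a 1 = vert (ter a) := by
  rw [ter, ← dedge_zero, dedge_bar, unitInterval.symm_zero]

lemma dedge_ne_vert {a : G.Dir} {s : I} (h0 : 0 < s) (h1 : s < 1) (v : G.V) :
    dedge a s ≠ vert v :=
  edge_ne_vert (par_interior h0 h1).1 (par_interior h0 h1).2 v

lemma dedge_injective_of_interior {a b : G.Dir} {s t : I} (h0 : 0 < s) (h1 : s < 1)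
    (h : dedge a s = dedge b t) : (a = b ∧ s = t) ∨ (a = bar b ∧ s = unitInterval.symm t) := by
  obtain ⟨he, hp⟩ := edge_injective_of_interior (par_interior h0 h1).1 (par_interior h0 h1).2 h
  rcases eq_or_eq_bar he with rfl | rfl
  · exact Or.inl ⟨rfl, par_injective _ hp⟩
  · refine Or.inr ⟨rfl, par_injective (bar b) ?_⟩
    rw [hp, par_bar]
    obtain ⟨e, i⟩ := b
    cases i <;> simp [par]

lemma vert_injective {v w : G.V} (h : (vert v : G.Realization) = vert w) : v = w := by
  by_contra hne
  have h1 := hat_vert_self (G := G) 1 v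
  rw [h, hat_vert_of_ne 1 (Ne.symm hne)] at h1
  exact zero_ne_one h1

end FinGraph

namespace MarkedGraph

variable {Γ : MarkedGraph n}

lemma lipBound_dedge (a : Γ.graph.Dir) : LipBound (Γ.length a.1) (dedge a) := fun s t => by
  have := lipBound_edge (Γ := Γ) a.1 (par a s) (par a t)
  rwa [Subtype.dist_eq, Real.dist_eq, abs_par_sub, ← Real.dist_eq, ← Subtype.dist_eq] at this

lemma dist_dedge_le (a : Γ.graph.Dir) (s t : I) :
    dist (dedge a s) (dedge a t) ≤ Γ.length a.1 * |(s : ℝ) - t| := lipBound_dedge a s t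

variable (Γ) in
/-- The length of a directed edge. -/
def weight (a : Γ.graph.Dir) : ℝ := Γ.length a.1

lemma weight_pos (a : Γ.graph.Dir) : 0 < weight Γ a := Γ.length_pos a.1

end MarkedGraph

namespace FracWord

open MarkedGraph

variable {Γ : MarkedGraph n}

/-- The word is a reduced edge path from `v` that does not begin by reversing `prev`. -/
def Valid (v : Γ.graph.V) (prev : Option Γ.graph.Dir) : FracWord Γ.graph.Dir → Prop
  | nil => True
  | part a _ => org a = v ∧ prev ≠ some (bar a)
  | cons a x => org a = v ∧ prev ≠ some (bar a) ∧ Valid (ter a) (some a) x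

/-- Parameters of fractional letters are points of the unit interval. -/
def toUnit (s : Set.Ioo (0 : ℝ) 1) : I := ⟨s, s.2.1.le, s.2.2.le⟩

lemma toUnit_pos (s : Set.Ioo (0 : ℝ) 1) : 0 < toUnit s := s.2.1

lemma toUnit_lt_one (s : Set.Ioo (0 : ℝ) 1) : toUnit s < 1 := s.2.2

/-- The endpoint of an edge path from `v`. -/
def endpoint (v : Γ.graph.V) : FracWord Γ.graph.Dir → Γ.graph.Realization
  | nil => vert v
  | part a s => dedge a (toUnit s)
  | cons a x => endpoint (ter a) x

lemma dist_vert_endpoint_le {v : Γ.graph.V} {prev : Option Γ.graph.Dir}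
    {x : FracWord Γ.graph.Dir} (hx : Valid v prev x) :
    dist (vert v) (endpoint v x) ≤ len (weight Γ) x := by
  induction x generalizing v prev with
  | nil => simp [endpoint, len]
  | part a s =>
    obtain ⟨rfl, -⟩ := hx
    rw [← dedge_zero]
    refine (dist_dedge_le a 0 _).trans_eq ?_
    simp [len, weight, toUnit, abs_of_pos s.2.1]
  | cons a x ih =>
    obtain ⟨rfl, -, hx⟩ := hx
    refine (dist_triangle _ (vert (ter a)) _).trans (add_le_add ?_ (ih hx))
    rw [← dedge_zero, ← dedge_one]
    refine (dist_dedge_le a 0 _).trans_eq ?_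
    simp [weight]

/-- After the common initial segment, the two remaining edge paths joined back to back connect the
endpoints, and their total length is the tree distance. -/
lemma dist_endpoint_le {v : Γ.graph.V} {prev : Option Γ.graph.Dir} {x y : FracWord Γ.graph.Dir}
    (hx : Valid v prev x) (hy : Valid v prev y) :
    dist (endpoint v x) (endpoint v y) ≤ treeDist (weight Γ) x y := by
  have key : ∀ {v : Γ.graph.V} {prev : Option Γ.graph.Dir} {x y : FracWord Γ.graph.Dir},
      Valid v prev x → Valid v prev y →
      dist (endpoint v x) (endpoint v y) ≤ len (weight Γ) x + len (weight Γ) y := by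
    intro v prev x y hx hy
    refine (dist_triangle_left _ _ (vert v)).trans
      (add_le_add (dist_vert_endpoint_le hx) (dist_vert_endpoint_le hy))
  have part_cons : ∀ {v : Γ.graph.V} {prev : Option Γ.graph.Dir} {a : Γ.graph.Dir}
      {s : Set.Ioo (0 : ℝ) 1} {y : FracWord Γ.graph.Dir}, Valid v prev (cons a y) →
      dist (endpoint v (part a s)) (endpoint v (cons a y)) ≤
        treeDist (weight Γ) (part a s) (cons a y) := by
    intro v prev a s y hy
    rw [treeDist_part_cons]
    refine (dist_triangle _ (vert (ter a)) _).trans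
      (add_le_add ?_ (dist_vert_endpoint_le hy.2.2))
    rw [← dedge_one]
    refine (dist_dedge_le a _ _).trans_eq ?_
    rw [abs_sub_comm, abs_of_nonneg]
    · rfl
    · simpa [toUnit] using s.2.2.le
  induction x generalizing v prev y with
  | nil => rw [treeDist_nil]; exact dist_vert_endpoint_le hy
  | part a s =>
    cases y with
    | nil => rw [dist_comm, treeDist_comm, treeDist_nil]; exact dist_vert_endpoint_le hx
    | part b t =>
      by_cases hab : a = b
      · subst hab
        rw [treeDist_part_part]
        exact dist_dedge_le a _ _
      · rw [treeDist_part_part_of_ne hab]; exact key hx hy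
    | cons b y =>
      by_cases hab : a = b
      · subst hab; exact part_cons hy
      · rw [treeDist_part_cons_of_ne hab]; exact key hx hy
  | cons a x ih =>
    cases y with
    | nil => rw [dist_comm, treeDist_comm, treeDist_nil]; exact dist_vert_endpoint_le hx
    | part b t =>
      rw [dist_comm, treeDist_comm]
      by_cases hab : b = a
      · subst hab; exact part_cons hx
      · rw [treeDist_part_cons_of_ne hab]; exact key hy hx
    | cons b y =>
      by_cases hab : a = b
      · subst hab
        rw [treeDist_cons_cons]
        exact ih hx.2.2 hy.2.2
      · rw [treeDist_cons_of_ne hab]; exact key hx hy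

open Classical in
/-- The word of a segment of one edge. -/
def stub {D : Type} (a : D) (u : I) : FracWord D :=
  if h0 : u = 0 then nil else if h1 : u = 1 then cons a nil else
    part a ⟨u, unitInterval.pos_iff_ne_zero.2 h0, unitInterval.lt_one_iff_ne_one.2 h1⟩

lemma stub_zero {D : Type} (a : D) : stub a 0 = nil := dif_pos rfl

lemma stub_one {D : Type} (a : D) : stub a 1 = cons a nil := by simp [stub]

lemma stub_toUnit {D : Type} (a : D) (s : Set.Ioo (0 : ℝ) 1) : stub a (toUnit s) = part a s := by
  rw [stub, dif_neg (toUnit_pos s).ne', dif_neg (toUnit_lt_one s).ne]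
  rfl

lemma unit_cases (u : I) : u = 0 ∨ u = 1 ∨ ∃ s, u = toUnit s := by
  by_cases h0 : u = 0
  · exact Or.inl h0
  by_cases h1 : u = 1
  · exact Or.inr (Or.inl h1)
  exact Or.inr (Or.inr ⟨⟨u, unitInterval.pos_iff_ne_zero.2 h0,
    unitInterval.lt_one_iff_ne_one.2 h1⟩, rfl⟩)

lemma treeDist_stub {D : Type} {w : D → ℝ} (a : D) (u u' : I) :
    treeDist w (stub a u) (stub a u') = w a * |(u : ℝ) - u'| := by
  have h1 : ∀ s : Set.Ioo (0 : ℝ) 1, |(s : ℝ)| = s := fun s => abs_of_pos s.2.1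
  have h2 : ∀ s : Set.Ioo (0 : ℝ) 1, |1 - (s : ℝ)| = 1 - s := fun s =>
    abs_of_pos (sub_pos.2 s.2.2)
  rcases unit_cases u with rfl | rfl | ⟨s, rfl⟩ <;> rcases unit_cases u' with rfl | rfl | ⟨s', rfl⟩
  · simp [treeDist_self]
  · simp [stub_zero, stub_one, treeDist_nil, len]
  · rw [stub_zero, stub_toUnit, treeDist_nil]; simp [len, toUnit, h1]
  · rw [treeDist_comm]; simp [stub_zero, stub_one, treeDist_nil, len]
  · simp [treeDist_self]
  · rw [stub_one, stub_toUnit, treeDist_comm, treeDist_part_cons]; simp [len, toUnit, h2]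
  · rw [stub_zero, stub_toUnit, treeDist_comm, treeDist_nil]; simp [len, toUnit, h1]
  · rw [stub_one, stub_toUnit, treeDist_part_cons, abs_sub_comm]; simp [len, toUnit, h2]
  · rw [stub_toUnit, stub_toUnit, treeDist_part_part]; rfl

lemma valid_stub {v : Γ.graph.V} {prev : Option Γ.graph.Dir} {a : Γ.graph.Dir} (h : org a = v)
    (h' : prev ≠ some (bar a)) (u : I) : Valid v prev (stub a u) := by
  rcases unit_cases u with rfl | rfl | ⟨s, rfl⟩
  · rw [stub_zero]; trivial
  · rw [stub_one]; exact ⟨h, h', trivial⟩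
  · rw [stub_toUnit]; exact ⟨h, h'⟩

lemma endpoint_stub {v : Γ.graph.V} {a : Γ.graph.Dir} (h : org a = v) (u : I) :
    endpoint v (stub a u) = dedge a u := by
  rcases unit_cases u with rfl | rfl | ⟨s, rfl⟩
  · rw [stub_zero, dedge_zero, h]; rfl
  · rw [stub_one, dedge_one]; rfl
  · rw [stub_toUnit]; rfl

lemma exists_dedge_eq (e : Γ.graph.E) {s : I} {v : Γ.graph.V} (h : edge e s = vert v) :
    ∃ a : Γ.graph.Dir, a.1 = e ∧ org a = v ∧ par a 0 = s := by
  rcases edge_eq_vert_iff h with rfl | rfl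
  · exact ⟨(e, true), rfl, vert_injective ((edge_zero e).symm.trans h), by simp [par]⟩
  · exact ⟨(e, false), rfl, vert_injective ((edge_one e).symm.trans h), by simp [par]⟩

/-- Moving the endpoint inside an edge lifts to words, unless it forces backtracking over the
preceding letter. -/
lemma exists_step {v : Γ.graph.V} {prev : Option Γ.graph.Dir} {x : FracWord Γ.graph.Dir}
    (hx : Valid v prev x) {e : Γ.graph.E} {s : I} (h : endpoint v x = edge e s) (t : I) :
    (∃ y, Valid v prev y ∧ endpoint v y = edge e t ∧
      treeDist (weight Γ) x y ≤ Γ.length e * |(s : ℝ) - t|) ∨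
    (x = nil ∧ ∃ a : Γ.graph.Dir, a.1 = e ∧ org a = v ∧ par a 0 = s ∧ prev = some (bar a)) := by
  induction x generalizing v prev with
  | nil =>
    obtain ⟨a, rfl, ha, rfl⟩ := exists_dedge_eq e h.symm
    by_cases hp : prev = some (bar a)
    · exact Or.inr ⟨rfl, a, rfl, ha, rfl, hp⟩
    refine Or.inl ⟨stub a (par a t), valid_stub ha hp _, ?_, ?_⟩
    · rw [endpoint_stub ha, dedge, par_par]
    · rw [← stub_zero a, treeDist_stub, ← abs_par_sub a, par_par]
      rfl
  | part b r =>
    have hb : b.1 = e ∧ par b (toUnit r) = s :=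
      edge_injective_of_interior (par_interior (toUnit_pos r) (toUnit_lt_one r)).1
        (par_interior (toUnit_pos r) (toUnit_lt_one r)).2 h
    obtain ⟨rfl, rfl⟩ := hb
    refine Or.inl ⟨stub b (par b t), valid_stub hx.1 hx.2 _, ?_, ?_⟩
    · rw [endpoint_stub hx.1, dedge, par_par]
    · rw [← stub_toUnit, treeDist_stub, ← abs_par_sub b, par_par]
      rfl
  | cons b x ih =>
    refine Or.inl ?_
    rcases ih hx.2.2 h with ⟨y, hy, hy', hd⟩ | ⟨rfl, a, rfl, ha, rfl, hab⟩
    · exact ⟨cons b y, ⟨hx.1, hx.2.1, hy⟩, hy', by rwa [treeDist_cons_cons]⟩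
    -- The tail is empty and the step moves back over the last full letter, so this letter is
    -- shortened to a fraction of itself. This keeps the word reduced.
    · obtain rfl := Option.some_injective _ hab
      refine ⟨stub (bar a) (par (bar a) t), valid_stub hx.1 hx.2.1 _, ?_, ?_⟩
      · rw [endpoint_stub hx.1, dedge, par_par]; rfl
      · rw [← stub_one, treeDist_stub, ← abs_par_sub (bar a), par_par]
        rw [par_bar, show unitInterval.symm (par a 1) = par a 0 by simp [par]; split_ifs <;> simp]
        rfl

/-- At the root there is no preceding letter, so the exceptional case of `exists_step` cannot occur
and a path lifts segment by segment. -/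
lemma exists_lift_pathLength {v : Γ.graph.V} {x : FracWord Γ.graph.Dir} (hx : Valid v none x)
    {q : Γ.graph.Realization} {r : ℝ} (h : PathLength Γ.length (endpoint v x) q r) :
    ∃ y, Valid v none y ∧ endpoint v y = q ∧ treeDist (weight Γ) x y ≤ r := by
  induction h with
  | refl => exact ⟨x, hx, rfl, (treeDist_self x).le⟩
  | step e s t _ ih =>
    obtain ⟨y, hy, hy', hd⟩ := ih
    rcases exists_step hy hy' t with ⟨z, hz, hz', hd'⟩ | ⟨-, a, -, -, -, ha⟩
    · exact ⟨z, hz, hz', (treeDist_triangle weight_pos x y z).trans (add_le_add hd hd')⟩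
    · simp at ha

/-- Distinct words with the same endpoint are far apart. -/
lemma le_treeDist_of_endpoint_eq {m : ℝ} (hm : ∀ e, m ≤ Γ.length e) {v : Γ.graph.V}
    {prev : Option Γ.graph.Dir} {x y : FracWord Γ.graph.Dir} (hx : Valid v prev x)
    (hy : Valid v prev y) (h : endpoint v x = endpoint v y) (hne : x ≠ y) :
    m ≤ treeDist (weight Γ) x y := by
  have hw : ∀ a, m ≤ weight Γ a := fun a => hm a.1
  have hl : ∀ x, 0 ≤ len (weight Γ) x := len_nonneg weight_pos
  have hp : ∀ (a : Γ.graph.Dir) (s : Set.Ioo (0 : ℝ) 1), 0 ≤ weight Γ a * s := fun a s =>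
    mul_nonneg (weight_pos a).le s.2.1.le
  have part_cons : ∀ {v : Γ.graph.V} {prev : Option Γ.graph.Dir} {a b : Γ.graph.Dir}
      {s : Set.Ioo (0 : ℝ) 1} {y : FracWord Γ.graph.Dir}, Valid v prev (cons b y) →
      endpoint v (part a s) = endpoint v (cons b y) →
        m ≤ treeDist (weight Γ) (part a s) (cons b y) := by
    intro v prev a b s y hy h
    by_cases hab : a = b
    · subst hab
      rw [treeDist_part_cons]
      have h1 : 0 ≤ weight Γ a * (1 - s) := mul_nonneg (weight_pos a).le (sub_nonneg.2 s.2.2.le)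
      cases y with
      | nil => exact absurd h (dedge_ne_vert (toUnit_pos s) (toUnit_lt_one s) _)
      | part c t =>
        rcases dedge_injective_of_interior (toUnit_pos s) (toUnit_lt_one s) h with
          ⟨rfl, hst⟩ | ⟨rfl, -⟩
        · have : (s : ℝ) = t := congrArg (Subtype.val : I → ℝ) hst
          rw [len, ← this]
          linarith [hw a]
        -- Here the longer word would traverse an edge and then turn back into it, which reducedness
        -- forbids.
        · exact absurd rfl hy.2.2.2
      | cons c y =>
        have := hl y
        rw [len]
        linarith [hw c]
    · rw [treeDist_part_cons_of_ne hab]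
      linarith [hp a s, hw b, hl y]
  induction x generalizing v prev y with
  | nil =>
    rw [treeDist_nil]
    cases y with
    | nil => exact absurd rfl hne
    | part b t => exact absurd h.symm (dedge_ne_vert (toUnit_pos t) (toUnit_lt_one t) _)
    | cons b y => rw [len]; linarith [hw b, hl y]
  | part a s =>
    cases y with
    | nil => exact absurd h (dedge_ne_vert (toUnit_pos s) (toUnit_lt_one s) _)
    | part b t =>
      rcases dedge_injective_of_interior (toUnit_pos s) (toUnit_lt_one s) h with
          ⟨rfl, hst⟩ | ⟨rfl, hst⟩
      · exact absurd (congrArg (part a) (Subtype.ext (congrArg (Subtype.val : I → ℝ) hst))) hne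
      -- The two words enter the same edge from opposite ends and meet, so their last letters
      -- together have the length of a full edge.
      · have : (s : ℝ) = 1 - t := congrArg (Subtype.val : I → ℝ) hst
        rw [treeDist_part_part_of_ne (bar_ne b), this]
        have := hw b
        unfold weight at *
        simp only [bar_fst]
        linarith
    | cons b y => exact part_cons hy h
  | cons a x ih =>
    cases y with
    | nil =>
      rw [treeDist_comm, treeDist_nil, len]
      linarith [hw a, hl x]
    | part b t =>
      rw [treeDist_comm]
      exact part_cons hx h.symm
    | cons b y =>
      by_cases hab : a = b
      · subst hab
        rw [treeDist_cons_cons]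
        exact ih hx.2.2 hy.2.2 h fun h' => hne (by rw [h'])
      · rw [treeDist_cons_of_ne hab]
        linarith [hw a, hw b, hl x, hl y, weight_pos b]

end FracWord

/-- A tree that covers a metric space by a map that is isometric on a uniform scale. -/
structure TreeCover (X : Type) [MetricSpace X] where
  T : Type
  [metricT : MetricSpace T]
  p : T → X
  r : ℝ
  r_pos : 0 < r
  fourPoint : FourPoint T
  lipBound : LipBound 1 p
  surjective : Function.Surjective p
  isometric : ∀ x y, dist x y < r → dist (p x) (p y) = dist x y
  chart : ∀ x q, dist (p x) q < r → ∃ y, p y = q ∧ dist x y = dist (p x) q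
  separated : ∀ x y, p x = p y → x ≠ y → 3 * r ≤ dist x y

attribute [instance] TreeCover.metricT

namespace FracWord

open MarkedGraph

variable (Γ : MarkedGraph n) (v : Γ.graph.V)

/-- The reduced words that begin at `v`. -/
abbrev Tree : Type := {x : FracWord Γ.graph.Dir // Valid (Γ := Γ) v none x}

instance : MetricSpace (Tree Γ v) where
  dist x y := treeDist (weight Γ) x.1 y.1
  dist_self x := treeDist_self x.1
  dist_comm x y := treeDist_comm x.1 y.1
  dist_triangle x y z := treeDist_triangle weight_pos x.1 y.1 z.1
  eq_of_dist_eq_zero h := Subtype.ext (eq_of_treeDist_eq_zero weight_pos h)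

end FracWord

namespace MarkedGraph

open FracWord

/-- Every marked graph is covered by a tree. -/
def treeCover (Γ : MarkedGraph n) : TreeCover Γ.graph.Realization :=
  let v : Γ.graph.V := Γ.graph.src Γ.nonempty_edges.some
  let m := Γ.exists_length_lower_bound.choose
  have hm0 : 0 < m := Γ.exists_length_lower_bound.choose_spec.1
  have hm : ∀ e, m ≤ Γ.length e := Γ.exists_length_lower_bound.choose_spec.2
  have lip : LipBound 1 (fun x : Tree Γ v => endpoint v x.1) := fun x y => by
    rw [one_mul]; exact dist_endpoint_le x.2 y.2
  have sep : ∀ x y : Tree Γ v, endpoint v x.1 = endpoint v y.1 → x ≠ y → m ≤ dist x y :=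
    fun x y h hne => le_treeDist_of_endpoint_eq hm x.2 y.2 h fun h' => hne (Subtype.ext h')
  have lifts : ∀ (x : Tree Γ v) q R, dist (endpoint v x.1) q < R →
      ∃ y : Tree Γ v, endpoint v y.1 = q ∧ dist x y < R := by
    intro x q R h
    obtain ⟨R', hR', hp⟩ := exists_pathLength_lt h
    obtain ⟨y, hy, hq, hd⟩ := exists_lift_pathLength x.2 hp
    exact ⟨⟨y, hy⟩, hq, lt_of_le_of_lt hd hR'⟩
  have chart : ∀ (x : Tree Γ v) q, dist (endpoint v x.1) q < m / 3 →
      ∃ y : Tree Γ v, endpoint v y.1 = q ∧ dist x y = dist (endpoint v x.1) q := by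
    intro x q h
    obtain ⟨y, rfl, hy⟩ := lifts x q _ h
    refine ⟨y, rfl, le_antisymm (le_of_forall_gt fun R hR => ?_) (by simpa using lip x y)⟩
    -- Lifts exist with distance below any bound larger than the distance in the graph. Two lifts of
    -- the same point within `m / 3` of `x` are less than `m` apart, hence equal, so one lift serves
    -- for all bounds and realizes the distance.
    obtain ⟨z, hz, hd⟩ := lifts x _ (min R (m / 3)) (lt_min hR h)
    obtain rfl : y = z := by
      by_contra hne
      have h1 := sep y z hz.symm hne
      have h2 := dist_triangle_left y z x
      have h3 := hd.trans_le (min_le_right _ _)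
      linarith
    exact hd.trans_le (min_le_left _ _)
  { T := Tree Γ v
    p := fun x => endpoint v x.1
    r := m / 3
    r_pos := by linarith
    fourPoint := fun x y z u => treeDist_fourPoint weight_pos x.1 y.1 z.1 u.1
    lipBound := lip
    surjective := fun q => by
      obtain ⟨y, hy, -⟩ := lifts ⟨nil, trivial⟩ q _ (lt_add_one _)
      exact ⟨y, hy⟩
    isometric := fun x y h => by
      have h1 := lip x y
      rw [one_mul] at h1
      obtain ⟨z, hz, hd⟩ := chart x _ (h1.trans_lt h)
      obtain rfl : y = z := by
        by_contra hne
        have h1 := sep y z hz.symm hne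
        have h2 := dist_triangle_left y z x
        linarith
      exact hd.symm
    chart := chart
    separated := fun x y h hne => by linarith [sep x y h hne] }

end MarkedGraph

/-! ### Tree covers as covering spaces -/

namespace TreeCover

variable {X : Type} [MetricSpace X] (C : TreeCover X)

lemma continuous : Continuous C.p := C.lipBound.continuous

/-- A tree cover is a covering map. -/
lemma isCoveringMap : IsCoveringMap C.p := by
  have hr := C.r_pos
  have sep : ∀ x y, C.p x = C.p y → dist x y < 3 * C.r → x = y := fun x y h hd => by
    by_contra hne
    exact absurd hd (not_lt.2 (C.separated x y h hne))
  intro q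
  obtain ⟨x₀, hx₀⟩ := C.surjective q
  have : Nonempty (X → C.T) := ⟨fun _ => x₀⟩
  have : Nonempty (C.p ⁻¹' {q}) := ⟨⟨x₀, hx₀⟩⟩
  have : DiscreteTopology (C.p ⁻¹' {q}) := by
    refine DiscreteTopology.of_forall_le_dist (r := 3 * C.r) (by linarith) fun x y hne => ?_
    exact C.separated x y (x.2.trans y.2.symm) fun h => hne (Subtype.ext h)
  -- The sheets over the ball of radius `C.r / 2` around `q` are the balls of the same radius around
  -- the points of the fibre.
  refine .of_trivialization (t := (Metric.isOpen_ball (x := q)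
    (ε := C.r / 2)).trivializationDiscrete (f := C.p) (ι := C.p ⁻¹' {q})
    (fun i => Metric.ball i.1 (C.r / 2)) _ ?_ ?_ ?_ ?_ ?_) (Metric.mem_ball_self (by linarith))
  · intro i W hW
    refine ⟨fun h => (h.preimage C.continuous).inter Metric.isOpen_ball, fun h => ?_⟩
    rw [Metric.isOpen_iff]
    intro w hw
    have hi : C.p i.1 = q := i.2
    have h1 : dist (C.p i.1) w < C.r / 2 := by rw [hi, dist_comm]; exact hW hw
    obtain ⟨y, rfl, hy⟩ := C.chart i.1 w (by linarith)
    have hy' : y ∈ Metric.ball i.1 (C.r / 2) := by rw [Metric.mem_ball, dist_comm, hy]; exact h1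
    obtain ⟨ε, hε, hb⟩ := Metric.isOpen_iff.1 h y ⟨hw, hy'⟩
    refine ⟨min ε C.r, lt_min hε hr, fun w' hw' => ?_⟩
    rw [Metric.mem_ball, dist_comm] at hw'
    obtain ⟨y', rfl, hd⟩ := C.chart y w' (hw'.trans_le (min_le_right _ _))
    refine (hb ?_).1
    rw [Metric.mem_ball, dist_comm, hd]
    exact hw'.trans_le (min_le_left _ _)
  · intro i x hx y hy h
    refine sep x y h ?_
    have := dist_triangle_right x y i.1
    rw [Metric.mem_ball] at hx hy
    linarith
  · intro i w hw
    have hi : C.p i.1 = q := i.2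
    have h1 : dist (C.p i.1) w < C.r / 2 := by rw [hi, dist_comm]; exact hw
    obtain ⟨y, rfl, hy⟩ := C.chart i.1 w (by linarith)
    exact ⟨y, by rw [Metric.mem_ball, dist_comm, hy]; exact h1, rfl⟩
  · intro i j hij
    refine Set.disjoint_left.2 fun z hz hz' => hij (Subtype.ext (sep i.1 j.1 ?_ ?_))
    · exact i.2.trans j.2.symm
    · rw [Metric.mem_ball] at hz hz'
      have := dist_triangle_left i.1 j.1 z
      linarith
  · intro z hz
    rw [Set.mem_preimage, Metric.mem_ball] at hz
    obtain ⟨y, hy, hd⟩ := C.chart z q (by linarith)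
    refine Set.mem_iUnion.2 ⟨⟨y, hy⟩, ?_⟩
    rw [Metric.mem_ball, hd]
    exact hz

end TreeCover

/-! ### Geodesics in trees and in spaces covered by trees -/

open Filter Topology

/-- The Gromov product. -/
def gprod {T : Type*} [PseudoMetricSpace T] (x a b : T) : ℝ :=
  (dist x a + dist x b - dist a b) / 2

section Gromov

variable {T : Type*} [PseudoMetricSpace T]

lemma gprod_comm (x a b : T) : gprod x a b = gprod x b a := by
  unfold gprod; rw [dist_comm a b]; ring

lemma gprod_self (x a : T) : gprod x a a = dist x a := by simp [gprod]

lemma gprod_le (x a b : T) : gprod x a b ≤ dist x a := by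
  unfold gprod
  linarith [dist_triangle x a b]

lemma sub_le_gprod (x a b : T) : dist x a - dist a b ≤ gprod x a b := by
  unfold gprod
  linarith [dist_triangle_right x a b]

/-- The four point condition for the base point and three others, rewritten as the ultrametric
inequality for Gromov products. -/
lemma FourPoint.min_gprod_le (h : FourPoint T) (x a b c : T) :
    min (gprod x a b) (gprod x b c) ≤ gprod x a c := by
  have h1 := h a c b x
  rw [dist_comm b x, dist_comm c x, dist_comm a x, dist_comm c b] at h1
  unfold gprod
  rw [min_le_iff]
  rcases le_max_iff.1 h1 with h1 | h1
  · left; linarith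
  · right; linarith

lemma continuous_gprod_left (x b : T) : Continuous fun a => gprod x a b := by
  unfold gprod; fun_prop

/-- In a tree a path covers the geodesic to its endpoint, as far as this is forced by the
starting point. -/
lemma FourPoint.exists_mem_path (h : FourPoint T) {ζ : ℝ → T} {a b u : ℝ} (hab : a ≤ b)
    (hζ : Continuous ζ) (x : T) (ha : gprod x (ζ a) (ζ b) < u) (hb : u < dist x (ζ b)) :
    ∃ t ∈ Set.Icc a b, dist x (ζ t) = u ∧ gprod x (ζ t) (ζ b) = u := by
  have hf : Continuous fun t => gprod x (ζ t) (ζ b) := (continuous_gprod_left x (ζ b)).comp hζ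
  let S := {t | t ∈ Set.Icc a b ∧ gprod x (ζ t) (ζ b) ≤ u}
  have hS : IsCompact S := by
    refine isCompact_Icc.of_isClosed_subset ?_ fun t ht => ht.1
    exact isClosed_Icc.inter (isClosed_le hf continuous_const)
  -- The last time at which the path has not passed beyond level `u` towards its endpoint.
  obtain ⟨t, ⟨ht, htu⟩, hmax⟩ := hS.exists_isGreatest ⟨a, ⟨le_rfl, hab⟩, ha.le⟩
  have htb : t < b := by
    refine lt_of_le_of_ne ht.2 fun h' => ?_
    rw [h', gprod_self] at htu
    linarith
  have hgt : ∀ t', t < t' → t' ≤ b → u < gprod x (ζ t') (ζ b) := fun t' h1 h2 => by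
    by_contra hc
    exact absurd (hmax ⟨⟨ht.1.trans h1.le, h2⟩, not_lt.1 hc⟩) (not_le.2 h1)
  have hIoc : Set.Ioc t b ∈ 𝓝[>] t := Ioc_mem_nhdsGT htb
  have hge : u ≤ gprod x (ζ t) (ζ b) := by
    refine ge_of_tendsto ((hf.tendsto t).mono_left (nhdsWithin_le_nhds (s := Set.Ioi t))) ?_
    exact Filter.eventually_of_mem hIoc fun t' h' => (hgt t' h'.1 h'.2).le
  have hu := le_antisymm htu hge
  refine ⟨t, ht, le_antisymm ?_ (hge.trans (gprod_le _ _ _)), hu⟩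
  by_contra hc
  push Not at hc
  have hd : Tendsto (fun t' => dist (ζ t) (ζ t')) (𝓝[>] t) (𝓝 0) := by
    have : Continuous fun t' => dist (ζ t) (ζ t') := by fun_prop
    simpa using (this.tendsto t).mono_left nhdsWithin_le_nhds
  -- If the path were off the geodesic at time `t`, then a slightly later point would still branch
  -- off together with it. Both products with this later point would exceed `u`, contradicting the
  -- value `u` at time `t`.
  obtain ⟨t', h1, h2⟩ := ((hd.eventually_lt_const (sub_pos.2 hc)).and hIoc).exists
  have h3 := h.min_gprod_le x (ζ t) (ζ t') (ζ b)
  have h4 := sub_le_gprod x (ζ t) (ζ t')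
  have h5 := hgt t' h2.1 h2.2
  rcases min_le_iff.1 h3 with h3 | h3 <;> linarith

/-- Points of a tree on the geodesic from `x` to `y` are determined by their distance to `x`. -/
lemma FourPoint.dist_eq_zero (h : FourPoint T) {x y a b : T} {u : ℝ} (ha : dist x a = u)
    (hb : dist x b = u) (ha' : u ≤ gprod x a y) (hb' : u ≤ gprod x b y) : dist a b = 0 := by
  have h1 := h.min_gprod_le x a y b
  rw [gprod_comm x y b] at h1
  have h2 : u ≤ gprod x a b := (le_min ha' hb').trans h1
  unfold gprod at h2
  exact le_antisymm (by linarith) dist_nonneg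

end Gromov

/-- A map that locally multiplies distances by `s`. -/
def LocGeod {X Y : Type*} [PseudoMetricSpace X] [PseudoMetricSpace Y] (c : X → Y) (s : ℝ) : Prop :=
  ∀ x, ∃ U ∈ 𝓝 x, ∀ a ∈ U, ∀ b ∈ U, dist (c a) (c b) = s * dist a b

lemma LocGeod.continuous {X Y : Type*} [PseudoMetricSpace X] [PseudoMetricSpace Y] {c : X → Y}
    {s : ℝ} (h : LocGeod c s) : Continuous c := by
  rw [continuous_iff_continuousAt]
  intro x
  obtain ⟨U, hU, hd⟩ := h x
  rw [ContinuousAt, tendsto_iff_dist_tendsto_zero]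
  have : Tendsto (fun y => s * dist y x) (𝓝 x) (𝓝 0) := by
    have : Continuous fun y => s * dist y x := by fun_prop
    simpa using this.tendsto x
  exact this.congr' (eventually_of_mem hU fun y hy => (hd y hy x (mem_of_mem_nhds hU)).symm)

lemma LocGeod.exists_ball {X Y : Type*} [PseudoMetricSpace X] [PseudoMetricSpace Y] {c : X → Y}
    {s : ℝ} (h : LocGeod c s) (x : X) : ∃ ε > 0, ∀ a b, dist a x < ε → dist b x < ε →
      dist (c a) (c b) = s * dist a b := by
  obtain ⟨U, hU, hd⟩ := h x
  obtain ⟨ε, hε, hb⟩ := Metric.mem_nhds_iff.1 hU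
  exact ⟨ε, hε, fun a b ha hb' => hd a (hb ha) b (hb hb')⟩

lemma LocGeod.lipBound {Y : Type*} [PseudoMetricSpace Y] {c : ℝ → Y} {s : ℝ} (h : LocGeod c s) :
    LipBound s c := by
  refine LipBound.of_le fun x y hxy => dist_le_of_locally hxy h.continuous.continuousOn ?_
  intro t _
  obtain ⟨ε, hε, hd⟩ := h.exists_ball t
  refine ⟨ε, hε, fun u _ h1 h2 => (hd t u (by simpa using hε) ?_).le.trans_eq ?_⟩
  · rw [Real.dist_eq, abs_of_pos (sub_pos.2 h1)]; linarith
  · rw [dist_comm, Real.dist_eq, abs_of_pos (sub_pos.2 h1)]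

/-- Local geodesics in trees are geodesics. -/
lemma FourPoint.dist_eq_of_locGeod {T : Type*} [PseudoMetricSpace T] (h : FourPoint T) {c : ℝ → T}
    {s : ℝ} (hc : LocGeod c s) (hs : 0 ≤ s) {a b : ℝ} (hab : a ≤ b) :
    dist (c a) (c b) = s * (b - a) := by
  have hl := hc.lipBound
  rcases hs.eq_or_lt with rfl | hs
  · have := hl a b
    rw [zero_mul] at this ⊢
    exact le_antisymm this dist_nonneg
  have hl' : ∀ x y, x ≤ y → dist (c x) (c y) ≤ s * (y - x) := fun x y hxy => by
    have := hl x y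
    rwa [dist_comm x y, Real.dist_eq, abs_of_nonneg (sub_nonneg.2 hxy)] at this
  have hcl : IsClosed {t | dist (c a) (c t) = s * (t - a)} := by
    have := hc.continuous
    exact isClosed_eq (by fun_prop) (by fun_prop)
  refine (hcl.inter isClosed_Icc).Icc_subset_of_forall_exists_gt (a := a) (b := b) (by simp)
    ?_ ⟨hab, le_rfl⟩
  rintro t ⟨ht, hta, -⟩ y hy
  obtain ⟨ε, hε, hd⟩ := hc.exists_ball t
  have hty : t < y := hy
  have hd' : ∀ x y, t - ε < x → x ≤ y → y < t + ε → dist (c x) (c y) = s * (y - x) := by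
    intro x y h1 h2 h3
    rw [hd x y (by rw [Real.dist_eq, abs_lt]; constructor <;> linarith)
      (by rw [Real.dist_eq, abs_lt]; constructor <;> linarith), dist_comm, Real.dist_eq,
      abs_of_nonneg (by linarith)]
  set u := min y (t + ε / 2) with hu
  have htu : t < u := lt_min hty (by linarith)
  have huε : u < t + ε := (min_le_right _ _).trans_lt (by linarith)
  refine ⟨u, ?_, htu, min_le_left _ _⟩
  refine le_antisymm (hl' a u (by linarith)) ?_
  rcases hta.eq_or_lt with rfl | hta
  · exact (hd' a u (by linarith) htu.le huε).ge
  · set x := max a (t - ε / 2) with hx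
    have hax : a ≤ x := le_max_left _ _
    have hxt : x < t := max_lt hta (by linarith)
    have hxε : t - ε < x := (show t - ε < t - ε / 2 by linarith).trans_le (le_max_right _ _)
    have h1 := hd' x u hxε (by linarith) huε
    have h2 := hl' a x hax
    have h3 := hl' t u htu.le
    have h4 := hl' x t hxt.le
    have h5 : dist (c a) (c t) = s * (t - a) := ht
    have h6 := mul_pos hs (sub_pos.2 hxt)
    -- The four point condition for `a < x < t < u`, with `x` and `u` close to `t`. The first
    -- alternative fails by `2 * s * (t - x)`, and the second gives the missing lower bound between
    -- `a` and `u`.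
    rcases le_max_iff.1 (h (c a) (c t) (c x) (c u)) with h7 | h7
    · linarith
    · rw [dist_comm (c t) (c x)] at h7
      change s * (u - a) ≤ dist (c a) (c u)
      linarith

/-- The quotient map from the line to the circle of circumference one is isometric on balls of
radius `1 / 4`. -/
lemma LocGeod.of_circle {Y : Type*} [PseudoMetricSpace Y] {β : UnitAddCircle → Y} {s : ℝ}
    (h : LocGeod β s) : LocGeod (fun t : ℝ => β t) s := by
  intro t
  obtain ⟨ε, hε, hd⟩ := h.exists_ball (t : UnitAddCircle)
  have hle : ∀ a b : ℝ, dist (a : UnitAddCircle) b ≤ dist a b := fun a b => by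
    rw [dist_eq_norm, ← AddCircle.coe_sub, UnitAddCircle.norm_eq, Real.dist_eq]
    simpa using round_le (a - b) 0
  refine ⟨Metric.ball t (min ε (1 / 4)), Metric.ball_mem_nhds _ (by positivity), fun a ha b hb => ?_⟩
  rw [Metric.mem_ball, lt_min_iff] at ha hb
  rw [hd a b ((hle _ _).trans_lt ha.1) ((hle _ _).trans_lt hb.1)]
  congr 1
  rw [dist_eq_norm, ← AddCircle.coe_sub, (AddCircle.norm_coe_eq_abs_iff 1 one_ne_zero).2,
    Real.dist_eq]
  have := dist_triangle_right a b t
  rw [abs_one, ← Real.dist_eq]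
  linarith

namespace TreeCover

variable {X : Type} [MetricSpace X] (C : TreeCover X)

/-- If the lift went farther, it would pass a point at distance strictly between `C.r / 2` and
`C.r`. There the covering is isometric, so the projection would be too far from its start. -/
lemma dist_le_of_short {f : ℝ → C.T} (hf : Continuous f) {a b : ℝ} (hab : a ≤ b)
    (h : ∀ t ∈ Set.Icc a b, dist (C.p (f a)) (C.p (f t)) ≤ C.r / 2) :
    dist (f a) (f b) ≤ C.r / 2 := by
  have hr := C.r_pos
  by_contra hc
  push Not at hc
  set u := min (dist (f a) (f b)) (3 * C.r / 4) with hu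
  have hu1 : C.r / 2 < u := lt_min hc (by linarith)
  have hu2 : u < C.r := (min_le_right _ _).trans_lt (by linarith)
  obtain ⟨t, ht, htu⟩ := intermediate_value_Icc (f := fun t => dist (f a) (f t)) hab
    (by fun_prop) ⟨by simp only [dist_self]; linarith, min_le_left _ _⟩
  have h1 := h t ht
  change dist (f a) (f t) = u at htu
  rw [C.isometric _ _ (by rw [htu]; exact hu2), htu] at h1
  linarith

/-- Lifts of a line to the tree. -/
lemma exists_lift_line (f : C(ℝ, X)) (t : ℝ) (x : C.T) (hx : C.p x = f t) :
    ∃ g : C(ℝ, C.T), g t = x ∧ ∀ u, C.p (g u) = f u := by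
  obtain ⟨g, ⟨h1, h2⟩, -⟩ := C.isCoveringMap.existsUnique_continuousMap_lifts f t x hx
  exact ⟨g, h1, fun u => congrFun h2 u⟩

lemma locGeod_lift {g : ℝ → C.T} (hg : Continuous g) {s : ℝ} (h : LocGeod (C.p ∘ g) s) :
    LocGeod g s := by
  intro t
  obtain ⟨U, hU, hd⟩ := h t
  have hr := C.r_pos
  refine ⟨U ∩ g ⁻¹' Metric.ball (g t) (C.r / 2), inter_mem hU
    (hg.continuousAt.preimage_mem_nhds (Metric.ball_mem_nhds _ (by linarith))), ?_⟩
  rintro a ⟨ha, ha'⟩ b ⟨hb, hb'⟩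
  rw [← hd a ha b hb, Function.comp_apply, Function.comp_apply, C.isometric]
  rw [Set.mem_preimage, Metric.mem_ball] at ha' hb'
  linarith [dist_triangle_right (g a) (g b) (g t)]

/-- Homotopic loops have lifts at bounded distance. -/
lemma exists_lifts {α β : C(UnitAddCircle, X)} (h : α.Homotopic β) :
    ∃ (f g : ℝ → C.T) (K : ℝ), Continuous f ∧ Continuous g ∧ (∀ t, C.p (f t) = α t) ∧
      (∀ t, C.p (g t) = β t) ∧ ∀ t, dist (f t) (g t) ≤ K := by
  obtain ⟨H⟩ := h
  have hr := C.r_pos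
  let q : C(ℝ, UnitAddCircle) := ⟨fun t => t, AddCircle.continuous_mk' 1⟩
  obtain ⟨x, hx⟩ := C.surjective (α (q 0))
  obtain ⟨f, -, hf⟩ := C.exists_lift_line (α.comp q) 0 x hx
  let H' : C(I × ℝ, X) := H.toContinuousMap.comp ((ContinuousMap.id I).prodMap q)
  have H0 : ∀ a, H' (0, a) = C.p (f a) := fun a => (H.apply_zero _).trans (hf a).symm
  let F := C.isCoveringMap.liftHomotopy H' f H0
  have hF : ∀ z, C.p (F z) = H' z := fun z =>
    congrFun (C.isCoveringMap.liftHomotopy_lifts H' f H0) z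
  have hF0 : ∀ t, F (0, t) = f t := C.isCoveringMap.liftHomotopy_zero H' f H0
  have huc : UniformContinuous H.toContinuousMap :=
    CompactSpace.uniformContinuous_of_continuous H.toContinuousMap.continuous
  -- Time is cut into `N` steps during which every point of the circle moves by less than `C.r / 2`.
  -- The lifted homotopy then moves each point of the line by at most `N * (C.r / 2)`, uniformly in
  -- the point.
  obtain ⟨δ, hδ, hd⟩ := Metric.uniformContinuous_iff.1 huc (C.r / 2) (by linarith)
  obtain ⟨N, hN⟩ := exists_nat_gt (1 / δ)
  have hNpos : (0 : ℝ) < N := (one_div_pos.2 hδ).trans hN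
  let P : ℝ → I := Set.projIcc 0 1 zero_le_one
  have hP : Continuous P := continuous_projIcc
  have step : ∀ t : ℝ, ∀ k : ℕ, dist (F (P 0, t)) (F (P (k / N), t)) ≤ k * (C.r / 2) := by
    intro t k
    induction k with
    | zero => simp
    | succ k ih =>
      have h1 := C.dist_le_of_short (f := fun s => F (P s, t)) (by fun_prop) (a := k / N)
        (b := (k + 1 : ℕ) / N) (by gcongr; simp) fun s hs => by
          rw [hF, hF]
          refine (hd ?_).le
          change dist (P _, q t) (P _, q t) < δ
          rw [Prod.dist_eq, dist_self, max_eq_left dist_nonneg]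
          refine (dist_projIcc_le _ _).trans_lt ?_
          have h2 : ((k + 1 : ℕ) : ℝ) / N = k / N + 1 / N := by push_cast; ring
          rw [h2] at hs
          rw [dist_comm, Real.dist_eq, abs_of_nonneg (by linarith [hs.1])]
          have h3 : 1 / (N : ℝ) < δ := (one_div_lt hδ hNpos).1 hN
          linarith [hs.2]
      refine (dist_triangle _ _ _).trans ((add_le_add ih h1).trans_eq ?_)
      push_cast; ring
  refine ⟨f, fun t => F (1, t), N * (C.r / 2), f.continuous, by fun_prop, hf, fun t => ?_,
    fun t => ?_⟩
  · rw [hF]; exact H.apply_one _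
  · have h1 := step t N
    have h2 : P 0 = 0 := Set.projIcc_left _
    have h3 : P (N / N) = 1 := by rw [div_self hNpos.ne']; exact Set.projIcc_right _
    rwa [h2, h3, hF0] at h1

/-- Lifts of the two loops are geodesics in the tree at bounded distance from each other, so the
lengths `s * N` and `s' * N` differ by a bounded amount. -/
lemma speed_le (C : TreeCover X) {α β : C(UnitAddCircle, X)} (h : α.Homotopic β) {s s' : ℝ} (hα : LocGeod α s)
    (hβ : LocGeod β s') (hs : 0 ≤ s) (hs' : 0 ≤ s') : s ≤ s' := by
  obtain ⟨f, g, K, hf, hg, hf', hg', hK⟩ := C.exists_lifts h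
  have h1 : LocGeod f s := C.locGeod_lift hf (by
    rw [show C.p ∘ f = fun t : ℝ => α t from funext hf']; exact hα.of_circle)
  have h2 : LocGeod g s' := C.locGeod_lift hg (by
    rw [show C.p ∘ g = fun t : ℝ => β t from funext hg']; exact hβ.of_circle)
  by_contra hc
  push Not at hc
  obtain ⟨N, hN⟩ := exists_nat_gt (2 * K / (s - s'))
  have e1 := C.fourPoint.dist_eq_of_locGeod h1 hs (Nat.cast_nonneg (α := ℝ) N)
  have e2 := C.fourPoint.dist_eq_of_locGeod h2 hs' (Nat.cast_nonneg (α := ℝ) N)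
  have e3 := dist_triangle4 (f 0) (g 0) (g N) (f N)
  rw [dist_comm (g N)] at e3
  rw [div_lt_iff₀ (sub_pos.2 hc)] at hN
  linarith [hK 0, hK N]

/-- A loop that is homotopic to an immersed loop covers it. -/
lemma mem_range_of_homotopic (C : TreeCover X) {α β : C(UnitAddCircle, X)} (h : α.Homotopic β) {s : ℝ} (hs : 0 < s)
    (hβ : LocGeod β s) (z : UnitAddCircle) : β z ∈ Set.range α := by
  obtain ⟨f, g, K, hf, hg, hf', hg', hK⟩ := C.exists_lifts h
  have h2 : LocGeod g s := C.locGeod_lift hg (by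
    rw [show C.p ∘ g = fun t : ℝ => β t from funext hg']; exact hβ.of_circle)
  obtain ⟨t, rfl⟩ := QuotientAddGroup.mk_surjective z
  obtain ⟨N, hN⟩ := exists_nat_gt (2 * K / s)
  rw [div_lt_iff₀ hs] at hN
  have hK0 : 0 ≤ K := dist_nonneg.trans (hK 0)
  have hN0 : (0 : ℝ) ≤ N := Nat.cast_nonneg N
  have hd := fun {a b : ℝ} (hab : a ≤ b) => C.fourPoint.dist_eq_of_locGeod h2 hs.le hab
  have d1 := hd (show t - N ≤ t by linarith)
  have d2 := hd (show t ≤ t + N by linarith)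
  have d3 := hd (show t - N ≤ t + N by linarith)
  have k1 := hK (t - N)
  have k2 := hK (t + N)
  rw [dist_comm] at k1
  have b1 : dist (g (t - N)) (g (t + N)) ≤ dist (g (t - N)) (f (t + N)) + K :=
    (dist_triangle _ (f (t + N)) _).trans (by linarith)
  -- On a long time interval the path `f` starts and ends within `K` of the ends of the geodesic
  -- `g`, far from its midpoint `g t`. In a tree it must therefore pass through `g t`.
  obtain ⟨u, -, hu, hu'⟩ := C.fourPoint.exists_mem_path (ζ := f) (a := t - N) (b := t + N)
    (u := s * N) (by linarith) hf (g (t - N))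
    ((gprod_le _ _ _).trans_lt (by linarith)) (by linarith)
  have d4 : dist (g (t - N)) (g t) = s * N := by rw [d1]; ring
  have hy : s * N ≤ gprod (g (t - N)) (g t) (f (t + N)) := by
    have h3 := C.fourPoint.min_gprod_le (g (t - N)) (g t) (g (t + N)) (f (t + N))
    have h4 : gprod (g (t - N)) (g t) (g (t + N)) = s * N := by
      unfold gprod; rw [d1, d2, d3]; ring
    have h5 := sub_le_gprod (g (t - N)) (g (t + N)) (f (t + N))
    rw [dist_comm (g (t + N)), d3] at h5
    rw [h4] at h3
    rcases min_le_iff.1 h3 with h3 | h3 <;> linarith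
  have := C.fourPoint.dist_eq_zero hu d4 hu'.ge hy
  rw [dist_eq_zero] at this
  exact ⟨u, by rw [← hf', this, hg']⟩

/-- Two geodesic germs agree or form a geodesic. -/
lemma germ_dichotomy (C : TreeCover X) {c c' : ℝ → X} (h0 : c 0 = c' 0) {s ε : ℝ} (hs : 0 < s) (hε : 0 < ε)
    (hc : ∀ a ∈ Set.Icc 0 ε, ∀ b ∈ Set.Icc 0 ε, dist (c a) (c b) = s * |a - b|)
    (hc' : ∀ a ∈ Set.Icc 0 ε, ∀ b ∈ Set.Icc 0 ε, dist (c' a) (c' b) = s * |a - b|) :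
    (∃ δ > 0, ∀ t ∈ Set.Icc 0 δ, c t = c' t) ∨
      ∃ δ > 0, ∀ a ∈ Set.Icc 0 δ, ∀ b ∈ Set.Icc 0 δ, dist (c a) (c' b) = s * (a + b) := by
  have hr := C.r_pos
  obtain ⟨x, hx⟩ := C.surjective (c 0)
  obtain ⟨δ, hδ, hδε, hδr⟩ : ∃ δ > 0, δ ≤ ε ∧ s * (δ + δ) < C.r := by
    refine ⟨min ε (C.r / (4 * s)), by positivity, min_le_left _ _, ?_⟩
    have := min_le_right ε (C.r / (4 * s))
    have h1 := mul_le_mul_of_nonneg_left this hs.le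
    have h2 : s * (C.r / (4 * s)) = C.r / 4 := by field_simp
    linarith
  -- The germs are lifted point by point. Only distances to the common start are used below, so
  -- continuity of the lift is not needed.
  have lift : ∀ γ : ℝ → X, c 0 = γ 0 →
      (∀ a ∈ Set.Icc 0 ε, ∀ b ∈ Set.Icc 0 ε, dist (γ a) (γ b) = s * |a - b|) →
      ∃ γ' : ℝ → C.T, ∀ t ∈ Set.Icc 0 δ, C.p (γ' t) = γ t ∧ dist x (γ' t) = s * t := by
    intro γ hγ0 hγ
    have : ∀ t ∈ Set.Icc 0 δ, ∃ y, C.p y = γ t ∧ dist x y = s * t := by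
      intro t ht
      have h1 : dist (C.p x) (γ t) = s * t := by
        rw [hx, hγ0, hγ 0 ⟨le_rfl, hε.le⟩ t ⟨ht.1, ht.2.trans hδε⟩, zero_sub, abs_neg,
          abs_of_nonneg ht.1]
      obtain ⟨y, hy, hy'⟩ := C.chart x (γ t) (by
        rw [h1]; linarith [mul_le_mul_of_nonneg_left ht.2 hs.le, mul_pos hs hδ])
      exact ⟨y, hy, hy'.trans h1⟩
    have hne : Nonempty C.T := ⟨x⟩
    choose! γ' hγ' using this
    exact ⟨γ', hγ'⟩
  have iso : ∀ {y z : C.T} {a b : ℝ}, a ∈ Set.Icc 0 δ → b ∈ Set.Icc 0 δ → dist x y = s * a →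
      dist x z = s * b → dist (C.p y) (C.p z) = dist y z := by
    intro y z a b ha hb hy hz
    refine C.isometric y z ?_
    have h1 := dist_triangle_left y z x
    have h2 := mul_le_mul_of_nonneg_left ha.2 hs.le
    have h3 := mul_le_mul_of_nonneg_left hb.2 hs.le
    linarith
  obtain ⟨g, hg⟩ := lift c rfl hc
  obtain ⟨g', hg'⟩ := lift c' h0 hc'
  have hgg : ∀ {γ : ℝ → X} {γ' : ℝ → C.T},
      (∀ a ∈ Set.Icc 0 ε, ∀ b ∈ Set.Icc 0 ε, dist (γ a) (γ b) = s * |a - b|) →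
      (∀ t ∈ Set.Icc 0 δ, C.p (γ' t) = γ t ∧ dist x (γ' t) = s * t) →
      ∀ a ∈ Set.Icc 0 δ, ∀ b ∈ Set.Icc 0 δ, a ≤ b → s * a ≤ gprod x (γ' a) (γ' b) := by
    intro γ γ' hγ hγ' a ha b hb hab
    have h1 := iso ha hb (hγ' a ha).2 (hγ' b hb).2
    rw [(hγ' a ha).1, (hγ' b hb).1, hγ a ⟨ha.1, ha.2.trans hδε⟩ b ⟨hb.1, hb.2.trans hδε⟩,
      abs_sub_comm, abs_of_nonneg (sub_nonneg.2 hab)] at h1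
    unfold gprod
    rw [← h1, (hγ' a ha).2, (hγ' b hb).2]
    linarith
  -- A positive Gromov product at the start means that the lifts share an initial segment. Otherwise
  -- distances to the start add up, and this sum is the distance downstairs because all lifts lie
  -- within the isometric scale.
  by_cases hz : ∃ a ∈ Set.Icc 0 δ, ∃ b ∈ Set.Icc 0 δ, 0 < gprod x (g a) (g' b)
  · obtain ⟨a, ha, b, hb, hpos⟩ := hz
    set u := gprod x (g a) (g' b) with hu
    have hua : u ≤ s * a := (gprod_le _ _ _).trans_eq (hg a ha).2
    have hub : u ≤ s * b := by
      rw [hu, gprod_comm]; exact (gprod_le _ _ _).trans_eq (hg' b hb).2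
    refine Or.inl ⟨u / s, div_pos hpos hs, fun t ht => ?_⟩
    have htu : s * t ≤ u := by rw [mul_comm]; exact (le_div_iff₀ hs).1 ht.2
    have hta : t ≤ a := le_of_mul_le_mul_left (htu.trans hua) hs
    have htb : t ≤ b := le_of_mul_le_mul_left (htu.trans hub) hs
    have ht' : t ∈ Set.Icc 0 δ := ⟨ht.1, hta.trans ha.2⟩
    have h1 := hgg hc hg t ht' a ha hta
    have h2 := hgg hc' hg' t ht' b hb htb
    have h3 : s * t ≤ gprod x (g t) (g' b) :=
      (le_min h1 htu).trans (C.fourPoint.min_gprod_le x (g t) (g a) (g' b))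
    have h4 := C.fourPoint.dist_eq_zero (hg t ht').2 (hg' t ht').2 h3 h2
    rw [dist_eq_zero] at h4
    rw [← (hg t ht').1, h4, (hg' t ht').1]
  · push Not at hz
    refine Or.inr ⟨δ, hδ, fun a ha b hb => ?_⟩
    rw [← (hg a ha).1, ← (hg' b hb).1, iso ha hb (hg a ha).2 (hg' b hb).2]
    have h1 := hz a ha b hb
    have h2 := dist_triangle_left (g a) (g' b) x
    unfold gprod at h1
    rw [(hg a ha).2, (hg' b hb).2] at h1 h2
    linarith

end TreeCover

/-! ### Closed walks -/

/-- Near `t` the curve `c` multiplies distances by `s`. -/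
def GeodNear {Y : Type*} [PseudoMetricSpace Y] (c : ℝ → Y) (s t : ℝ) : Prop :=
  ∃ ε > 0, ∀ u v, |u - t| < ε → |v - t| < ε → dist (c u) (c v) = s * |u - v|

section Circle

variable {Y : Type*} {f : ℝ → Y} {L : ℝ}

/-- The loop obtained from a curve that is periodic with period `L`. -/
def circleMap (f : ℝ → Y) (L : ℝ) : UnitAddCircle → Y :=
  Function.Periodic.lift (f := fun t => f (L * Int.fract t)) (c := 1) fun t => by
    simp only [Int.fract_add_one]

/-- Periodicity is assumed only for nonnegative times because walks are indexed by natural numbers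
and start at time zero. -/
lemma circleMap_coe (hL : 0 ≤ L) (hf : ∀ t, 0 ≤ t → f (t + L) = f t) {t : ℝ} (ht : 0 ≤ t) :
    circleMap f L t = f (L * t) := by
  change f (L * Int.fract t) = f (L * t)
  have h : ∀ k : ℕ, f (L * (Int.fract t + k)) = f (L * Int.fract t) := by
    intro k
    induction k with
    | zero => simp
    | succ k ih =>
      rw [← ih, ← hf (L * (Int.fract t + k)) (by have := Int.fract_nonneg t; positivity)]
      congr 1; push_cast; ring
  rw [← h ⌊t⌋.toNat]
  congr 2
  have h1 : ((⌊t⌋.toNat : ℤ) : ℝ) = (⌊t⌋ : ℝ) := by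
    rw [Int.toNat_of_nonneg (Int.floor_nonneg.2 ht)]
  rw [Int.cast_natCast] at h1
  rw [h1, Int.fract_add_floor]

lemma comp_circleMap {Z : Type*} (φ : Y → Z) (z : UnitAddCircle) :
    circleMap (φ ∘ f) L z = φ (circleMap f L z) := by
  obtain ⟨t, rfl⟩ := QuotientAddGroup.mk_surjective z
  rfl

lemma locGeod_circleMap [PseudoMetricSpace Y] (hL : 0 < L) (hf : ∀ t, 0 ≤ t → f (t + L) = f t)
    {s : ℝ} (hg : ∀ t, 0 < t → GeodNear f s t) : LocGeod (circleMap f L) (s * L) := by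
  intro z
  obtain ⟨t₀, rfl⟩ := QuotientAddGroup.mk_surjective z
  -- A representative at least `1`, so that all parameters in a ball of radius `1 / 4` are
  -- nonnegative and positive times are available for `hg`.
  obtain ⟨t, ht, htz⟩ : ∃ t : ℝ, 1 ≤ t ∧ (t : UnitAddCircle) = (t₀ : UnitAddCircle) := by
    refine ⟨t₀ - ⌊t₀⌋ + 1, by linarith [Int.floor_le t₀], ?_⟩
    have h1 : t₀ - ⌊t₀⌋ + 1 = t₀ + ((1 - ⌊t₀⌋ : ℤ) : ℝ) := by push_cast; ring
    rw [h1, AddCircle.coe_add]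
    have h2 : (((1 - ⌊t₀⌋ : ℤ) : ℝ) : UnitAddCircle) = 0 := by
      rw [AddCircle.coe_eq_zero_iff]
      exact ⟨1 - ⌊t₀⌋, by simp⟩
    rw [h2, add_zero]
  obtain ⟨ε, hε, hd⟩ := hg (L * t) (by positivity)
  have lift : ∀ w : UnitAddCircle, ∃ u : ℝ, (u : UnitAddCircle) = w ∧
      |u - t| = dist w (t₀ : UnitAddCircle) := by
    intro w
    obtain ⟨u, rfl⟩ := QuotientAddGroup.mk_surjective w
    refine ⟨u - round (u - t), ?_, ?_⟩
    · rw [AddCircle.coe_sub]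
      have h2 : (((round (u - t) : ℤ) : ℝ) : UnitAddCircle) = 0 := by
        rw [AddCircle.coe_eq_zero_iff]
        exact ⟨round (u - t), by simp⟩
      rw [h2, sub_zero]
    · rw [← htz, dist_eq_norm]
      change _ = ‖((u : UnitAddCircle) - t)‖
      rw [← AddCircle.coe_sub, UnitAddCircle.norm_eq]
      congr 1; ring
  refine ⟨Metric.ball _ (min (1 / 4) (ε / L)), Metric.ball_mem_nhds _ (by positivity), ?_⟩
  intro a ha b hb
  obtain ⟨u, rfl, hu⟩ := lift a
  obtain ⟨v, rfl, hv⟩ := lift b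
  rw [Metric.mem_ball, lt_min_iff] at ha hb
  change dist _ (t₀ : UnitAddCircle) < _ ∧ dist _ (t₀ : UnitAddCircle) < _ at ha hb
  rw [← hu] at ha
  rw [← hv] at hb
  have hu0 : 0 ≤ u := by linarith [(abs_lt.1 ha.1).1]
  have hv0 : 0 ≤ v := by linarith [(abs_lt.1 hb.1).1]
  have hs : ∀ x : ℝ, |x - t| < ε / L → |L * x - L * t| < ε := fun x hx => by
    rw [← mul_sub, abs_mul, abs_of_pos hL, mul_comm]
    exact (lt_div_iff₀ hL).1 hx
  rw [circleMap_coe hL.le hf hu0, circleMap_coe hL.le hf hv0, hd _ _ (hs u ha.2) (hs v hb.2),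
    ← mul_sub, abs_mul, abs_of_pos hL, dist_eq_norm, ← AddCircle.coe_sub,
    (AddCircle.norm_coe_eq_abs_iff 1 one_ne_zero).2, mul_assoc]
  rw [abs_one]
  have := abs_sub_le u t v
  rw [abs_sub_comm t v] at this
  linarith [ha.1, hb.1]

end Circle

namespace MarkedGraph

variable {Γ Γ' : MarkedGraph n}

/-- The directed edge parametrized by arc length. -/
def arc (a : Γ.graph.Dir) (τ : ℝ) : Γ.graph.Realization :=
  dedge a (Set.projIcc 0 1 zero_le_one (τ / weight Γ a))

lemma arc_of_mem {a : Γ.graph.Dir} {τ : ℝ} (h : τ / weight Γ a ∈ I) :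
    arc a τ = dedge a ⟨τ / weight Γ a, h⟩ := by
  rw [arc, Set.projIcc_of_mem _ h]

lemma arc_zero (a : Γ.graph.Dir) : arc a 0 = vert (org a) := by
  rw [← dedge_zero, arc, zero_div, Set.projIcc_left]
  rfl

lemma arc_bar (a : Γ.graph.Dir) (τ : ℝ) : arc (bar a) τ = arc a (weight Γ a - τ) := by
  have h : weight Γ (bar a) = weight Γ a := rfl
  rw [arc, arc, dedge_bar, h, sub_div, div_self (weight_pos a).ne']
  rw [unitInterval.symm_projIcc]

lemma arc_weight (a : Γ.graph.Dir) : arc a (weight Γ a) = vert (ter a) := by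
  have := arc_bar a 0
  rw [sub_zero, arc_zero] at this
  exact this.symm

lemma lipBound_arc (a : Γ.graph.Dir) : LipBound 1 (arc a) := fun x y => by
  refine (lipBound_dedge a _ _).trans ?_
  refine (mul_le_mul_of_nonneg_left (dist_projIcc_le _ _) (weight_pos a).le).trans_eq ?_
  rw [Real.dist_eq, Real.dist_eq, ← sub_div, abs_div, abs_of_pos (weight_pos a)]
  have := (weight_pos a).ne'
  field_simp

variable {Y : Type} [PseudoMetricSpace Y]

/-- The map has slope `κ` along the directed edge. -/
def Stretched (φ : Γ.graph.Realization → Y) (κ : ℝ) (a : Γ.graph.Dir) : Prop :=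
  ∀ τ ∈ Set.Icc 0 (weight Γ a), ∃ ε > 0, ∀ u ∈ Set.Icc 0 (weight Γ a),
    ∀ v ∈ Set.Icc 0 (weight Γ a), |u - τ| < ε → |v - τ| < ε →
      dist (φ (arc a u)) (φ (arc a v)) = κ * |u - v|

lemma stretched_of_locGeod {φ : Γ.graph.Realization → Y} {κ : ℝ} {a : Γ.graph.Dir}
    (h : LocGeod (fun t : I => φ (edge a.1 t)) (κ * Γ.length a.1)) : Stretched φ κ a := by
  have hw := weight_pos a
  have hI : ∀ u ∈ Set.Icc 0 (weight Γ a), u / weight Γ a ∈ I := fun u hu =>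
    ⟨div_nonneg hu.1 hw.le, (div_le_one hw).2 hu.2⟩
  intro τ hτ
  obtain ⟨ε, hε, hd⟩ := h.exists_ball (par a ⟨_, hI τ hτ⟩)
  have hdist : ∀ u (hu : u ∈ Set.Icc 0 (weight Γ a)) v (hv : v ∈ Set.Icc 0 (weight Γ a)),
      dist (par a ⟨_, hI u hu⟩) (par a ⟨_, hI v hv⟩) = |u - v| / weight Γ a := fun u hu v hv => by
    rw [Subtype.dist_eq, Real.dist_eq, abs_par_sub, ← sub_div, abs_div, abs_of_pos hw]
  refine ⟨ε * weight Γ a, mul_pos hε hw, fun u hu v hv h1 h2 => ?_⟩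
  rw [arc_of_mem (hI u hu), arc_of_mem (hI v hv)]
  refine (hd (par a ⟨_, hI u hu⟩) (par a ⟨_, hI v hv⟩) ?_ ?_).trans ?_
  · rw [hdist u hu τ hτ]; exact (div_lt_iff₀ hw).2 h1
  · rw [hdist v hv τ hτ]; exact (div_lt_iff₀ hw).2 h2
  · rw [hdist u hu v hv, weight]
    have := (Γ.length_pos a.1).ne'
    field_simp

lemma Stretched.geodNear {φ : Γ.graph.Realization → Y} {κ : ℝ} {a : Γ.graph.Dir}
    (h : Stretched φ κ a) {τ : ℝ} (h0 : 0 < τ) (h1 : τ < weight Γ a) :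
    GeodNear (fun t => φ (arc a t)) κ τ := by
  obtain ⟨ε, hε, hd⟩ := h τ ⟨h0.le, h1.le⟩
  have h2 := sub_pos.2 h1
  refine ⟨min ε (min τ (weight Γ a - τ)), by positivity, fun u v hu hv => ?_⟩
  simp only [lt_min_iff, abs_lt] at hu hv
  exact hd u ⟨by linarith, by linarith⟩ v ⟨by linarith, by linarith⟩ (abs_lt.2 hu.1)
    (abs_lt.2 hv.1)

lemma Stretched.exists_germ {φ : Γ.graph.Realization → Y} {κ : ℝ} {a : Γ.graph.Dir}
    (h : Stretched φ κ a) : ∃ ε > 0, ε ≤ weight Γ a ∧ ∀ u ∈ Set.Icc 0 ε, ∀ v ∈ Set.Icc 0 ε,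
      dist (φ (arc a u)) (φ (arc a v)) = κ * |u - v| := by
  have hw := weight_pos a
  obtain ⟨ε, hε, hd⟩ := h 0 ⟨le_rfl, hw.le⟩
  refine ⟨min (ε / 2) (weight Γ a), by positivity, min_le_right _ _, fun u hu v hv => ?_⟩
  rw [Set.mem_Icc, le_min_iff] at hu hv
  refine hd u ⟨hu.1, hu.2.2⟩ v ⟨hv.1, hv.2.2⟩ ?_ ?_
  · rw [sub_zero, abs_of_nonneg hu.1]; linarith
  · rw [sub_zero, abs_of_nonneg hv.1]; linarith

/-- The directed edges `b` and `b'` have the same image germ. -/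
def SameGerm (φ : Γ.graph.Realization → Y) (b b' : Γ.graph.Dir) : Prop :=
  ∃ δ > 0, ∀ t ∈ Set.Icc 0 δ, φ (arc b t) = φ (arc b' t)

/-- A reversed edge has the same slope. -/
lemma Stretched.bar {φ : Γ.graph.Realization → Y} {κ : ℝ} {a : Γ.graph.Dir}
    (h : Stretched φ κ a) : Stretched φ κ (bar a) := by
  have hw : weight Γ (FinGraph.bar a) = weight Γ a := rfl
  rintro τ ⟨h0, h1⟩
  rw [hw] at h1
  obtain ⟨ε, hε, hd⟩ := h (weight Γ a - τ) ⟨by linarith, by linarith⟩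
  refine ⟨ε, hε, fun u hu v hv h2 h3 => ?_⟩
  rw [hw] at hu hv
  rw [arc_bar, arc_bar, hd _ ⟨by linarith [hu.2], by linarith [hu.1]⟩ _
    ⟨by linarith [hv.2], by linarith [hv.1]⟩, abs_sub_comm u v]
  · congr 2; ring
  · rw [abs_sub_comm] at h2; convert h2 using 2; ring
  · rw [abs_sub_comm] at h3; convert h3 using 2; ring

section Walk

variable (a : ℕ → Γ.graph.Dir)

/-- The length of an initial segment of a walk. -/
def walkLength (i : ℕ) : ℝ := ∑ j ∈ Finset.range i, weight Γ (a j)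

/-- The unit speed curve that follows the walk. -/
def walk (t : ℝ) : Γ.graph.Realization :=
  let i := sInf {i : ℕ | t < walkLength a (i + 1)}
  arc (a i) (t - walkLength a i)

variable {a}

lemma walkLength_succ (i : ℕ) : walkLength a (i + 1) = walkLength a i + weight Γ (a i) :=
  Finset.sum_range_succ _ _

lemma strictMono_walkLength : StrictMono (walkLength a) :=
  strictMono_nat_of_lt_succ fun i => by rw [walkLength_succ]; linarith [weight_pos (a i)]

lemma exists_walkLength {t : ℝ} (ht : 0 ≤ t) :
    ∃ i, walkLength a i ≤ t ∧ t < walkLength a (i + 1) := by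
  obtain ⟨m, hm0, hm⟩ := Γ.exists_length_lower_bound
  have h1 : ∀ i : ℕ, i * m ≤ walkLength a i := fun i => by
    induction i with
    | zero => simp [walkLength]
    | succ i ih =>
      rw [walkLength_succ]
      have : m ≤ weight Γ (a i) := hm _
      push_cast
      linarith
  obtain ⟨k, hk⟩ := exists_nat_gt (t / m)
  rw [div_lt_iff₀ hm0] at hk
  classical
  have hex : ∃ i, t < walkLength a i := ⟨k, hk.trans_le (h1 k)⟩
  have hpos : Nat.find hex ≠ 0 := fun h => by
    have := Nat.find_spec hex
    rw [h] at this
    simp [walkLength] at this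
    linarith
  obtain ⟨i, hi⟩ := Nat.exists_eq_succ_of_ne_zero hpos
  refine ⟨i, not_lt.1 (Nat.find_min hex (by omega)), ?_⟩
  have := Nat.find_spec hex
  rwa [hi] at this

lemma sInf_walkLength {i : ℕ} {t : ℝ} (h0 : walkLength a i ≤ t) (h1 : t < walkLength a (i + 1)) :
    sInf {i : ℕ | t < walkLength a (i + 1)} = i := by
  refine le_antisymm (Nat.sInf_le h1) (le_csInf ⟨i, h1⟩ fun j hj => ?_)
  by_contra hc
  push Not at hc
  have := (strictMono_walkLength (a := a)).monotone (show j + 1 ≤ i from hc)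
  exact absurd hj (not_lt.2 (this.trans h0))

/-- The closed interval is allowed: at its right end `walk` already uses the next edge, and the two
descriptions agree at the common vertex. -/
lemma walk_eq (ha : ∀ i, ter (a i) = org (a (i + 1))) {i : ℕ} {t : ℝ} (h0 : walkLength a i ≤ t)
    (h1 : t ≤ walkLength a (i + 1)) : walk a t = arc (a i) (t - walkLength a i) := by
  rcases h1.lt_or_eq with h1 | rfl
  · unfold walk
    rw [sInf_walkLength h0 h1]
  · have : sInf {j : ℕ | walkLength a (i + 1) < walkLength a (j + 1)} = i + 1 :=
      sInf_walkLength le_rfl (strictMono_walkLength (Nat.lt_succ_self _))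
    unfold walk
    simp only [this]
    rw [sub_self, arc_zero, ← ha, ← arc_weight, walkLength_succ, add_sub_cancel_left]

lemma walk_add_period (ha : ∀ i, ter (a i) = org (a (i + 1))) {N : ℕ}
    (hN : ∀ i, a (i + N) = a i) {t : ℝ} (ht : 0 ≤ t) : walk a (t + walkLength a N) = walk a t := by
  have h : ∀ i, walkLength a (i + N) = walkLength a i + walkLength a N := fun i => by
    induction i with
    | zero => simp [walkLength]
    | succ i ih =>
      rw [show i + 1 + N = i + N + 1 by ring, walkLength_succ, walkLength_succ, ih, hN]; ring
  obtain ⟨i, h0, h1⟩ := exists_walkLength (a := a) ht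
  rw [walk_eq ha h0 h1.le, walk_eq ha (i := i + N) (by rw [h]; linarith)
    (by rw [show i + N + 1 = i + 1 + N by ring, h]; linarith), hN, h]
  congr 1; ring

/-- A walk without illegal turns is mapped to a local geodesic. -/
lemma geodNear_walk {φ : Γ.graph.Realization → Γ'.graph.Realization} {κ : ℝ} (hκ : 0 < κ)
    (ha : ∀ i, ter (a i) = org (a (i + 1))) (hs : ∀ i, Stretched φ κ (a i))
    (hl : ∀ i, ¬ SameGerm φ (bar (a i)) (a (i + 1))) {t : ℝ} (ht : 0 < t) :
    GeodNear (φ ∘ walk a) κ t := by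
  obtain ⟨i, h0, h1⟩ := exists_walkLength (a := a) ht.le
  rcases h0.eq_or_lt with h0 | h0
  · obtain ⟨j, rfl⟩ : ∃ j, i = j + 1 := by
      refine Nat.exists_eq_succ_of_ne_zero fun h => ?_
      rw [h] at h0
      simp [walkLength] at h0
      linarith
    obtain ⟨ε₁, hε₁, hw₁, hd₁⟩ := (hs j).bar.exists_germ
    obtain ⟨ε₂, hε₂, hw₂, hd₂⟩ := (hs (j + 1)).exists_germ
    have hstart : φ (arc (bar (a j)) 0) = φ (arc (a (j + 1)) 0) := by
      rw [arc_zero, arc_zero, ← ha]; rfl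
    have hmin : 0 < min ε₁ ε₂ := lt_min hε₁ hε₂
    -- At a vertex, the incoming edge read backwards and the outgoing edge have image germs from a
    -- common point. Since the germs are different, they form a geodesic through it.
    rcases Γ'.treeCover.germ_dichotomy (c := fun t => φ (arc (bar (a j)) t))
      (c' := fun t => φ (arc (a (j + 1)) t)) hstart hκ hmin
      (fun u hu v hv => hd₁ u ⟨hu.1, hu.2.trans (min_le_left _ _)⟩ v
        ⟨hv.1, hv.2.trans (min_le_left _ _)⟩)
      (fun u hu v hv => hd₂ u ⟨hu.1, hu.2.trans (min_le_right _ _)⟩ v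
        ⟨hv.1, hv.2.trans (min_le_right _ _)⟩) with h | ⟨δ, hδ, h⟩
    · exact absurd h (hl j)
    · have left : ∀ u, t - min ε₁ δ ≤ u → u ≤ t → walk a u = arc (bar (a j)) (t - u) := by
        intro u h2 h3
        have h4 := walkLength_succ (a := a) j
        have h5 : weight Γ (bar (a j)) = weight Γ (a j) := rfl
        have h6 := min_le_left ε₁ δ
        rw [walk_eq ha (i := j) (by linarith) (by linarith), arc_bar]
        congr 1; linarith
      have right : ∀ u, t ≤ u → u ≤ t + min ε₂ δ → walk a u = arc (a (j + 1)) (u - t) := by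
        intro u h2 h3
        have h4 := walkLength_succ (a := a) (j + 1)
        have h6 := min_le_left ε₂ δ
        rw [walk_eq ha (i := j + 1) (by linarith) (by linarith), h0]
      have mixed : ∀ u v, t - min ε₁ δ ≤ u → u ≤ t → t ≤ v → v ≤ t + min ε₂ δ →
          dist (φ (walk a u)) (φ (walk a v)) = κ * |u - v| := by
        intro u v h2 h3 h4 h5
        rw [left u h2 h3, right v h4 h5, h (t - u) ⟨by linarith, by
          linarith [min_le_right ε₁ δ]⟩ (v - t) ⟨by linarith, by linarith [min_le_right ε₂ δ]⟩,
          abs_sub_comm, abs_of_nonneg (by linarith)]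
        ring
      refine ⟨min (min ε₁ δ) (min ε₂ δ), by positivity, fun u v hu hv => ?_⟩
      rw [abs_lt] at hu hv
      have m1 := min_le_left (min ε₁ δ) (min ε₂ δ)
      have m2 := min_le_right (min ε₁ δ) (min ε₂ δ)
      simp only [Function.comp_apply]
      rcases le_total u t with h2 | h2 <;> rcases le_total v t with h3 | h3
      · rw [left u (by linarith) h2, left v (by linarith) h3, hd₁ (t - u)
          ⟨by linarith, by linarith [min_le_left ε₁ δ]⟩ (t - v)
          ⟨by linarith, by linarith [min_le_left ε₁ δ]⟩, abs_sub_comm u v]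
        congr 2; ring
      · exact mixed u v (by linarith) h2 h3 (by linarith)
      · rw [dist_comm, abs_sub_comm]
        exact mixed v u (by linarith) h3 h2 (by linarith)
      · rw [right u h2 (by linarith), right v h3 (by linarith), hd₂ (u - t)
          ⟨by linarith, by linarith [min_le_left ε₂ δ]⟩ (v - t)
          ⟨by linarith, by linarith [min_le_left ε₂ δ]⟩]
        congr 2; ring
  · have h2 := walkLength_succ (a := a) i
    obtain ⟨ε, hε, hd⟩ := (hs i).geodNear (τ := t - walkLength a i) (by linarith) (by linarith)
    have h3 := sub_pos.2 h0
    have h4 := sub_pos.2 h1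
    refine ⟨min ε (min (t - walkLength a i) (walkLength a (i + 1) - t)), by positivity,
      fun u v hu hv => ?_⟩
    simp only [lt_min_iff, abs_lt] at hu hv
    simp only [Function.comp_apply]
    rw [walk_eq ha (i := i) (by linarith) (by linarith), walk_eq ha (i := i) (by linarith)
      (by linarith)]
    have h5 := hd (u - walkLength a i) (v - walkLength a i)
      (by rw [abs_lt]; constructor <;> linarith) (by rw [abs_lt]; constructor <;> linarith)
    simp only at h5
    rw [h5]
    congr 2; ring

end Walk

/-- Where a tent is linear its variation bounds the distance from below. One side of a tent peaked
at `1 / 2` covers each open half of the edge, and a tent peaked at `2 / 3` rises across the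
midpoint. Loops are included, which is why this is only local. -/
lemma locGeod_edge (e : Γ.graph.E) : LocGeod (fun t : I => (edge e t : Γ.graph.Realization))
    (Γ.length e) := by
  have key : ∀ c δ (h0 : δ ≤ c) (h1 : c + δ ≤ 1) (s t : I),
      |max 0 (δ - |(s : ℝ) - c|) - max 0 (δ - |(t : ℝ) - c|)| = |(s : ℝ) - t| →
      dist (edge e s : Γ.graph.Realization) (edge e t) = Γ.length e * dist s t := by
    intro c δ h0 h1 s t h
    refine le_antisymm (lipBound_edge e s t) ?_
    have := abs_sub_le_dist (tent_lipschitz Γ.length_pos e c δ h0 h1) (edge e s) (edge e t)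
    rwa [tent_edge, tent_edge, ← mul_sub, abs_mul, abs_of_pos (Γ.length_pos e), h,
      ← Real.dist_eq, ← Subtype.dist_eq] at this
  have hopen : ∀ a b : ℝ, IsOpen {t : I | a < t ∧ (t : ℝ) < b} := fun a b =>
    (isOpen_lt continuous_const continuous_subtype_val).inter
      (isOpen_lt continuous_subtype_val continuous_const)
  intro t
  rcases lt_trichotomy (t : ℝ) (1 / 2) with h | h | h
  · refine ⟨_, (hopen (-1) (1 / 2)).mem_nhds ⟨by linarith [t.2.1], h⟩, fun s hs u hu => ?_⟩
    have h1 := s.2.1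
    have h2 := u.2.1
    refine key (1 / 2) (1 / 2) le_rfl (by norm_num) s u ?_
    rw [abs_of_neg (by linarith [hs.2] : (s : ℝ) - 1 / 2 < 0),
      abs_of_neg (by linarith [hu.2] : (u : ℝ) - 1 / 2 < 0), max_eq_right (by linarith),
      max_eq_right (by linarith)]
    congr 1; ring
  · refine ⟨_, (hopen (1 / 3) (2 / 3)).mem_nhds ⟨by rw [h]; norm_num, by rw [h]; norm_num⟩,
      fun s hs u hu => ?_⟩
    refine key (2 / 3) (1 / 3) (by norm_num) (by norm_num) s u ?_
    rw [abs_of_neg (by linarith [hs.2] : (s : ℝ) - 2 / 3 < 0),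
      abs_of_neg (by linarith [hu.2] : (u : ℝ) - 2 / 3 < 0), max_eq_right (by linarith [hs.1]),
      max_eq_right (by linarith [hu.1])]
    congr 1; ring
  · refine ⟨_, (hopen (1 / 2) 2).mem_nhds ⟨h, by linarith [t.2.2]⟩, fun s hs u hu => ?_⟩
    have h1 := s.2.2
    have h2 := u.2.2
    refine key (1 / 2) (1 / 2) le_rfl (by norm_num) s u ?_
    rw [abs_of_pos (by linarith [hs.1] : 0 < (s : ℝ) - 1 / 2),
      abs_of_pos (by linarith [hu.1] : 0 < (u : ℝ) - 1 / 2), max_eq_right (by linarith),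
      max_eq_right (by linarith), abs_sub_comm]
    congr 1; ring

lemma stretched_id (a : Γ.graph.Dir) : Stretched (id : Γ.graph.Realization → _) 1 a :=
  stretched_of_locGeod (by rw [one_mul]; exact locGeod_edge a.1)

/-- Points in the first thirds of two directed edges can only agree if the directions do: for
opposite directions of one edge the parameters would have to sum to one. -/
lemma eq_of_sameGerm_id {b b' : Γ.graph.Dir}
    (h : SameGerm (id : Γ.graph.Realization → _) b b') : b = b' := by
  obtain ⟨δ, hδ, h⟩ := h
  have h1 := weight_pos b
  have h2 := weight_pos b'
  set t := min δ (min (weight Γ b / 3) (weight Γ b' / 3)) with ht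
  have ht0 : 0 < t := by positivity
  have ht1 : t ≤ weight Γ b / 3 := (min_le_right _ _).trans (min_le_left _ _)
  have ht2 : t ≤ weight Γ b' / 3 := (min_le_right _ _).trans (min_le_right _ _)
  have e1 : 0 < t / weight Γ b ∧ t / weight Γ b ≤ 1 / 3 :=
    ⟨by positivity, by rw [div_le_iff₀ h1]; linarith⟩
  have e2 : 0 < t / weight Γ b' ∧ t / weight Γ b' ≤ 1 / 3 :=
    ⟨by positivity, by rw [div_le_iff₀ h2]; linarith⟩
  have h3 := h t ⟨ht0.le, min_le_left _ _⟩
  rw [id, id, arc_of_mem ⟨e1.1.le, by linarith⟩, arc_of_mem ⟨e2.1.le, by linarith⟩] at h3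
  rcases dedge_injective_of_interior e1.1 (show t / weight Γ b < 1 by linarith) h3 with h | h
  · exact h.1
  · have h4 : t / weight Γ b = 1 - t / weight Γ b' := congrArg (Subtype.val : I → ℝ) h.2
    linarith

end MarkedGraph

/-! ### Immersed loops in core graphs and surjectivity -/

lemma exists_perm_apply_ne {α : Type*} [Finite α] (h : 2 ≤ Nat.card α) :
    ∃ π : Equiv.Perm α, ∀ x, π x ≠ x := by
  obtain ⟨k, hk⟩ := Nat.exists_eq_add_of_le h
  let e := Finite.equivFinOfCardEq (hk.trans (add_comm 2 k))
  refine ⟨(e.trans (finRotate (k + 2))).trans e.symm, fun x hx => ?_⟩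
  have h1 : finRotate (k + 2) (e x) = e x := by simpa using congrArg e hx
  rw [finRotate_apply] at h1
  simp at h1

lemma LocGeod.nonneg_of_line {Y : Type*} [PseudoMetricSpace Y] {c : ℝ → Y} {s : ℝ}
    (h : LocGeod c s) : 0 ≤ s := by
  obtain ⟨ε, hε, hd⟩ := h.exists_ball 0
  have h1 := hd 0 (ε / 2) (by simpa using hε) (by simp [abs_of_pos hε, hε])
  have h2 : 0 ≤ s * dist (0 : ℝ) (ε / 2) := h1 ▸ dist_nonneg
  refine nonneg_of_mul_nonneg_left h2 ?_
  rw [dist_pos]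
  linarith

namespace FinGraph

variable {G : FinGraph}

lemma two_le_card_org (hG : G.IsCore) (v : G.V) : 2 ≤ Nat.card {a : G.Dir // org a = v} := by
  refine (hG v).trans ?_
  rw [valence, ← Nat.card_sum]
  let F : {e // G.src e = v} ⊕ {e // G.tgt e = v} → {a : G.Dir // org a = v} :=
    Sum.elim (fun e => ⟨(e.1, true), e.2⟩) (fun e => ⟨(e.1, false), e.2⟩)
  refine Nat.card_le_card_of_injective F ?_
  rintro (⟨x, hx⟩ | ⟨x, hx⟩) (⟨y, hy⟩ | ⟨y, hy⟩) h <;>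
    have h1 := congrArg (fun a => a.1.1) h <;> have h2 := congrArg (fun a => a.1.2) h <;>
    simp [F] at h1 h2 <;> simp [h1]

/-- At each vertex a fixed point free permutation of the outgoing directions is applied to the
reversed incoming edge. Injectivity is what makes all orbits of the resulting non-backtracking walk
periodic. -/
lemma exists_turn (hG : G.IsCore) : ∃ f : G.Dir → G.Dir, Function.Injective f ∧
    ∀ a, org (f a) = ter a ∧ f a ≠ bar a := by
  choose π hπ using fun v => exists_perm_apply_ne (two_le_card_org hG v)
  refine ⟨fun a => (π (ter a) ⟨bar a, rfl⟩).1, fun a b h => ?_, fun a => ⟨(π (ter a) _).2, fun h =>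
    hπ _ _ (Subtype.ext h)⟩⟩
  have hv : ter a = ter b := by
    rw [← (π (ter a) ⟨bar a, rfl⟩).2, ← (π (ter b) ⟨bar b, rfl⟩).2]
    exact congrArg org h
  have key : ∀ (v w : G.V) (hvw : v = w) (x : {a : G.Dir // org a = v})
      (y : {a : G.Dir // org a = w}), (π v x).1 = (π w y).1 → x.1 = y.1 := by
    rintro v _ rfl x y h
    exact congrArg Subtype.val ((π v).injective (Subtype.ext h))
  have := key _ _ hv _ _ h
  simpa using congrArg bar this

end FinGraph

namespace MarkedGraph

variable {Γ Γ' : MarkedGraph n}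

/-- A closed walk without illegal turns gives an immersed loop with immersed image. -/
lemma exists_loop_of_walk (φ : C(Γ.graph.Realization, Γ'.graph.Realization)) {κ : ℝ} (hκ : 0 < κ)
    {a : ℕ → Γ.graph.Dir} {N : ℕ} (hN0 : 0 < N) (hN : ∀ i, a (i + N) = a i)
    (ha : ∀ i, ter (a i) = org (a (i + 1))) (hs : ∀ i, Stretched φ κ (a i))
    (hl : ∀ i, ¬ SameGerm φ (bar (a i)) (a (i + 1))) :
    ∃ α : C(UnitAddCircle, Γ.graph.Realization), ∃ L > 0, LocGeod α L ∧
      LocGeod (φ.comp α) (κ * L) ∧ ∀ τ ∈ Set.Icc 0 (weight Γ (a 0)), arc (a 0) τ ∈ Set.range α := by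
  set L := walkLength a N with hL
  have hLpos : 0 < L := by
    have := strictMono_walkLength (a := a) hN0
    rwa [show walkLength a 0 = 0 by simp [walkLength]] at this
  have hper : ∀ t, 0 ≤ t → walk a (t + L) = walk a t := fun t ht => walk_add_period ha hN ht
  have h1 : LocGeod (circleMap (walk a) L) (1 * L) := by
    refine locGeod_circleMap hLpos hper fun t ht => ?_
    refine geodNear_walk (φ := (id : Γ.graph.Realization → _)) one_pos ha
      (fun i => stretched_id _) (fun i => ?_) ht
    -- A turn that backtracks in `Γ` has equal germs, hence equal image germs, and is illegal for
    -- `φ` as well.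
    rintro ⟨δ, hδ, h⟩
    exact hl i ⟨δ, hδ, fun t ht => congrArg φ (h t ht)⟩
  have h2 : LocGeod (circleMap (φ ∘ walk a) L) (κ * L) :=
    locGeod_circleMap hLpos (fun t ht => congrArg φ (hper t ht)) fun t ht =>
      geodNear_walk hκ ha hs hl ht
  refine ⟨⟨circleMap (walk a) L, h1.continuous⟩, L, hLpos, by rwa [one_mul] at h1, ?_, ?_⟩
  · rwa [show circleMap (φ ∘ walk a) L = _ from funext fun z => comp_circleMap φ z] at h2
  · intro τ hτ
    refine ⟨((τ / L : ℝ) : UnitAddCircle), ?_⟩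
    have h0 : walkLength a 0 = 0 := by simp [walkLength]
    have h3 := walkLength_succ (a := a) 0
    rw [h0, zero_add] at h3
    rw [ContinuousMap.coe_mk]
    rw [circleMap_coe hLpos.le hper (div_nonneg hτ.1 hLpos.le), mul_div_cancel₀ _ hLpos.ne',
      walk_eq ha (i := 0) (by rw [h0]; exact hτ.1) (by rw [zero_add, h3]; linarith [hτ.2]), h0, sub_zero]

lemma exists_arc_eq (x : Γ.graph.Realization) :
    ∃ a, ∃ τ ∈ Set.Icc 0 (weight Γ a), arc a τ = x := by
  induction x using realization_ind with
  | hv v =>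
    have := two_le_card_org Γ.isCore v
    have : Nonempty {a : Γ.graph.Dir // org a = v} := by
      exact (Nat.card_pos_iff.1 (by omega)).1
    obtain ⟨a, ha⟩ := this
    exact ⟨a, 0, ⟨le_rfl, (weight_pos a).le⟩, by rw [arc_zero, ha]⟩
  | he e t =>
    have h := Γ.length_pos e
    refine ⟨(e, true), Γ.length e * t, ⟨mul_nonneg h.le t.2.1, ?_⟩, ?_⟩
    · exact mul_le_of_le_one_right h.le t.2.2
    · rw [arc, weight, mul_div_cancel_left₀ _ h.ne', Set.projIcc_val]
      simp [dedge, par]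

/-- Every point of a core graph lies on an immersed loop. -/
lemma exists_loop_through (x : Γ.graph.Realization) :
    ∃ α : C(UnitAddCircle, Γ.graph.Realization), ∃ L > 0, LocGeod α L ∧ x ∈ Set.range α := by
  obtain ⟨a, τ, hτ, rfl⟩ := exists_arc_eq x
  obtain ⟨f, hf, hfa⟩ := exists_turn Γ.isCore
  -- An injective self-map of a finite set has only periodic points, so the walk returns to the
  -- chosen edge itself.
  obtain ⟨N, hN0, hN⟩ := Function.mem_periodicPts.1 (hf.mem_periodicPts a)
  obtain ⟨α, L, hL, h1, -, h2⟩ := exists_loop_of_walk (ContinuousMap.id Γ.graph.Realization)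
    one_pos (a := fun i => f^[i] a) hN0 (fun i => by rw [Function.iterate_add_apply, hN])
    (fun i => by rw [Function.iterate_succ_apply', (hfa _).1])
    (fun i => stretched_id _) (fun i h => by
      have := eq_of_sameGerm_id h
      rw [Function.iterate_succ_apply'] at this
      exact (hfa _).2 this.symm)
  exact ⟨α, L, hL, h1, h2 τ hτ⟩

/-- For a compatible `ψ` in the other direction, `φ ∘ ψ` is homotopic to the identity. It therefore
sends an immersed loop through the given point to a homotopic loop, which must cover the immersed
one. -/
lemma Compatible.surjective {φ : C(Γ.graph.Realization, Γ'.graph.Realization)}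
    (hφ : Compatible Γ Γ' φ) : Function.Surjective φ := by
  obtain ⟨ψ, hψ⟩ := exists_compatible Γ' Γ
  have hid : Compatible Γ' Γ' (ContinuousMap.id _) := ContinuousMap.Homotopic.refl _
  intro x
  obtain ⟨α, L, hL, h1, z, rfl⟩ := exists_loop_through x
  have h2 : ((φ.comp ψ).comp α).Homotopic α := by
    have := ((hφ.comp hψ).homotopic_of hid).comp (ContinuousMap.Homotopic.refl α)
    rwa [ContinuousMap.id_comp] at this
  obtain ⟨w, hw⟩ := Γ'.treeCover.mem_range_of_homotopic h2 hL h1 z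
  exact ⟨ψ (α w), hw⟩

/-- Homotopic immersed loops have the same length. -/
lemma loopLength_eq {α β : C(UnitAddCircle, Γ.graph.Realization)} (h : α.Homotopic β) {L : ℝ}
    (hβ : LocGeod β L) : loopLength Γ.length α = L := by
  have hL := hβ.of_circle.nonneg_of_line
  have : {L' | ∃ β' : C(UnitAddCircle, Γ.graph.Realization), α.Homotopic β' ∧
      IsLocalGeodesic Γ.length β' L'} = {L} := by
    ext L'
    constructor
    · rintro ⟨β', h', hβ'⟩
      have hβ' : LocGeod β' L' := hβ'
      have hL' := hβ'.of_circle.nonneg_of_line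
      exact le_antisymm (Γ.treeCover.speed_le (h'.symm.trans h) hβ' hβ hL' hL)
        (Γ.treeCover.speed_le (h.symm.trans h') hβ hβ' hL hL')
    · rintro rfl
      exact ⟨β, h, hβ⟩
  rw [loopLength, this, csInf_singleton]

end MarkedGraph

open MeasureTheory

/-! ### Length measure and maps that do not increase distances -/

instance (Γ : MarkedGraph n) : MeasurableSpace Γ.graph.Realization := borel _

instance (Γ : MarkedGraph n) : BorelSpace Γ.graph.Realization := ⟨rfl⟩

lemma LipBound.hausdorff_image_le {X Y : Type*} [MetricSpace X] [MetricSpace Y]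
    [MeasurableSpace X] [BorelSpace X] [MeasurableSpace Y] [BorelSpace Y] {K : ℝ} {f : X → Y}
    (h : LipBound K f) (s : Set X) :
    Measure.hausdorffMeasure 1 (f '' s) ≤ ENNReal.ofReal K * Measure.hausdorffMeasure 1 s := by
  have := h.lipschitzWith.hausdorffMeasure_image_le zero_le_one s
  rwa [ENNReal.rpow_one] at this

/-- Lower bounds for the length measure come from 1-Lipschitz functions to the line, as lower bounds
for distances do. -/
lemma volume_le_of_subset_image {X : Type*} [MetricSpace X] [MeasurableSpace X] [BorelSpace X]
    {F : X → ℝ} (hF : LipBound 1 F) {s : Set X} {t : Set ℝ} (h : t ⊆ F '' s) :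
    volume t ≤ Measure.hausdorffMeasure 1 s := by
  have := hF.hausdorff_image_le s
  rw [hausdorffMeasure_real, ENNReal.ofReal_one, one_mul] at this
  exact (measure_mono h).trans this

lemma lipBound_dist {X : Type*} [MetricSpace X] (x : X) : LipBound 1 (fun y => dist x y) :=
  fun y z => by
    simp only [Real.dist_eq, one_mul, dist_comm x]
    exact abs_dist_sub_le y z x

namespace MarkedGraph

variable {Γ Γ' : MarkedGraph n}

variable (Γ) in
/-- The length measure. -/
def lengthMeasure : Measure Γ.graph.Realization := Measure.hausdorffMeasure 1

lemma lengthMeasure_singleton (x : Γ.graph.Realization) : lengthMeasure Γ {x} = 0 := by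
  have : NullSingletonClass (lengthMeasure Γ) := Measure.nullSingletonClass_hausdorff _ one_pos
  exact measure_singleton x

lemma lipBound_tent (e : Γ.graph.E) (c δ : ℝ) (h0 : δ ≤ c) (h1 : c + δ ≤ 1) :
    LipBound 1 (tent Γ.length e c δ h0 h1) := fun x y => by
  rw [one_mul, Real.dist_eq]
  exact abs_sub_le_dist (tent_lipschitz Γ.length_pos e c δ h0 h1) x y

lemma lengthMeasure_univ_le : lengthMeasure Γ Set.univ ≤ 1 := by
  have h : (Set.univ : Set Γ.graph.Realization) ⊆
      ⋃ e : Γ.graph.E, arc (e, true) '' Set.Icc 0 (Γ.length e) := by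
    intro x _
    obtain ⟨⟨e, i⟩, τ, hτ, rfl⟩ := exists_arc_eq x
    refine Set.mem_iUnion.2 ⟨e, ?_⟩
    cases i
    · refine ⟨Γ.length e - τ, ⟨sub_nonneg.2 hτ.2, by linarith [hτ.1]⟩, ?_⟩
      exact (arc_bar (e, true) τ).symm
    · exact ⟨τ, hτ, rfl⟩
  refine (measure_mono h).trans ((measure_iUnion_fintype_le _ _).trans ?_)
  calc ∑ e, lengthMeasure Γ (arc (e, true) '' Set.Icc 0 (Γ.length e))
      ≤ ∑ e, ENNReal.ofReal (Γ.length e) := by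
        refine Finset.sum_le_sum fun e _ => ?_
        refine ((lipBound_arc (e, true)).hausdorff_image_le _).trans ?_
        rw [hausdorffMeasure_real, Real.volume_Icc]
        simp
    _ = 1 := by
        rw [← ENNReal.ofReal_sum_of_nonneg fun e _ => (Γ.length_pos e).le, Γ.length_sum,
          ENNReal.ofReal_one]

/-- A tent folds an edge in two and detects only half of its length. So each edge is split into two
disjoint open halves, indexed by its directions, on each of which the tent peaked at the midpoint
has image of length `Γ.length e / 2`. -/
lemma one_le_lengthMeasure_univ : 1 ≤ lengthMeasure Γ Set.univ := by
  have hc : ∀ i : Bool, (1 / 4 : ℝ) ≤ (if i then 1 / 4 else 3 / 4) ∧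
      (if i then 1 / 4 else 3 / 4 : ℝ) + 1 / 4 ≤ 1 := fun i => by cases i <;> norm_num
  let U : Γ.graph.Dir → Set Γ.graph.Realization := fun a =>
    {x | 0 < tent Γ.length a.1 (if a.2 then 1 / 4 else 3 / 4) (1 / 4) (hc a.2).1 (hc a.2).2 x}
  have hU : ∀ a, IsOpen (U a) := fun a =>
    isOpen_lt continuous_const (continuous_tent _ _ _ _ _ _)
  have hmem : ∀ a x, x ∈ U a → ∃ t : I, x = edge a.1 t ∧
      |(t : ℝ) - (if a.2 then 1 / 4 else 3 / 4)| < 1 / 4 := by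
    intro a x hx
    induction x using realization_ind with
    | hv v => exact absurd hx (lt_irrefl (0 : ℝ))
    | he e t =>
      change 0 < tent _ _ _ _ _ _ _ at hx
      by_cases he : e = a.1
      · subst he
        rw [tent_edge] at hx
        refine ⟨t, rfl, ?_⟩
        by_contra hcon
        rw [max_eq_left (by linarith), mul_zero] at hx
        exact lt_irrefl _ hx
      · rw [tent_edge_of_ne he] at hx
        exact absurd hx (lt_irrefl _)
  have hdisj : Pairwise fun a b => Disjoint (U a) (U b) := by
    intro a b hab
    refine Set.disjoint_left.2 fun x hx hx' => hab ?_
    obtain ⟨t, rfl, ht⟩ := hmem a x hx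
    obtain ⟨t', h, ht'⟩ := hmem b _ hx'
    have h01 : 0 < t ∧ t < 1 := by
      change (0 : ℝ) < t ∧ (t : ℝ) < 1
      rw [abs_lt] at ht
      split_ifs at ht <;> constructor <;> linarith
    obtain ⟨he, rfl⟩ := edge_injective_of_interior h01.1 h01.2 h
    refine Prod.ext he ?_
    rw [abs_lt] at ht ht'
    rcases a with ⟨_, _ | _⟩ <;> rcases b with ⟨_, _ | _⟩ <;> simp at ht ht' ⊢ <;> linarith
  have hle : ∀ a, ENNReal.ofReal (Γ.length a.1 / 2) ≤ lengthMeasure Γ (U a) := by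
    intro a
    have hl := Γ.length_pos a.1
    have h2 : Set.Ioo 0 (Γ.length a.1 / 2) ⊆
        tent Γ.length a.1 (1 / 2) (1 / 2) le_rfl (by norm_num) '' U a := by
      intro y hy
      have hy0 : 0 < y / Γ.length a.1 := div_pos hy.1 hl
      have hy1 : y / Γ.length a.1 < 1 / 2 := by rw [div_lt_iff₀ hl]; linarith [hy.2]
      have hy2 : Γ.length a.1 * (y / Γ.length a.1) = y := mul_div_cancel₀ _ hl.ne'
      set z := y / Γ.length a.1 with hz
      refine ⟨edge a.1 ⟨if a.2 then z else 1 - z, by split_ifs <;> constructor <;> linarith⟩,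
        ?_, ?_⟩
      · change 0 < tent _ _ _ _ _ _ _
        rw [tent_edge]
        refine mul_pos hl (lt_max_of_lt_right (sub_pos.2 ?_))
        rw [abs_lt]
        split_ifs <;> constructor <;> simp <;> linarith
      · rw [tent_edge]
        conv_rhs => rw [← hy2]
        congr 1
        split_ifs
        · rw [abs_of_neg (by simp; linarith), max_eq_right (by simp; linarith)]; simp
        · rw [abs_of_pos (by simp; linarith), max_eq_right (by simp; linarith)]; simp; ring
    have := volume_le_of_subset_image (lipBound_tent a.1 _ _ _ _) h2
    rwa [Real.volume_Ioo, sub_zero] at this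
  calc (1 : ENNReal) = ∑ a : Γ.graph.Dir, ENNReal.ofReal (Γ.length a.1 / 2) := by
        rw [← ENNReal.ofReal_sum_of_nonneg fun a _ => (half_pos (Γ.length_pos a.1)).le,
          Fintype.sum_prod_type]
        simp only [Fintype.sum_bool, add_halves, Γ.length_sum, ENNReal.ofReal_one]
    _ ≤ ∑ a, lengthMeasure Γ (U a) := Finset.sum_le_sum fun a _ => hle a
    _ ≤ _ := sum_measure_le_measure_univ (fun a _ => (hU a).measurableSet.nullMeasurableSet)
          fun a _ b _ hab => (hdisj hab).aedisjoint

/-- A marked graph has total length one. -/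
lemma lengthMeasure_univ : lengthMeasure Γ Set.univ = 1 :=
  le_antisymm lengthMeasure_univ_le one_le_lengthMeasure_univ

instance : IsProbabilityMeasure (lengthMeasure Γ) := ⟨lengthMeasure_univ⟩

/-- A surjection between spaces of total length one cannot have a Lipschitz constant below one. -/
lemma Compatible.one_le {φ : C(Γ.graph.Realization, Γ'.graph.Realization)} {K : ℝ}
    (hφ : Compatible Γ Γ' φ) (hK : LipBound K φ) : 1 ≤ K := by
  have h := hK.hausdorff_image_le Set.univ
  rw [Set.image_univ, hφ.surjective.range_eq] at h
  change lengthMeasure Γ' Set.univ ≤ _ * lengthMeasure Γ Set.univ at h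
  rwa [lengthMeasure_univ, lengthMeasure_univ, mul_one, ← ENNReal.ofReal_one,
    ENNReal.ofReal_le_ofReal_iff' , or_iff_left (by norm_num)] at h

section Nonexpanding

variable {φ : C(Γ.graph.Realization, Γ'.graph.Realization)}

/-- The images of `A` and its complement cover a space of the same total length, and neither image
is longer than its source. So nothing is lost. -/
lemma lengthMeasure_image (hφ : Compatible Γ Γ' φ) (h1 : LipBound 1 φ)
    {A : Set Γ.graph.Realization} (hA : MeasurableSet A) :
    lengthMeasure Γ' (φ '' A) = lengthMeasure Γ A := by
  have hle : ∀ B, lengthMeasure Γ' (φ '' B) ≤ lengthMeasure Γ B := fun B => by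
    have := h1.hausdorff_image_le B
    rwa [ENNReal.ofReal_one, one_mul] at this
  refine le_antisymm (hle A) ?_
  have h2 : lengthMeasure Γ A + lengthMeasure Γ Aᶜ ≤
      lengthMeasure Γ' (φ '' A) + lengthMeasure Γ Aᶜ := by
    rw [measure_add_measure_compl hA, lengthMeasure_univ, ← lengthMeasure_univ (Γ := Γ'),
      ← hφ.surjective.range_eq, ← Set.image_univ, ← Set.union_compl_self A, Set.image_union]
    exact (measure_union_le _ _).trans (add_le_add_right (hle _) _)
  exact (ENNReal.add_le_add_iff_right (measure_ne_top _ _)).1 h2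

/-- Inclusion–exclusion: an overlap of positive length would make the image of the union too short.
This is the obstruction to folding. -/
lemma lengthMeasure_image_inter (hφ : Compatible Γ Γ' φ) (h1 : LipBound 1 φ)
    {A B : Set Γ.graph.Realization} (hA : IsCompact A) (hB : IsCompact B)
    (hAB : lengthMeasure Γ (A ∩ B) = 0) : lengthMeasure Γ' (φ '' A ∩ φ '' B) = 0 := by
  have hA' := hA.measurableSet
  have hB' := hB.measurableSet
  have e1 := measure_union_add_inter (μ := lengthMeasure Γ') (φ '' A)
    (hB.image φ.continuous).measurableSet
  have e2 := measure_union_add_inter (μ := lengthMeasure Γ) A hB'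
  rw [← Set.image_union, lengthMeasure_image hφ h1 (hA'.union hB'),
    lengthMeasure_image hφ h1 hA', lengthMeasure_image hφ h1 hB', ← e2, hAB] at e1
  exact (ENNReal.add_right_inj (measure_ne_top _ _)).1 e1

end Nonexpanding

/-- Compatible maps are faithful and full on homotopy classes of paths. -/
lemma Compatible.exists_path {φ : C(Γ.graph.Realization, Γ'.graph.Realization)}
    (hφ : Compatible Γ Γ' φ) {p q : Γ.graph.Realization} (γ : Path (φ p) (φ q)) :
    ∃ η : Path p q, (η.map φ.continuous).Homotopic γ := by
  obtain ⟨ψ, hψ⟩ := exists_compatible Γ' Γ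
  let h : ContinuousMap.HomotopyEquiv Γ.graph.Realization Γ'.graph.Realization :=
    { toFun := φ
      invFun := ψ
      left_inv := (hψ.comp hφ).homotopic_of (ContinuousMap.Homotopic.refl _)
      right_inv := (hφ.comp hψ).homotopic_of (ContinuousMap.Homotopic.refl _) }
  -- A homotopy equivalence induces an equivalence of fundamental groupoids; its fullness lifts
  -- homotopy classes of paths with prescribed endpoints.
  have hfull : (FundamentalGroupoid.map φ).Full :=
    (FundamentalGroupoidFunctor.equivOfHomotopyEquiv h).full_functor
  let g : (FundamentalGroupoid.map φ).obj ⟨p⟩ ⟶ (FundamentalGroupoid.map φ).obj ⟨q⟩ :=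
    Path.Homotopic.Quotient.mk γ
  obtain ⟨f, hf⟩ := (FundamentalGroupoid.map φ).map_surjective g
  obtain ⟨η, rfl⟩ := Path.Homotopic.Quotient.mk_surjective f
  exact ⟨η, Path.Homotopic.Quotient.exact hf⟩

end MarkedGraph

/-! ### Nonexpanding compatible maps are isometries -/

namespace MarkedGraph

variable {Γ Γ' : MarkedGraph n}

/-- Connected sets are at least as long as the distance of their points. -/
lemma dist_le_lengthMeasure {A : Set Γ.graph.Realization} (hA : IsPreconnected A)
    {x y : Γ.graph.Realization} (hx : x ∈ A) (hy : y ∈ A) :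
    ENNReal.ofReal (dist x y) ≤ lengthMeasure Γ A := by
  have h := (hA.image (fun z => dist x z) (by fun_prop)).Icc_subset (a := 0) (b := dist x y)
    ⟨x, hx, dist_self x⟩ ⟨y, hy, rfl⟩
  have := volume_le_of_subset_image (lipBound_dist x) h
  rwa [Real.volume_Icc, sub_zero] at this

section Nonexpanding

variable {φ : C(Γ.graph.Realization, Γ'.graph.Realization)}

/-- The image of an immersed path under a nonexpanding compatible map does not lift to a closed path
in the tree. -/
lemma Compatible.lift_ne (hφ : Compatible Γ Γ' φ) (h1 : LipBound 1 φ)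
    (C : TreeCover Γ'.graph.Realization) {δ : ℝ → Γ.graph.Realization} (hδ : Continuous δ) {s : ℝ}
    (hs : 0 < s) (hnear : ∀ t, 0 < t → t < 1 → ∃ ε > 0, 0 ≤ t - ε ∧ t + ε ≤ 1 ∧
      ∀ u v, |u - t| ≤ ε → |v - t| ≤ ε → dist (δ u) (δ v) = s * |u - v|)
    {ξ : ℝ → C.T} (hξc : Continuous ξ) (hcomp : ∀ t, C.p (ξ t) = φ (δ t)) : ξ 0 ≠ ξ 1 := by
  intro hξ1
  have hr := C.r_pos
  obtain ⟨x₀, hξ0⟩ : ∃ x₀, ξ 0 = x₀ := ⟨_, rfl⟩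
  rw [hξ0, eq_comm] at hξ1
  -- the lift is nowhere locally constant
  have hnonconst : ∀ a b, 0 ≤ a → a < b → b ≤ 1 → ∃ t ∈ Set.Icc a b, ξ t ≠ ξ a := by
    intro a b ha hab hb
    by_contra hc
    push Not at hc
    obtain ⟨m, hm⟩ : ∃ m, m = (a + b) / 2 := ⟨_, rfl⟩
    obtain ⟨ε, hε, -, -, hd⟩ := hnear m (by linarith) (by linarith)
    obtain ⟨w, hw⟩ : ∃ w, w = m + min ε ((b - a) / 2) := ⟨_, rfl⟩
    have hmin : 0 < min ε ((b - a) / 2) := lt_min hε (by linarith)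
    have hA : IsCompact ((fun t => δ t) '' Set.Icc a b) :=
      isCompact_Icc.image (hδ)
    -- Around its midpoint the arc has positive length, so its image cannot be a single point.
    have h2 := lengthMeasure_image hφ h1 hA.measurableSet
    have h3 : φ '' ((fun t => δ t) '' Set.Icc a b) ⊆ {φ (δ a)} := by
      rintro _ ⟨_, ⟨t, ht, rfl⟩, rfl⟩
      rw [Set.mem_singleton_iff, ← hcomp, ← hcomp, hc t ht]
    rw [measure_mono_null h3 (lengthMeasure_singleton _)] at h2
    have h4 := dist_le_lengthMeasure (A := (fun t => δ t) '' Set.Icc a b)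
      (isPreconnected_Icc.image _ (hδ).continuousOn)
      ⟨m, ⟨by linarith, by linarith⟩, rfl⟩
      ⟨w, ⟨by linarith, by linarith [min_le_right ε ((b - a) / 2)]⟩, rfl⟩
    rw [← h2, hd m w (by simp [hε.le]) (by
      rw [hw, add_sub_cancel_left, abs_of_pos hmin]; exact min_le_left _ _)] at h4
    have h5 : 0 < s * |m - w| := mul_pos hs (abs_pos.2 (by linarith))
    exact absurd h4 (not_le.2 (ENNReal.ofReal_pos.2 h5))
  -- a point of the lift at maximal distance
  obtain ⟨t, ht, hmax⟩ := isCompact_Icc.exists_isMaxOn (f := fun t => dist x₀ (ξ t))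
    (Set.nonempty_Icc.2 (zero_le_one' ℝ)) (by fun_prop)
  have hmax : ∀ u ∈ Set.Icc (0 : ℝ) 1, dist x₀ (ξ u) ≤ dist x₀ (ξ t) := hmax
  set y := ξ t with hy
  have hMpos : 0 < dist x₀ y := by
    obtain ⟨u, hu, hu'⟩ := hnonconst 0 1 le_rfl one_pos le_rfl
    rw [hξ0] at hu'
    exact (dist_pos.2 hu'.symm).trans_le (hmax u hu)
  have ht0 : 0 < t := by
    refine lt_of_le_of_ne ht.1 fun h => ?_
    rw [hy, ← h, hξ0, dist_self] at hMpos
    exact lt_irrefl _ hMpos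
  have ht1 : t < 1 := by
    refine lt_of_le_of_ne ht.2 fun h => ?_
    rw [hy, h, hξ1, dist_self] at hMpos
    exact lt_irrefl _ hMpos
  obtain ⟨ε, hε, hε0, hε1, hd⟩ := hnear t ht0 ht1
  have hlt : ∀ u ∈ Set.Icc (0 : ℝ) 1, ξ u ≠ y → gprod x₀ (ξ u) y < dist x₀ y := by
    intro u hu hne
    have h2 := hmax u hu
    have h3 := dist_pos.2 hne
    unfold gprod
    linarith
  obtain ⟨a, ha, hay⟩ : ∃ a ∈ Set.Icc (t - ε) t, ξ a ≠ y := by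
    by_cases h : ξ (t - ε) = y
    · obtain ⟨u, hu, hu'⟩ := hnonconst (t - ε) t hε0 (by linarith) ht.2
      exact ⟨u, hu, by rwa [h] at hu'⟩
    · exact ⟨t - ε, ⟨le_rfl, by linarith⟩, h⟩
  obtain ⟨b, hb, hby⟩ := hnonconst t (t + ε) ht.1 (by linarith) hε1
  -- The arcs of the path just before and just after the extremal time. The path is geodesic there,
  -- so they meet only in one point.
  let A := (fun t => δ t) '' Set.Icc (t - ε) t
  let B := (fun t => δ t) '' Set.Icc t (t + ε)
  have hAB : lengthMeasure Γ (A ∩ B) = 0 := by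
    refine measure_mono_null ?_ (lengthMeasure_singleton (δ t))
    rintro _ ⟨⟨u, hu, rfl⟩, ⟨v, hv, hvu⟩⟩
    have h2 := hd v u (by rw [abs_le]; constructor <;> linarith [hv.1, hv.2])
      (by rw [abs_le]; constructor <;> linarith [hu.1, hu.2])
    simp only at hvu
    rw [hvu, dist_self] at h2
    have h3 := abs_eq_zero.1 ((mul_eq_zero.1 h2.symm).resolve_left hs.ne')
    have h4 : u = t := by linarith [hv.1, hu.2]
    rw [h4]; exact Set.mem_singleton _
  have hover := lengthMeasure_image_inter hφ h1
    (isCompact_Icc.image (hδ) : IsCompact A)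
    (isCompact_Icc.image (hδ) : IsCompact B) hAB
  set g := max (gprod x₀ (ξ a) y) (gprod x₀ (ξ b) y) with hg
  have hgM : g < dist x₀ y := max_lt (hlt a ⟨by linarith [ha.1], by linarith [ha.2]⟩ hay)
    (hlt b ⟨by linarith [hb.1], by linarith [hb.2]⟩ hby)
  -- At the point `y` farthest from `x₀` the lift must leave back towards `x₀`. Both legs cover a
  -- common segment ending at `y`; it projects isometrically, so the two images overlap in positive
  -- length.
  have hsub : Set.Ioo 0 (min (dist x₀ y - g) C.r) ⊆
      (fun z => dist (C.p y) z) '' (φ '' A ∩ φ '' B) := by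
    rintro w ⟨hw0, hw⟩
    rw [lt_min_iff] at hw
    obtain ⟨u, hu, hu1, hu2⟩ := C.fourPoint.exists_mem_path (ζ := fun t => ξ t) ha.2 hξc x₀
      (u := dist x₀ y - w) (by linarith [le_max_left (gprod x₀ (ξ a) y) (gprod x₀ (ξ b) y)])
      (by linarith)
    -- `exists_mem_path` concerns paths that end at the target, whereas the second leg starts at
    -- `y`. It is therefore run in reversed time.
    obtain ⟨v, hv, hv1, hv2⟩ := C.fourPoint.exists_mem_path (ζ := fun t => ξ (-t))
      (neg_le_neg hb.1) (hξc.comp continuous_neg) x₀ (u := dist x₀ y - w)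
      (by
        simp only [neg_neg]
        linarith [le_max_right (gprod x₀ (ξ a) y) (gprod x₀ (ξ b) y)])
      (by simp only [neg_neg]; linarith)
    simp only [neg_neg] at hv2
    have huv := dist_eq_zero.1 (C.fourPoint.dist_eq_zero hu1 hv1 hu2.ge hv2.ge)
    have huy : dist y (ξ u) = w := by
      change gprod x₀ (ξ u) y = _ at hu2
      unfold gprod at hu2
      rw [dist_comm]
      linarith
    refine ⟨C.p (ξ u), ⟨⟨_, ⟨u, ⟨ha.1.trans hu.1, hu.2⟩, rfl⟩, (hcomp u).symm⟩,
      ⟨_, ⟨-v, ⟨by linarith [hv.2], by linarith [hv.1, hb.2]⟩, rfl⟩, ?_⟩⟩, ?_⟩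
    · rw [huv, hcomp]
    · simp only
      rw [C.isometric _ _ (by rw [huy]; exact hw.2), huy]
  have hpos := volume_le_of_subset_image (lipBound_dist (C.p y)) hsub
  change _ ≤ lengthMeasure Γ' _ at hpos
  rw [hover, Real.volume_Ioo, sub_zero] at hpos
  exact absurd hpos (not_le.2 (ENNReal.ofReal_pos.2 (lt_min (sub_pos.2 hgM) hr)))

/-- A nonexpanding compatible map is injective. -/
lemma Compatible.injective (hφ : Compatible Γ Γ' φ) (h1 : LipBound 1 φ) :
    Function.Injective φ := by
  intro p q hpq
  by_contra hne
  -- The constant path at the common image comes from a homotopy class of paths from `p` to `q`. Its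
  -- tight representative is not constant, but has nullhomotopic image.
  obtain ⟨η, hη⟩ := hφ.exists_path ((Path.refl (φ p)).cast rfl hpq.symm)
  obtain ⟨δ, s, hδη, hδ, hgeo, -⟩ := exists_tight η
  have hgeo : LocGeod (δ : I → Γ.graph.Realization) s := hgeo
  have hs : 0 < s := by
    by_contra hs
    have h2 := hδ 0 1
    rw [δ.source, δ.target] at h2
    have h3 := mul_nonneg (neg_nonneg.2 (not_lt.1 hs)) (dist_nonneg (x := (0 : I)) (y := 1))
    exact hne (dist_le_zero.1 (by linarith))
  -- the image path lifts to a closed path in the tree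
  obtain ⟨C⟩ : Nonempty (TreeCover Γ'.graph.Realization) := ⟨Γ'.treeCover⟩
  obtain ⟨x₀, hx₀⟩ := C.surjective (φ p)
  let γ : C(I, Γ'.graph.Realization) := φ.comp δ.toContinuousMap
  have hγ0 : γ 0 = C.p x₀ := by
    change φ (δ 0) = _
    rw [δ.source, hx₀]
  let ξ := C.isCoveringMap.liftPath γ x₀ hγ0
  have hξ0 : ξ 0 = x₀ := C.isCoveringMap.liftPath_zero _ _ _
  have hξ : ∀ t, C.p (ξ t) = φ (δ t) := congrFun (C.isCoveringMap.liftPath_lifts γ x₀ hγ0)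
  have hξ1 : ξ 1 = x₀ := by
    have hnull : γ.HomotopicRel (ContinuousMap.const I (φ p)) {0, 1} :=
      (hδη.map φ).trans hη
    have := C.isCoveringMap.liftPath_apply_one_eq_of_homotopicRel hnull x₀ hγ0 hx₀.symm
    rw [C.isCoveringMap.liftPath_const hx₀.symm] at this
    exact this
  let P : ℝ → I := Set.projIcc 0 1 zero_le_one
  have hP : Continuous P := continuous_projIcc
  have hP0 : P 0 = 0 := Set.projIcc_left _
  have hP1 : P 1 = 1 := Set.projIcc_right _
  refine hφ.lift_ne h1 C (δ := fun t => δ (P t)) (δ.continuous.comp hP) hs (fun t h0 h2 => ?_)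
    (ξ := fun t => ξ (P t)) (ξ.continuous.comp hP) (fun t => hξ (P t)) ?_
  · obtain ⟨ε, hε, hd⟩ := hgeo.exists_ball (P t)
    have h3 := sub_pos.2 h2
    refine ⟨min (ε / 2) (min t (1 - t)), by positivity, ?_, ?_, fun u v hu hv => ?_⟩
    · linarith [(min_le_right (ε / 2) _).trans (min_le_left t (1 - t))]
    · linarith [(min_le_right (ε / 2) _).trans (min_le_right t (1 - t))]
    · rw [le_min_iff, le_min_iff] at hu hv
      have hmem : ∀ w, |w - t| ≤ t → |w - t| ≤ 1 - t → w ∈ I := fun w h4 h5 => by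
        rw [abs_le] at h4 h5
        exact ⟨by linarith, by linarith⟩
      have hd' := hd (P u) (P v) ((dist_projIcc_le u t).trans_lt (by
        rw [Real.dist_eq]; linarith [hu.1])) ((dist_projIcc_le v t).trans_lt (by
        rw [Real.dist_eq]; linarith [hv.1]))
      rw [hd', Subtype.dist_eq]
      rw [show (P u : ℝ) = u from congrArg Subtype.val
          (Set.projIcc_of_mem zero_le_one (hmem u hu.2.1 hu.2.2)),
        show (P v : ℝ) = v from congrArg Subtype.val
          (Set.projIcc_of_mem zero_le_one (hmem v hv.2.1 hv.2.2)), Real.dist_eq]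
  · rw [hP0, hP1, hξ0, hξ1]

/-- A nonexpanding compatible map is an isometry. -/
lemma Compatible.dist_eq (hφ : Compatible Γ Γ' φ) (h1 : LipBound 1 φ)
    (x y : Γ.graph.Realization) : dist (φ x) (φ y) = dist x y := by
  refine le_antisymm (by simpa using h1 x y) (le_of_forall_gt fun r hr => ?_)
  obtain ⟨r', hr', hr0, ρ, hρ, h0, hρr⟩ := exists_curve hr
  refine lt_of_le_of_lt ?_ hr'
  let B := ρ '' Set.Icc 0 r'
  have hB : IsCompact B := isCompact_Icc.image hρ.continuous
  have hBc : IsPreconnected B := isPreconnected_Icc.image _ hρ.continuous.continuousOn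
  let h : Γ.graph.Realization ≃ₜ Γ'.graph.Realization :=
    φ.continuous.homeoOfEquivCompactToT2
      (f := Equiv.ofBijective φ ⟨hφ.injective h1, hφ.surjective⟩)
  -- The preimage of an almost shortest curve is connected because the map is a homeomorphism. It
  -- has the same length as the curve and contains `x` and `y`, which bounds their distance.
  have hpre : IsPreconnected (φ ⁻¹' B) := (h.isPreconnected_preimage).2 hBc
  have h2 := dist_le_lengthMeasure hpre (x := x) (y := y) ⟨0, ⟨le_rfl, hr0⟩, h0⟩
    ⟨r', ⟨hr0, le_rfl⟩, hρr⟩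
  rw [← lengthMeasure_image hφ h1 (hB.measurableSet.preimage φ.continuous.measurable),
    Set.image_preimage_eq _ hφ.surjective] at h2
  have h3 := hρ.hausdorff_image_le (Set.Icc 0 r')
  rw [hausdorffMeasure_real, Real.volume_Icc, ENNReal.ofReal_one, one_mul, sub_zero] at h3
  exact (ENNReal.ofReal_le_ofReal_iff hr0).1 (h2.trans h3)

/-- Nonexpanding compatible maps are equivalences of marked graphs. -/
lemma Compatible.equivalent (hφ : Compatible Γ Γ' φ) (h1 : LipBound 1 φ) : Equivalent Γ Γ' := by
  let h : Γ.graph.Realization ≃ₜ Γ'.graph.Realization :=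
    φ.continuous.homeoOfEquivCompactToT2
      (f := Equiv.ofBijective φ ⟨hφ.injective h1, hφ.surjective⟩)
  have hh : (h : C(Γ.graph.Realization, Γ'.graph.Realization)) = φ := rfl
  have hd : ∀ x y, dist (h x) (h y) = dist x y := hφ.dist_eq h1
  refine ⟨h, hφ, fun α => ?_⟩
  unfold loopLength
  congr 1
  ext L
  constructor
  · rintro ⟨β, hβ, hL⟩
    refine ⟨(h : C(_, _)).comp β, (ContinuousMap.Homotopic.refl _).comp hβ, fun z => ?_⟩
    obtain ⟨U, hU, hUd⟩ := hL z
    exact ⟨U, hU, fun a ha b hb => (hd _ _).trans (hUd a ha b hb)⟩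
  · rintro ⟨β, hβ, hL⟩
    refine ⟨(h.symm : C(_, _)).comp β, ?_, fun z => ?_⟩
    · have := (ContinuousMap.Homotopic.refl (h.symm : C(Γ'.Space, Γ.Space))).comp hβ
      have e : (h.symm : C(Γ'.Space, Γ.Space)).comp ((h : C(Γ.Space, Γ'.Space)).comp α) = α := by
        ext x; simp
      rwa [e] at this
    · obtain ⟨U, hU, hUd⟩ := hL z
      refine ⟨U, hU, fun a ha b hb => Eq.trans ?_ (hUd a ha b hb)⟩
      have := hd (h.symm (β a)) (h.symm (β b))
      rw [h.apply_symm_apply, h.apply_symm_apply] at this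
      exact this.symm

end Nonexpanding

end MarkedGraph

/-! ### Optimal maps have legal closed walks -/

lemma exists_uniform_pos {ι : Type*} [Finite ι] {Q : ι → ℝ → Prop}
    (h : ∀ i, ∃ δ > 0, ∀ t, 0 < t → t ≤ δ → Q i t) :
    ∃ δ > 0, ∀ t, 0 < t → t ≤ δ → ∀ i, Q i t := by
  choose δ hδ hQ using h
  cases isEmpty_or_nonempty ι
  · exact ⟨1, one_pos, fun t _ _ i => isEmptyElim i⟩
  · obtain ⟨i₀, hi₀⟩ := Finite.exists_min δ
    exact ⟨δ i₀, hδ i₀, fun t h0 h1 i => hQ i t h0 (h1.trans (hi₀ i))⟩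

namespace MarkedGraph

variable {Γ Γ' : MarkedGraph n}

/-- The map is linear with the given slopes. -/
def IsLinear (φ : C(Γ.graph.Realization, Γ'.graph.Realization)) (s : Γ.graph.E → ℝ) : Prop :=
  ∀ e, HasSlope Γ.length Γ'.length φ e (s e) ∧ LipBound (s e * Γ.length e) (edgePath φ e)

lemma IsLinear.lipBound {φ : C(Γ.graph.Realization, Γ'.graph.Realization)} {s : Γ.graph.E → ℝ}
    (h : IsLinear φ s) {K : ℝ} (hK : ∀ e, s e ≤ K) : LipBound K φ := by
  obtain ⟨e₀⟩ := Γ.nonempty_edges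
  have h0 : 0 ≤ s e₀ := nonneg_of_mul_nonneg_left (h e₀).2.nonneg_of_path (Γ.length_pos e₀)
  exact lipBound_of_edges (h0.trans (hK e₀)) fun e =>
    (h e).2.mono (mul_le_mul_of_nonneg_right (hK e) (Γ.length_pos e).le)

lemma IsLinear.stretched {φ : C(Γ.graph.Realization, Γ'.graph.Realization)} {s : Γ.graph.E → ℝ}
    (h : IsLinear φ s) (a : Γ.graph.Dir) : Stretched φ (s a.1) a :=
  stretched_of_locGeod (h a.1).1

/-- A curve that extends the image of an edge by prescribed tails. -/
lemma exists_extended_edge {φ : C(Γ.graph.Realization, Γ'.graph.Realization)} {e : Γ.graph.E}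
    {K : ℝ} (hφ : LipBound K (edgePath φ e)) {l r : ℝ → Γ'.graph.Realization} (hl : LipBound K l)
    (hr : LipBound K r) (hl0 : l 0 = φ (edge e 0)) (hr0 : r 0 = φ (edge e 1)) :
    ∃ γ : ℝ → Γ'.graph.Realization, LipBound K γ ∧ (∀ t : I, γ t = φ (edge e t)) ∧
      (∀ t, 0 ≤ t → γ (-t) = l t) ∧ ∀ t, 0 ≤ t → γ (1 + t) = r t := by
  have hK : 0 ≤ K := hφ.nonneg_of_path
  let m : ℝ → Γ'.graph.Realization := fun t => φ (edge e (Set.projIcc 0 1 zero_le_one t))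
  have hm : LipBound K m := fun x y =>
    (hφ _ _).trans (mul_le_mul_of_nonneg_left (dist_projIcc_le _ _) hK)
  have hm1 : m 1 = φ (edge e 1) := congrArg (fun t => φ (edge e t)) (Set.projIcc_right _)
  have hm0 : m 0 = φ (edge e 0) := congrArg (fun t => φ (edge e t)) (Set.projIcc_left _)
  have hr' : LipBound K (fun t => r (t - 1)) := fun x y => by
    simpa using hr (x - 1) (y - 1)
  have hl' : LipBound K (fun t => l (-t)) := fun x y => by
    simpa using hl (-x) (-y)
  let γ₁ : ℝ → Γ'.graph.Realization := fun t => if t ≤ 1 then m t else r (t - 1)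
  have h1 : LipBound K γ₁ := hm.glue hr' (by rw [sub_self, hr0, hm1])
  have h2 : LipBound K (fun t => if t ≤ 0 then l (-t) else γ₁ t) :=
    hl'.glue h1 (by rw [neg_zero, hl0]; simp [γ₁, hm0])
  refine ⟨_, h2, fun t => ?_, fun t ht => ?_, fun t ht => ?_⟩
  · have hmt : m t = φ (edge e t) := congrArg (fun t => φ (edge e t)) (Set.projIcc_val _ t)
    split_ifs with h
    · have ht : t = 0 := Subtype.ext (le_antisymm h t.2.1)
      rw [ht]
      simpa using hl0
    · simp only [γ₁]
      rw [if_pos t.2.2, hmt]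
  · rw [if_pos (by linarith), neg_neg]
  · rw [if_neg (by linarith)]
    simp only [γ₁]
    split_ifs with h
    · obtain rfl : t = 0 := by linarith
      rw [add_zero, hm1, hr0]
    · rw [add_sub_cancel_left]

open Classical in
/-- If all maximally stretched directions at the end of a maximally stretched edge have the same
image germ, then the image of the vertex can be pushed along this germ, and fewer edges are
maximally stretched. -/
lemma IsLinear.exists_push {φ : C(Γ.graph.Realization, Γ'.graph.Realization)}
    {s : Γ.graph.E → ℝ} (hφ : IsLinear φ s) {κ : ℝ} (hκ : 0 < κ) (hsκ : ∀ e, s e ≤ κ)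
    {a : Γ.graph.Dir} (ha : s a.1 = κ)
    (hno : ∀ b, org b = ter a → s b.1 = κ → SameGerm φ (bar a) b) :
    ∃ ψ : C(Γ.graph.Realization, Γ'.graph.Realization), ∃ s', ψ.Homotopic φ ∧ IsLinear ψ s' ∧
      (∀ e, s' e ≤ κ) ∧ {e | s' e = κ} ⊂ {e | s e = κ} := by
  set v := ter a with hv
  let g : ℝ → Γ'.graph.Realization := fun τ => φ (arc (bar a) τ)
  have hφκ : LipBound κ φ := hφ.lipBound hsκ
  have hg : LipBound κ g := by
    have := hφκ.comp (lipBound_arc (bar a)) hκ.le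
    rwa [mul_one] at this
  have hg0 : g 0 = φ (vert v) := congrArg φ (arc_zero (bar a))
  -- the slopes after adding tails
  let k : Γ.graph.E → ℝ := fun e => if s e = κ then κ else max (s e) (κ / 2)
  have hk1 : ∀ e, s e ≠ κ → k e < κ := fun e he => by
    simp only [k, if_neg he]
    exact max_lt (lt_of_le_of_ne (hsκ e) he) (half_lt_self hκ)
  have hk2 : ∀ e, k e ≤ κ := fun e => by
    by_cases he : s e = κ
    · simp [k, he]
    · exact (hk1 e he).le
  have hk3 : ∀ e, κ / 2 ≤ k e := fun e => by
    simp only [k]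
    split_ifs
    · linarith
    · exact le_max_right _ _
  have hk4 : ∀ e, s e ≤ k e := fun e => by
    simp only [k]
    split_ifs with h
    · exact h.le
    · exact le_max_left _ _
  obtain ⟨r, hr, hclose, -⟩ := Γ'.exists_homotopic_of_close
  obtain ⟨m, hm0, hm⟩ := Γ.exists_length_lower_bound
  obtain ⟨δ₁, hδ₁, hgerm⟩ := exists_uniform_pos (ι := Γ.graph.Dir)
    (Q := fun b t => org b = v → s b.1 = κ → φ (arc b t) = g t) fun b => by
      by_cases hb : org b = v ∧ s b.1 = κ
      · obtain ⟨δ, hδ, h⟩ := hno b hb.1 hb.2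
        exact ⟨δ, hδ, fun t h0 h1 _ _ => (h t ⟨h0.le, h1⟩).symm⟩
      · exact ⟨1, one_pos, fun t _ _ h1 h2 => absurd ⟨h1, h2⟩ hb⟩
  obtain ⟨δ₂, hδ₂, hsmall⟩ := exists_uniform_pos (ι := Γ.graph.E)
    (Q := fun e t => s e ≠ κ → k e * (1 + 4 * t / Γ.length e) < κ) fun e => by
      by_cases he : s e = κ
      · exact ⟨1, one_pos, fun t _ _ h => absurd he h⟩
      · have h1 := Γ.length_pos e
        have h2 := sub_pos.2 (hk1 e he)
        refine ⟨(κ - k e) * Γ.length e / (8 * κ), by positivity, fun t h0 ht _ => ?_⟩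
        have h3 : k e * (4 * t / Γ.length e) ≤ κ * (4 * t / Γ.length e) :=
          mul_le_mul_of_nonneg_right (hk2 e) (by positivity)
        have h4 : κ * (4 * t / Γ.length e) ≤
            κ * (4 * ((κ - k e) * Γ.length e / (8 * κ)) / Γ.length e) := by gcongr
        have h5 : κ * (4 * ((κ - k e) * Γ.length e / (8 * κ)) / Γ.length e) = (κ - k e) / 2 := by
          field_simp; ring
        rw [mul_add, mul_one]
        linarith
  -- `ε` lies within all coinciding germs, keeps slack edges below slope `κ` after adding up to `4 *
  -- ε / Γ.length e` to the parameter interval, moves points by less than the homotopy radius `r`,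
  -- and cuts at most a quarter of an edge at each end.
  obtain ⟨ε, hε, hεδ₁, hεδ₂, hεr, hεm⟩ : ∃ ε > 0, ε ≤ δ₁ ∧ ε ≤ δ₂ ∧ 2 * κ * ε < r ∧ 4 * ε ≤ m := by
    refine ⟨min (min δ₁ δ₂) (min (r / (4 * κ)) (m / 4)), by positivity, ?_, ?_, ?_, ?_⟩
    · exact (min_le_left _ _).trans (min_le_left _ _)
    · exact (min_le_left _ _).trans (min_le_right _ _)
    · have h1 : min (min δ₁ δ₂) (min (r / (4 * κ)) (m / 4)) ≤ r / (4 * κ) :=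
        (min_le_right _ _).trans (min_le_left _ _)
      have h2 := mul_le_mul_of_nonneg_left h1 (show 0 ≤ 2 * κ by positivity)
      have h3 : 2 * κ * (r / (4 * κ)) = r / 2 := by field_simp; ring
      linarith
    · linarith [(min_le_right (min δ₁ δ₂) _).trans (min_le_right (r / (4 * κ)) (m / 4))]
  let fV : Γ.graph.V → Γ'.graph.Realization := fun w => if w = v then g ε else φ (vert w)
  -- The change of the parameter interval at an end in `v`. Maximally stretched edges are cut back.
  -- Other edges get a tail; since tails run along `g` with parameter speed `Γ.length e / 2`, they
  -- reach `g ε` after `2 * (ε / Γ.length e)`.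
  let c : Γ.graph.E → ℝ := fun e => if s e = κ then -(ε / Γ.length e) else 2 * (ε / Γ.length e)
  let α : Γ.graph.E → ℝ := fun e => if Γ.graph.src e = v then c e else 0
  let β : Γ.graph.E → ℝ := fun e => if Γ.graph.tgt e = v then c e else 0
  have hεl : ∀ e, 0 < ε / Γ.length e ∧ ε / Γ.length e ≤ 1 / 4 := fun e =>
    ⟨div_pos hε (Γ.length_pos e), by
      rw [div_le_iff₀ (Γ.length_pos e)]; linarith [hm e]⟩
  have hc : ∀ e, |c e| ≤ 2 * (ε / Γ.length e) := fun e => by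
    have := (hεl e).1
    simp only [c]
    split_ifs
    · rw [abs_neg, abs_of_pos this]; linarith
    · rw [abs_of_pos (by linarith)]
  have hα : ∀ e, |α e| ≤ 2 * (ε / Γ.length e) := fun e => by
    have := (hεl e).1
    simp only [α]
    split_ifs
    · exact hc e
    · rw [abs_zero]; linarith
  have hβ : ∀ e, |β e| ≤ 2 * (ε / Γ.length e) := fun e => by
    have := (hεl e).1
    simp only [β]
    split_ifs
    · exact hc e
    · rw [abs_zero]; linarith
  -- the new images of the edges
  have hcurve : ∀ e, ∃ γ : ℝ → Γ'.graph.Realization, LipBound (k e * Γ.length e) γ ∧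
      (∀ t : I, γ t = φ (edge e t)) ∧ γ (-α e) = fV (Γ.graph.src e) ∧
      γ (1 + β e) = fV (Γ.graph.tgt e) := by
    intro e
    have hle := Γ.length_pos e
    have hkl : 0 ≤ k e * Γ.length e := mul_nonneg (by linarith [hk3 e]) hle.le
    have hφe : LipBound (k e * Γ.length e) (edgePath φ e) :=
      (hφ e).2.mono (mul_le_mul_of_nonneg_right (hk4 e) hle.le)
    have htail : LipBound (k e * Γ.length e) (fun t => g (Γ.length e / 2 * t)) := fun x y => by
      refine (hg _ _).trans ?_
      rw [Real.dist_eq, ← mul_sub, abs_mul, abs_of_pos (half_pos hle), ← Real.dist_eq]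
      have h1 := mul_le_mul_of_nonneg_right (hk3 e)
        (mul_nonneg hle.le (dist_nonneg (x := x) (y := y)))
      linarith
    let tail : Γ.graph.V → ℝ → Γ'.graph.Realization := fun w t =>
      if w = v then g (Γ.length e / 2 * t) else φ (vert w)
    have htail' : ∀ w, LipBound (k e * Γ.length e) (tail w) := fun w => by
      by_cases hw : w = v
      · simpa only [tail, if_pos hw] using htail
      · simpa only [tail, if_neg hw] using LipBound.const _ hkl _
    have htail0 : ∀ w, tail w 0 = φ (vert w) := fun w => by
      simp only [tail]
      split_ifs with hw
      · rw [mul_zero, hg0, hw]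
      · rfl
    obtain ⟨γ, h1, h2, h3, h4⟩ := exists_extended_edge hφe (htail' (Γ.graph.src e))
      (htail' (Γ.graph.tgt e)) (by rw [htail0, edge_zero]) (by rw [htail0, edge_one])
    refine ⟨γ, h1, h2, ?_, ?_⟩
    · simp only [α, fV]
      by_cases hw : Γ.graph.src e = v
      · rw [if_pos hw, if_pos hw]
        -- A maximally stretched edge at `v` starts along the common germ and already passes through
        -- `g ε`, so it is cut there. Any other edge reaches `g ε` along its tail.
        by_cases hs : s e = κ
        · have h5 := hgerm ε hε hεδ₁ (e, true) hw hs
          rw [← h5]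
          simp only [c, if_pos hs, neg_neg]
          have h6 : ε / Γ.length e ∈ I := ⟨(hεl e).1.le, by linarith [(hεl e).2]⟩
          rw [arc_of_mem h6]
          exact h2 ⟨_, h6⟩
        · simp only [c, if_neg hs]
          rw [h3 _ (by linarith [(hεl e).1])]
          simp only [tail, if_pos hw]
          congr 1; field_simp
      · rw [if_neg hw, if_neg hw, neg_zero, ← edge_zero]
        exact h2 0
    · simp only [β, fV]
      by_cases hw : Γ.graph.tgt e = v
      · rw [if_pos hw, if_pos hw]
        by_cases hs : s e = κ
        · have h5 := hgerm ε hε hεδ₁ (e, false) hw hs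
          rw [← h5]
          simp only [c, if_pos hs]
          have h6 : ε / Γ.length e ∈ I := ⟨(hεl e).1.le, by linarith [(hεl e).2]⟩
          rw [arc_of_mem (a := (e, false)) h6]
          exact h2 (unitInterval.symm ⟨_, h6⟩)
        · simp only [c, if_neg hs]
          rw [h4 _ (by linarith [(hεl e).1])]
          simp only [tail, if_pos hw]
          congr 1; field_simp
      · rw [if_neg hw, if_neg hw, add_zero, ← edge_one]
        exact h2 1
  choose γ hγ hγe hγ0 hγ1 using hcurve
  have hpos : ∀ e, 0 ≤ 1 + α e + β e := fun e => by
    have h1 := hεl e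
    have hb : ∀ w, -(1 / 4) ≤ (if w = v then c e else 0) := fun w => by
      simp only [c]
      split_ifs <;> linarith
    have h2 : -(1 / 4) ≤ α e := hb _
    have h3 : -(1 / 4) ≤ β e := hb _
    linarith
  -- The extended or shortened curve, rescaled to the unit interval. This multiplies its Lipschitz
  -- constant by the length `1 + α e + β e` of the parameter interval.
  let P : ∀ e, Path (fV (Γ.graph.src e)) (fV (Γ.graph.tgt e)) := fun e =>
    { toFun := fun t => γ e (-α e + t * (1 + α e + β e))
      continuous_toFun := (hγ e).continuous.comp (by fun_prop)
      source' := by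
        rw [← hγ0]
        congr 1
        simp
      target' := by
        rw [← hγ1]
        congr 1
        simp only [Set.Icc.coe_one]
        ring }
  have hP : ∀ e (t : I), P e t = γ e (-α e + t * (1 + α e + β e)) := fun _ _ => rfl
  let φ' := mapOfPaths fV P
  let K : Γ.graph.E → ℝ := fun e => k e * Γ.length e * (1 + α e + β e)
  have hφ'K : ∀ e, LipBound (K e) (edgePath φ' e) := fun e x y => by
    change dist (P e x) (P e y) ≤ _
    rw [hP, hP]
    refine (hγ e _ _).trans_eq ?_
    rw [Real.dist_eq, Subtype.dist_eq, Real.dist_eq,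
      show -α e + x * (1 + α e + β e) - (-α e + y * (1 + α e + β e)) =
        (1 + α e + β e) * ((x : ℝ) - y) by ring, abs_mul, abs_of_nonneg (hpos e)]
    ring
  have hhom : φ'.Homotopic φ := by
    refine hclose _ _ _ fun x => ?_
    have hedge : ∀ e (t : I), dist (φ' (edge e t)) (φ (edge e t)) < r := by
      intro e t
      change dist (P e t) _ < r
      rw [hP, ← hγe]
      refine ((hγ e _ _).trans ?_).trans_lt hεr
      rw [Real.dist_eq, show -α e + t * (1 + α e + β e) - t = -((1 - t) * α e) + t * β e by ring]
      have h1 : |-((1 - t) * α e) + t * β e| ≤ 2 * (ε / Γ.length e) := by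
        refine (abs_add_le _ _).trans ?_
        rw [abs_neg, abs_mul, abs_mul, abs_of_nonneg t.2.1, abs_of_nonneg (sub_nonneg.2 t.2.2)]
        have h2 := mul_le_mul_of_nonneg_left (hα e) (sub_nonneg.2 t.2.2)
        have h3 := mul_le_mul_of_nonneg_left (hβ e) t.2.1
        linarith
      have hle := Γ.length_pos e
      calc k e * Γ.length e * |-((1 - t) * α e) + t * β e|
          ≤ κ * Γ.length e * (2 * (ε / Γ.length e)) := by
            gcongr
            exact hk2 e
        _ = 2 * κ * ε := by field_simp
    obtain ⟨b, τ, -, rfl⟩ := exists_arc_eq x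
    exact hedge _ _
  obtain ⟨ψ, hψ, hlin⟩ := exists_linear φ' K hφ'K
  choose s' hs'K hs' hs'L using hlin
  have hbound : ∀ e, s' e ≤ k e * (1 + α e + β e) := fun e => by
    refine le_of_mul_le_mul_right ((hs'K e).trans_eq ?_) (Γ.length_pos e)
    simp only [K]; ring
  have hlt : ∀ e, s e ≠ κ → s' e < κ := fun e he => by
    refine (hbound e).trans_lt (lt_of_le_of_lt ?_ (hsmall ε hε hεδ₂ e he))
    refine mul_le_mul_of_nonneg_left ?_ (by linarith [hk3 e])
    have h1 := (le_abs_self _).trans (hα e)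
    have h2 := (le_abs_self _).trans (hβ e)
    rw [mul_div_assoc]
    linarith
  have hle : ∀ e, s e = κ → α e ≤ 0 ∧ β e ≤ 0 := fun e he => by
    have h1 := (hεl e).1
    simp only [α, β, c, if_pos he]
    constructor <;> split_ifs <;> linarith
  have hke : ∀ e, s e = κ → k e = κ := fun e he => if_pos he
  refine ⟨ψ, s', hψ.trans hhom, fun e => ⟨hs' e, hs'L e⟩, fun e => ?_, ?_⟩
  · by_cases he : s e = κ
    · refine (hbound e).trans ?_
      rw [hke e he]
      exact mul_le_of_le_one_right hκ.le (by linarith [(hle e he).1, (hle e he).2])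
    · exact (hlt e he).le
  · refine (Set.ssubset_iff_of_subset fun e he => ?_).2 ⟨a.1, ha, fun h' => ?_⟩
    · by_contra hne
      exact absurd he (hlt e hne).ne
    · have h1 := hbound a.1
      have h2 := hle a.1 ha
      rw [hke _ ha, show s' a.1 = κ from h'] at h1
      have h3 : α a.1 + β a.1 < 0 := by
        have h4 : c a.1 < 0 := by
          simp only [c, if_pos ha]
          linarith [(hεl a.1).1]
        -- The edge of `a` ends at `v` and is cut at least once, so its slope drops strictly and it
        -- leaves the maximal set.
        have h5 : Γ.graph.src a.1 = v ∨ Γ.graph.tgt a.1 = v := by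
          obtain ⟨e, _ | _⟩ := a
          · exact Or.inl rfl
          · exact Or.inr rfl
        rcases h5 with h5 | h5
        · have : α a.1 = c a.1 := if_pos h5
          linarith
        · have : β a.1 = c a.1 := if_pos h5
          linarith
      have h6 := mul_neg_of_pos_of_neg hκ h3
      linarith

/-- There is an optimal linear map such that every maximally stretched edge can be continued by a
maximally stretched edge without creating an illegal turn. -/
lemma IsLinear.exists_legal (N : ℕ) {φ : C(Γ.graph.Realization, Γ'.graph.Realization)}
    {s : Γ.graph.E → ℝ} (hφ : IsLinear φ s) {κ : ℝ} (hκ : 0 < κ) (hsκ : ∀ e, s e ≤ κ)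
    (hN : {e | s e = κ}.ncard = N) :
    ∃ ψ : C(Γ.graph.Realization, Γ'.graph.Realization), ∃ s', ψ.Homotopic φ ∧ IsLinear ψ s' ∧
      (∀ e, s' e ≤ κ) ∧ ∀ a : Γ.graph.Dir, s' a.1 = κ →
        ∃ b, org b = ter a ∧ s' b.1 = κ ∧ ¬ SameGerm ψ (bar a) b := by
  induction N using Nat.strong_induction_on generalizing φ s with
  | h N ih =>
    by_cases h : ∀ a : Γ.graph.Dir, s a.1 = κ →
        ∃ b, org b = ter a ∧ s b.1 = κ ∧ ¬ SameGerm φ (bar a) b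
    · exact ⟨φ, s, ContinuousMap.Homotopic.refl _, hφ, hsκ, h⟩
    · push Not at h
      -- A push decreases the number of maximally stretched edges. If none were left the condition
      -- would be vacuous; this is excluded later by optimality of `κ`.
      obtain ⟨a, ha, hno⟩ := h
      obtain ⟨ψ, s', h1, h2, h3, h4⟩ := hφ.exists_push hκ hsκ ha hno
      obtain ⟨ψ', s'', k1, k2⟩ := ih _ (hN ▸ Set.ncard_lt_ncard h4) h2 h3 rfl
      exact ⟨ψ', s'', k1.trans h1, k2⟩

/-- Equivalent marked graphs are related by a compatible nonexpanding map. -/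
theorem Equivalent.exists_nonexpanding (h : Equivalent Γ Γ') :
    ∃ φ : C(Γ.graph.Realization, Γ'.graph.Realization), Compatible Γ Γ' φ ∧ LipBound 1 φ := by
  obtain ⟨κ, φ₀, hφ₀, hK, -, hopt⟩ := exists_optimal Γ Γ'
  have hκ : 0 < κ := one_pos.trans_le (hφ₀.one_le hK)
  obtain ⟨φ₁, hφ₁, hlin⟩ := exists_linear φ₀ (fun e => κ * Γ.length e) fun e x y => by
    have := (hK (edge e x) (edge e y)).trans
      (mul_le_mul_of_nonneg_left (lipBound_edge e x y) hκ.le)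
    rwa [← mul_assoc] at this
  choose s₁ hs₁ hs₁' hs₁'' using hlin
  obtain ⟨φ, s, hφ, hs, hsκ, hlegal⟩ := IsLinear.exists_legal _ (φ := φ₁) (s := s₁)
    (fun e => ⟨hs₁' e, hs₁'' e⟩) hκ (fun e => le_of_mul_le_mul_right (hs₁ e) (Γ.length_pos e)) rfl
  have hcompat : Compatible Γ Γ' φ := hφ₀.homotopic (hφ.trans hφ₁)
  -- If all slopes were below `κ`, this compatible map would have a smaller Lipschitz constant than
  -- the optimal one.
  obtain ⟨e, he⟩ : ∃ e, s e = κ := by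
    by_contra hne
    push Not at hne
    have := Γ.nonempty_edges
    obtain ⟨e₀, he₀⟩ := Finite.exists_max s
    have := hopt _ φ hcompat (hs.lipBound he₀)
    exact hne e₀ (le_antisymm (hsκ _) this)
  choose f hf1 hf2 hf3 using hlegal
  let D := {a : Γ.graph.Dir // s a.1 = κ}
  let F : D → D := fun a => ⟨f a.1 a.2, hf2 a.1 a.2⟩
  -- Legal continuation is a self-map of a finite set, not necessarily injective, so its orbit is
  -- only eventually periodic. The closed walk starts at the repeated edge `y`.
  obtain ⟨i, j, hij, hF⟩ : ∃ i j : ℕ, i < j ∧ F^[i] ⟨(e, true), he⟩ = F^[j] ⟨(e, true), he⟩ := by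
    obtain ⟨i, j, hne, h⟩ := Finite.exists_ne_map_eq_of_infinite
      fun i : ℕ => F^[i] ⟨(e, true), he⟩
    rcases hne.lt_or_gt with hlt | hlt
    · exact ⟨i, j, hlt, h⟩
    · exact ⟨j, i, hlt, h.symm⟩
  set y := F^[i] ⟨(e, true), he⟩ with hy
  have hper : F^[j - i] y = y := by
    rw [hy, ← Function.iterate_add_apply, Nat.sub_add_cancel hij.le, ← hF]
  obtain ⟨α, L, hL, hα, hφα, -⟩ := exists_loop_of_walk φ hκ (a := fun k => (F^[k] y).1)
    (Nat.sub_pos_of_lt hij) (fun k => by rw [Function.iterate_add_apply, hper])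
    (fun k => by rw [Function.iterate_succ_apply']; exact (hf1 _ _).symm)
    (fun k => by
      have := hs.stretched (F^[k] y).1
      rwa [(F^[k] y).2] at this)
    (fun k => by rw [Function.iterate_succ_apply']; exact hf3 _ _)
  obtain ⟨h, hh, hlen⟩ := h
  have h1 := hlen α
  have h2 : ((h : C(Γ.Space, Γ'.Space)).comp α).Homotopic (φ.comp α) :=
    (Compatible.homotopic_of (φ := (h : C(Γ.Space, Γ'.Space))) hh hcompat).comp
      (ContinuousMap.Homotopic.refl α)
  rw [loopLength_eq (ContinuousMap.Homotopic.refl α) hα, loopLength_eq h2 hφα] at h1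
  -- The legal loop has length `L` and its image has length `κ * L`. The equivalence is homotopic to
  -- `φ` and preserves loop lengths.
  have hκ1 : κ = 1 := by
    have : (κ - 1) * L = 0 := by linarith
    linarith [(mul_eq_zero.1 this).resolve_right hL.ne']
  exact ⟨φ₀, hφ₀, hκ1 ▸ hK⟩

end MarkedGraph

/-! ### The stretch factor -/

lemma LocGeod.lipBound_unit {Y : Type*} [PseudoMetricSpace Y] {c : I → Y} {s : ℝ}
    (h : LocGeod c s) : LipBound s c := by
  have key : ∀ a b : I, a ≤ b → dist (c a) (c b) ≤ s * ((b : ℝ) - a) := by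
    intro a b hab
    have hP : ∀ u ∈ Set.Icc (a : ℝ) b, ∃ hu : u ∈ I, Set.projIcc 0 1 zero_le_one u = ⟨u, hu⟩ :=
      fun u hu => ⟨⟨a.2.1.trans hu.1, hu.2.trans b.2.2⟩, Set.projIcc_of_mem _ _⟩
    have h1 := dist_le_of_locally (f := fun t => c (Set.projIcc 0 1 zero_le_one t)) (s := s)
      (show (a : ℝ) ≤ b from hab) (h.continuous.comp continuous_projIcc).continuousOn
      fun t ht => by
        obtain ⟨ε, hε, hd⟩ := h.exists_ball (Set.projIcc 0 1 zero_le_one t)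
        refine ⟨ε, hε, fun u hu htu hut => ?_⟩
        obtain ⟨hu', hPu⟩ := hP u hu
        obtain ⟨ht', hPt⟩ := hP t ⟨ht.1, ht.2.le⟩
        have h2 : dist (Set.projIcc (0 : ℝ) 1 zero_le_one u) (Set.projIcc 0 1 zero_le_one t) =
            u - t := by
          rw [hPu, hPt, Subtype.dist_eq, Real.dist_eq, abs_of_pos (sub_pos.2 htu)]
        have h3 := hd _ _ ((dist_self _).trans_lt hε) (h2.trans_lt (by linarith))
        rw [h3, dist_comm, h2]
    rwa [Set.projIcc_val, Set.projIcc_val] at h1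
  intro a b
  rcases le_total a b with hab | hab
  · refine (key a b hab).trans_eq ?_
    rw [dist_comm, Subtype.dist_eq, Real.dist_eq, abs_of_nonneg (sub_nonneg.2 (Subtype.coe_le_coe.2 hab))]
  · rw [dist_comm]
    refine (key b a hab).trans_eq ?_
    rw [Subtype.dist_eq, Real.dist_eq, abs_of_nonneg (sub_nonneg.2 (Subtype.coe_le_coe.2 hab))]

/-- Consequently each edge has only one slope, and `maxSlope` is a supremum over a finite set. -/
lemma LocGeod.speed_unique {Y : Type*} [PseudoMetricSpace Y] {c : I → Y} {s s' : ℝ}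
    (h : LocGeod c s) (h' : LocGeod c s') : s = s' := by
  obtain ⟨ε, hε, hd⟩ := h.exists_ball 0
  obtain ⟨ε', hε', hd'⟩ := h'.exists_ball 0
  let t : I := ⟨min (1 / 2) (min (ε / 2) (ε' / 2)), by positivity,
    (min_le_left _ _).trans (by norm_num)⟩
  have ht : 0 < (t : ℝ) := by change 0 < min _ _; positivity
  have h1 : (t : ℝ) ≤ ε / 2 := (min_le_right _ _).trans (min_le_left _ _)
  have h2 : (t : ℝ) ≤ ε' / 2 := (min_le_right _ _).trans (min_le_right _ _)
  have h3 : dist t 0 = t := by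
    rw [Subtype.dist_eq, Real.dist_eq, Set.Icc.coe_zero, sub_zero, abs_of_pos ht]
  have h4 := hd t 0 (by rw [h3]; linarith) (by rwa [dist_self])
  have h5 := hd' t 0 (by rw [h3]; linarith) (by rwa [dist_self])
  rw [h4, h3] at h5
  exact mul_right_cancel₀ ht.ne' h5

namespace MarkedGraph

variable {Γ Γ' Γ'' : MarkedGraph n}

lemma HasSlope.unique {φ : C(Γ.graph.Realization, Γ'.graph.Realization)} {e : Γ.graph.E} {s s' : ℝ}
    (h : HasSlope Γ.length Γ'.length φ e s) (h' : HasSlope Γ.length Γ'.length φ e s') : s = s' :=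
  mul_right_cancel₀ (Γ.length_pos e).ne' (LocGeod.speed_unique (c := fun t : I => φ (edge e t)) h h')

lemma maxSlope_spec {φ : C(Γ.graph.Realization, Γ'.graph.Realization)} {s : Γ.graph.E → ℝ}
    (hs : ∀ e, HasSlope Γ.length Γ'.length φ e (s e)) :
    (∀ e, s e ≤ maxSlope Γ.length Γ'.length φ) ∧ ∃ e, s e = maxSlope Γ.length Γ'.length φ := by
  have : Nonempty Γ.graph.E := Γ.nonempty_edges
  have hset : {t | ∃ e, HasSlope Γ.length Γ'.length φ e t} = Set.range s := by
    ext t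
    exact ⟨fun ⟨e, he⟩ => ⟨e, HasSlope.unique (hs e) he⟩, fun ⟨e, he⟩ => ⟨e, he ▸ hs e⟩⟩
  have hfin := Set.finite_range s
  rw [maxSlope, hset]
  exact ⟨fun e => le_csSup hfin.bddAbove ⟨e, rfl⟩, (Set.range_nonempty s).csSup_mem hfin⟩

lemma IsDifferenceOfMarkings.lipBound {φ : C(Γ.graph.Realization, Γ'.graph.Realization)}
    (h : IsDifferenceOfMarkings Γ Γ' φ) : LipBound (maxSlope Γ.length Γ'.length φ) φ := by
  choose s hs using h.2
  have hlin : IsLinear φ s := fun e => ⟨hs e, LocGeod.lipBound_unit (hs e)⟩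
  exact hlin.lipBound (maxSlope_spec hs).1

variable (Γ Γ') in
/-- The stretch factor is the least Lipschitz constant of a compatible map, and it is the maximal
slope of a difference of markings. -/
lemma stretch_spec : (∃ φ, IsDifferenceOfMarkings Γ Γ' φ ∧
      maxSlope Γ.length Γ'.length φ = stretch Γ Γ') ∧
    ∀ K φ, Compatible Γ Γ' φ → LipBound K φ → stretch Γ Γ' ≤ K := by
  obtain ⟨K, φ₀, hφ₀, hK, hK0, hopt⟩ := exists_optimal Γ Γ'
  obtain ⟨φ, hφ, hlin⟩ := exists_linear φ₀ (fun e => K * Γ.length e) fun e x y => by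
    have := (hK (edge e x) (edge e y)).trans
      (mul_le_mul_of_nonneg_left (lipBound_edge e x y) hK0)
    rwa [← mul_assoc] at this
  choose s hsK hs _ using hlin
  have hdiff : IsDifferenceOfMarkings Γ Γ' φ := ⟨hφ₀.homotopic hφ, fun e => ⟨s e, hs e⟩⟩
  have hle : ∀ ψ, IsDifferenceOfMarkings Γ Γ' ψ → K ≤ maxSlope Γ.length Γ'.length ψ :=
    fun ψ hψ => hopt _ ψ hψ.1 hψ.lipBound
  have hmax : maxSlope Γ.length Γ'.length φ = K := by
    obtain ⟨e, he⟩ := (maxSlope_spec hs).2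
    refine le_antisymm ?_ (hle φ hdiff)
    rw [← he]
    exact le_of_mul_le_mul_right (hsK e) (Γ.length_pos e)
  have hst : stretch Γ Γ' = K := by
    refine le_antisymm (csInf_le ⟨K, ?_⟩ ⟨φ, hdiff, hmax.symm⟩)
      (le_csInf ⟨_, φ, hdiff, rfl⟩ ?_) <;> rintro _ ⟨ψ, hψ, rfl⟩ <;> exact hle ψ hψ
  rw [hst]
  exact ⟨⟨φ, hdiff, hmax⟩, hopt⟩

lemma stretch_le {K : ℝ} {φ : C(Γ.graph.Realization, Γ'.graph.Realization)}
    (hφ : Compatible Γ Γ' φ) (hK : LipBound K φ) : stretch Γ Γ' ≤ K :=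
  (stretch_spec Γ Γ').2 K φ hφ hK

variable (Γ Γ') in
lemma exists_lipBound_stretch : ∃ φ, Compatible Γ Γ' φ ∧ LipBound (stretch Γ Γ') φ := by
  obtain ⟨φ, hφ, h⟩ := (stretch_spec Γ Γ').1
  exact ⟨φ, hφ.1, h ▸ hφ.lipBound⟩

variable (Γ Γ') in
lemma one_le_stretch : 1 ≤ stretch Γ Γ' := by
  obtain ⟨φ, hφ, hK⟩ := exists_lipBound_stretch Γ Γ'
  exact hφ.one_le hK

-- A composite of differences of markings need not be linear on edges. The characterization by
-- Lipschitz constants makes retightening unnecessary here.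
variable (Γ Γ' Γ'') in
lemma stretch_triangle : stretch Γ Γ'' ≤ stretch Γ Γ' * stretch Γ' Γ'' := by
  obtain ⟨φ, hφ, hK⟩ := exists_lipBound_stretch Γ Γ'
  obtain ⟨ψ, hψ, hK'⟩ := exists_lipBound_stretch Γ' Γ''
  rw [mul_comm]
  exact stretch_le (hψ.comp hφ) (hK'.comp hK (zero_le_one.trans (one_le_stretch _ _)))

lemma stretch_eq_one_of_equivalent (h : Equivalent Γ Γ') : stretch Γ Γ' = 1 := by
  obtain ⟨φ, hφ, hK⟩ := h.exists_nonexpanding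
  exact le_antisymm (stretch_le hφ hK) (one_le_stretch _ _)

lemma equivalent_of_stretch_eq_one (h : stretch Γ Γ' = 1) : Equivalent Γ Γ' := by
  obtain ⟨φ, hφ, hK⟩ := exists_lipBound_stretch Γ Γ'
  exact hφ.equivalent (h ▸ hK)

/-- Passing through equivalent graphs costs factors of one in the triangle inequality. -/
lemma stretch_congr {Δ Δ' : MarkedGraph n} (h : Γ ≈ Δ) (h' : Γ' ≈ Δ') :
    stretch Γ Γ' = stretch Δ Δ' := by
  have key : ∀ {Γ Γ' Δ Δ' : MarkedGraph n}, Γ ≈ Δ → Γ' ≈ Δ' → stretch Γ Γ' ≤ stretch Δ Δ' := by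
    intro Γ Γ' Δ Δ' h h'
    refine (stretch_triangle Γ Δ Γ').trans ?_
    rw [stretch_eq_one_of_equivalent h, one_mul]
    refine (stretch_triangle Δ Δ' Γ').trans_eq ?_
    rw [stretch_eq_one_of_equivalent (Setoid.symm h'), mul_one]
  exact le_antisymm (key h h') (key (Setoid.symm h) (Setoid.symm h'))

/-- Precomposing both markings with the same automorphism leaves the map compatible and its
Lipschitz constant unchanged. -/
lemma stretch_act_le (φ : MulAut (FreeGroup (Fin n))) :
    stretch (Γ.act φ) (Γ'.act φ) ≤ stretch Γ Γ' := by
  obtain ⟨ψ, hψ, hK⟩ := exists_lipBound_stretch Γ Γ'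
  exact stretch_le (Γ := Γ.act φ) (Γ' := Γ'.act φ) (φ := ψ)
    (ContinuousMap.Homotopic.comp hψ (ContinuousMap.Homotopic.refl _)) hK

end MarkedGraph

/-! ### The stretch factor on Outer space -/

namespace Outer

/-- The infimum over all representatives is attained on the given ones, since equivalent pairs have
the same stretch factor. -/
lemma stretch_toOuter (Γ Γ' : MarkedGraph n) :
    stretch Γ.toOuter Γ'.toOuter = Γ.stretch Γ' := by
  obtain ⟨⟨φ, hφ, hmax⟩, hle⟩ := MarkedGraph.stretch_spec Γ Γ'
  have hbd : ∀ r ∈ {r | ∃ Δ Δ' : MarkedGraph n, Δ.toOuter = Γ.toOuter ∧ Δ'.toOuter = Γ'.toOuter ∧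
      ∃ φ, MarkedGraph.IsDifferenceOfMarkings Δ Δ' φ ∧ r = maxSlope Δ.length Δ'.length φ},
      Γ.stretch Γ' ≤ r := by
    rintro _ ⟨Δ, Δ', h, h', ψ, hψ, rfl⟩
    rw [← MarkedGraph.stretch_congr (Quotient.exact h) (Quotient.exact h')]
    exact MarkedGraph.stretch_le hψ.1 hψ.lipBound
  exact le_antisymm (csInf_le ⟨_, hbd⟩ ⟨Γ, Γ', rfl, rfl, φ, hφ, hmax.symm⟩)
    (le_csInf ⟨_, Γ, Γ', rfl, rfl, φ, hφ, rfl⟩ hbd)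

lemma one_le_stretch (x y : Outer n) : 1 ≤ stretch x y := by
  induction x using Quotient.inductionOn with
  | h Γ =>
    induction y using Quotient.inductionOn with
    | h Γ' => exact (MarkedGraph.one_le_stretch Γ Γ').trans_eq (stretch_toOuter Γ Γ').symm

lemma stretch_triangle (x y z : Outer n) : stretch x z ≤ stretch x y * stretch y z := by
  induction x using Quotient.inductionOn with
  | h Γ =>
    induction y using Quotient.inductionOn with
    | h Γ' =>
      induction z using Quotient.inductionOn with
      | h Γ'' =>
        have := MarkedGraph.stretch_triangle Γ Γ' Γ''
        rwa [← stretch_toOuter, ← stretch_toOuter, ← stretch_toOuter] at this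

lemma eq_of_stretch_eq_one {x y : Outer n} (h : stretch x y = 1) : x = y := by
  induction x using Quotient.inductionOn with
  | h Γ =>
    induction y using Quotient.inductionOn with
    | h Γ' =>
      exact Quotient.sound (MarkedGraph.equivalent_of_stretch_eq_one
        ((stretch_toOuter Γ Γ').symm.trans h))

lemma stretch_act_le (Φ : OutF n) (x y : Outer n) : stretch (x <• Φ) (y <• Φ) ≤ stretch x y := by
  induction x using Quotient.inductionOn with
  | h Γ =>
    induction y using Quotient.inductionOn with
    | h Γ' =>
      induction Φ using QuotientGroup.induction_on with
      | H φ =>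
        have := MarkedGraph.stretch_act_le (Γ := Γ) (Γ' := Γ') φ
        rwa [← stretch_toOuter, ← stretch_toOuter] at this

/-- The reverse inequality is the same one for `Φ⁻¹`. -/
lemma stretch_act (Φ : OutF n) (x y : Outer n) : stretch (x <• Φ) (y <• Φ) = stretch x y := by
  refine le_antisymm (stretch_act_le Φ x y) ?_
  have h := stretch_act_le Φ⁻¹ (x <• Φ) (y <• Φ)
  rwa [MulOpposite.op_inv, inv_smul_smul, inv_smul_smul] at h

end Outer

end OuterSpace

end

theorem proposition2p4 (n : ℕ) :
    -- independence of the choice of representatives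
    (∀ Γ Γ' : OuterSpace.MarkedGraph n,
      OuterSpace.Outer.d Γ.toOuter Γ'.toOuter = Real.log (Γ.stretch Γ')) ∧
    (∀ x y : OuterSpace.Outer n,
      0 ≤ OuterSpace.Outer.d x y ∧ (OuterSpace.Outer.d x y = 0 → x = y)) ∧
    (∀ x y z : OuterSpace.Outer n,
      OuterSpace.Outer.d x z ≤ OuterSpace.Outer.d x y + OuterSpace.Outer.d y z) ∧
    (∀ (Φ : OuterSpace.OutF n) (x y : OuterSpace.Outer n),
      OuterSpace.Outer.d (x <• Φ) (y <• Φ) = OuterSpace.Outer.d x y) := by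
  open OuterSpace in
  refine ⟨fun Γ Γ' => ?_, fun x y => ⟨?_, fun h => ?_⟩, fun x y z => ?_, fun Φ x y => ?_⟩
  · rw [Outer.d, Outer.stretch_toOuter]
  · exact Real.log_nonneg (Outer.one_le_stretch x y)
  · refine Outer.eq_of_stretch_eq_one ?_
    have h1 := Outer.one_le_stretch x y
    -- Positivity excludes the other real zeros of `Real.log`, at `0` and `-1`.
    exact Real.eq_one_of_pos_of_log_eq_zero (one_pos.trans_le h1) h
  · have h1 := one_pos.trans_le (Outer.one_le_stretch x y)
    have h2 := one_pos.trans_le (Outer.one_le_stretch y z)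
    have h3 := one_pos.trans_le (Outer.one_le_stretch x z)
    rw [Outer.d, Outer.d, Outer.d, ← Real.log_mul h1.ne' h2.ne']
    exact Real.log_le_log h3 (Outer.stretch_triangle x y z)
  · rw [Outer.d, Outer.d, Outer.stretch_act]
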